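/- **Setting.** Let $(\Omega,\mathcal F,\mathbb P)$ be a probability space, $\theta:\Omega\to\Omega$ an invertible bimeasurable ergodic $\mathbb P$-preserving map, and $I=[c,d]$, $c<d$. For each $\omega$ let $T_\omega:I\to I$ be surjective, and let $\mathcal Z^*_\omega$ be a countable family of pairwise disjoint non-degenerate subintervals of $I$ covering $I$ up to a Lebesgue null set, such that $T_\omega$ is continuous and strictly monotone on each $Z\in\mathcal Z^*_\omega$; the map $(\omega,x)\mapsto(\theta\omega,T_\omega x)$ on $\Omega\times I$ is measurable. Put $T^n_\omega=T_{\theta^{n-1}\omega}\circ\dots\circ T_\omega$. Let $D_\omega$ be the set of points of $I$ interior to no $Z\in\mathcal Z_\omega^*$ (the endpoints and the uncovered null set), $S_\omega=\bigcup_{k\ge0}T_\omega^{-k}D_{\theta^k\omega}$, assumed dense in $I$, and $X_\omega=I\setminus S_\omega$. An interval of $X_\omega$ is a set $A\cap X_\omega$ with $A$ an interval. Let $\mathcal Z^n_\omega$ be the partition of $X_\omega$ into the nonempty sets $X_\omega\cap\bigcap_{i<n}T_\omega^{-i}Z_i$, $Z_i\in\mathcal Z^*_{\theta^i\omega}$.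 For a set $A$, $\operatorname{var}_A$ is the total variation on $A$; for functions on $X_\omega$, $\operatorname{var}=\operatorname{var}_{X_\omega}$, and $BV(X_\omega)$ is the set of real functions on $X_\omega$ of finite variation. Let $\varphi:\Omega\times I\to\mathbb R\cup\{-\infty\}$ be summable: $g_{\omega,c}=e^{\varphi_\omega}$ satisfies $\inf_{Z\cap X_\omega}g_{\omega,c}>0$ for all $Z\in\mathcal Z^*_\omega$, $\operatorname{var}_I(g_{\omega,c})<\infty$ and $S^1_\omega:=\sum_{Z\in\mathcal Z^*_\omega}\sup_Zg_{\omega,c}<\infty$; assume $\log S^1_\omega\in L^1(\mathbb P)$. Let $H\subseteq\bigcup_\omega\{\omega\}\times X_\omega$ be measurable, with fibers $H_\omega$. Put $J_\omega=X_\omega\setminus H_\omega$, $\mathbb 1_\omega=\mathbb 1_{J_\omega}$, $K_{\omega,n-1}=\{x\in X_\omega:T^i_\omega x\in J_{\theta^i\omega},\ 0\le i\le n-1\}$, let $g^n_\omega$ be the restriction of $\prod_{i<n}g_{\theta^i\omega,c}\circ T^i_\omega$ to $K_{\omega,n-1}$, and let $\|g^n_\omega\|_\infty$ be its supremum. The open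 operator is $$\mathcal L_\omega f(x)=\sum_{y\in X_\omega,\,T_\omega y=x}f(y)\mathbb 1_\omega(y)g_{\omega,c}(y)\quad(x\in X_{\theta\omega}),\qquad \mathcal L^n_\omega=\mathcal L_{\theta^{n-1}\omega}\circ\dots\circ\mathcal L_\omega .$$ Let $S_{\omega,n}=\{x\in X_\omega:\mathcal L^n_{\theta^{-n}\omega}\mathbb 1_{\theta^{-n}\omega}(x)\ne0\}$, and assume $\bigcap_{n\ge1}S_{\omega,n}\neq\varnothing$ for all $\omega$. Define $$F_\omega(f)=\lim_{n\to\infty}\inf_{x\in S_{\theta^n\omega,n}}\frac{\mathcal L^n_\omega f(x)}{\mathcal L^n_\omega\mathbb 1_\omega(x)},\qquad \rho_\omega=F_{\theta\omega}(\mathcal L_\omega\mathbb 1_\omega),\qquad \rho^n_\omega=\prod_{i<n}\rho_{\theta^i\omega},\qquad \tilde{\mathcal L}^n_\omega=(\rho^n_\omega)^{-1}\mathcal L^n_\omega,$$ where $\rho_\omega>0$ for a.e. $\omega$ and $\log\rho_\omega\in L^1(\mathbb P)$. Fix $a\ge0$, $b\ge1$. For every $\omega$ and $n\ge1$ let $\mathcal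 U_{\omega,n}$ be a finite partition of $I$ with $\operatorname{var}_{U\cap K_{\omega,n-1}}(g^n_\omega)\le a\|g^n_\omega\|_\infty$ and $\sum_{Z\in\mathcal Z^n_\omega}\sup_{Z\cap U\cap K_{\omega,n-1}}g^n_\omega\le b\|g^n_\omega\|_\infty$ for all $U\in\mathcal U_{\omega,n}$ (a supremum over the empty set being $0$), and let $\tilde{\mathcal U}_{\omega,n}$ be a finite partition of $X_\omega$ into intervals of $X_\omega$ that refines $\mathcal U_{\omega,n}$ and each of whose elements is contained in $K_{\omega,n-1}$ or disjoint from it (for instance the coarsest one). Call $U\in\tilde{\mathcal U}_{\omega,n}$ with $U\subseteq K_{\omega,n-1}$ good if $F_\omega(\mathbb 1_U)>0$ and bad if $F_\omega(\mathbb 1_U)=0$. Assume there are $\delta_{\omega,n}>0$ with $\log\delta_{\omega,n}\in L^1(\mathbb P)$ for every $n\ge1$ and $F_\omega(\mathbb 1_U)\ge2\delta_{\omega,n}$ for all good $U$. Two elements contained in $K_{\omega,n-1}$ are contiguous if they share a boundary point or all points of $X_\omega$ between them lie in $\bigcup_{i<n}T_\omega^{-i}H_{\theta^i\omega}$. Let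 $\eta^n_\omega$ be the maximal number of bad elements in a class linked by chains of contiguous bad elements ($0$ if there are none), and assume $\log\eta^n_\omega\in L^1(\mathbb P)$ for every $n\ge1$, with $\log\eta^n_\omega$ read as $0$ where $\eta^n_\omega=0$. Put $$C_{\omega,n}=(\rho^n_\omega)^{-1}\bigl(a+2b+1+(2a+4b)\eta^n_\omega\bigr)\|g^n_\omega\|_\infty .$$ Suppose that there are integers $n\ge1$ with $\log C_{\omega,n}\in L^1(\mathbb P)$ and $\int_\Omega\log C_{\omega,n}\,d\mathbb P<0$, let $N_c$ be the smallest one, and set $\xi=-\frac1{N_c}\int_\Omega\log C_{\omega,N_c}\,d\mathbb P$. **Proposition.** Then $\xi>0$, and for every $\epsilon>0$ there is a measurable function $C_\epsilon:\Omega\to(0,\infty)$ such that for $\mathbb P$-a.e. $\omega$, all $n\ge1$ and all $f\in BV(X_{\theta^{-n}\omega})$, $$\operatorname{var}\bigl(\tilde{\mathcal L}^n_{\theta^{-n}\omega}f\bigr)\le C_\epsilon(\omega)e^{-(\xi-\epsilon)n}\operatorname{var}(f)+C_\epsilon(\omega)F_\omega\bigl(\tilde{\mathcal L}^n_{\theta^{-n}\omega}|f|\bigr);$$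 in particular the left-hand side is finite. -/

import Mathlib

open MeasureTheory Set Filter
open scoped ENNReal

noncomputable section

/-- A finite partition of `A`: finitely many nonempty pairwise disjoint sets with union `A`. -/
def IsFinitePartition (𝒰 : Set (Set ℝ)) (A : Set ℝ) : Prop :=
  𝒰.Finite ∧ ∅ ∉ 𝒰 ∧ 𝒰.PairwiseDisjoint id ∧ ⋃₀ 𝒰 = A

/-- A piecewise monotone random interval map with countably many branches on the compact interval
`I = [c, d]`, driven by an invertible ergodic measure preserving base map `θ`. The maps `T ω` are
total functions on `ℝ` of which only the restriction to `I` is used. -/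
structure RandomIntervalMap (Ω : Type*) [MeasurableSpace Ω] (P : Measure Ω) where
  /-- the invertible base map -/
  θ : Ω ≃ᵐ Ω
  ergodic : Ergodic θ P
  c : ℝ
  d : ℝ
  lt : c < d
  T : Ω → ℝ → ℝ
  mapsTo : ∀ ω, MapsTo (T ω) (Icc c d) (Icc c d)
  surjOn : ∀ ω, SurjOn (T ω) (Icc c d) (Icc c d)
  /-- measurability of the skew product `(ω, x) ↦ (θ ω, T ω x)` on `Ω × I` -/
  measurable : Measurable fun p : Ω × Icc c d => T p.1 p.2
  /-- the intervals of monotonicity of `T ω` (finitely or countably many) -/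
  branches : Ω → Set (Set ℝ)
  countable : ∀ ω, (branches ω).Countable
  subset : ∀ ω, ∀ Z ∈ branches ω, Z ⊆ Icc c d
  interval : ∀ ω, ∀ Z ∈ branches ω, Z.OrdConnected ∧ Z.Nontrivial
  disjoint : ∀ ω, (branches ω).PairwiseDisjoint id
  null : ∀ ω, volume (Icc c d \ ⋃₀ branches ω) = 0
  continuousOn : ∀ ω, ∀ Z ∈ branches ω, ContinuousOn (T ω) Z
  monotoneOn : ∀ ω, ∀ Z ∈ branches ω, StrictMonoOn (T ω) Z ∨ StrictAntiOn (T ω) Z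

namespace RandomIntervalMap

variable {Ω : Type*} [MeasurableSpace Ω] {P : Measure Ω} (R : RandomIntervalMap Ω P)

/-- `T_ω^n = T_{θ^{n-1}ω} ∘ ⋯ ∘ T_ω`. -/
def iter : ℕ → Ω → ℝ → ℝ
  | 0, _, x => x
  | n + 1, ω, x => iter n (R.θ ω) (R.T ω x)

/-- `D_ω`: the points of `I` interior to no branch interval, that is, the endpoints of the branch
intervals together with the null set that these intervals leave uncovered. -/
def disc (ω : Ω) : Set ℝ :=
  {x ∈ Icc R.c R.d | ∀ Z ∈ R.branches ω, x ∉ interior Z}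

/-- The singular set `S_ω = ⋃ₖ T_ω^{-k} D_{θ^k ω}`. -/
def sing (ω : Ω) : Set ℝ :=
  {x ∈ Icc R.c R.d | ∃ k : ℕ, R.iter k ω x ∈ R.disc (R.θ^[k] ω)}

/-- The fiber space `X_ω = I \ S_ω`. -/
def X (ω : Ω) : Set ℝ := Icc R.c R.d \ R.sing ω

/-- An interval of `X_ω`: the trace on `X_ω` of an interval. -/
def IsFiberInterval (ω : Ω) (U : Set ℝ) : Prop :=
  ∃ A : Set ℝ, A.OrdConnected ∧ U = A ∩ R.X ω

/-- The partition `𝒵_ω^n` of `X_ω` into monotonicity intervals of `T_ω^n`: the nonempty sets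
`Z₀ ∩ T_ω^{-1} Z₁ ∩ ⋯ ∩ T_ω^{-(n-1)} Z_{n-1}` in `X_ω`, with `Z_i` a branch interval of
`T_{θ^i ω}`. -/
def cylinders (n : ℕ) (ω : Ω) : Set (Set ℝ) :=
  {C | C.Nonempty ∧ ∃ Z : ℕ → Set ℝ, (∀ i < n, Z i ∈ R.branches (R.θ^[i] ω)) ∧
    C = {x ∈ R.X ω | ∀ i < n, R.iter i ω x ∈ Z i}}

end RandomIntervalMap

/-- A random interval map whose monotonicity partition is a generator, with a summable potential
`φ : Ω × I → ℝ ∪ {-∞}` and a measurable hole `H ⊆ ⋃ {ω} × X_ω`. -/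
structure RandomOpenSystem (Ω : Type*) [MeasurableSpace Ω] (P : Measure Ω) extends
    RandomIntervalMap Ω P where
  /-- the branch partitions are generators -/
  generator : ∀ ω, Icc c d ⊆ closure (toRandomIntervalMap.sing ω)
  φ : Ω → ℝ → EReal
  φ_ne_top : ∀ ω x, φ ω x ≠ ⊤
  weight_pos : ∀ ω, ∀ Z ∈ branches ω, ∃ m : ℝ, 0 < m ∧
    ∀ x ∈ Z ∩ toRandomIntervalMap.X ω, m ≤ (EReal.exp (φ ω x)).toReal
  weight_bv : ∀ ω, BoundedVariationOn (fun x => (EReal.exp (φ ω x)).toReal) (Icc c d)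
  weight_summable : ∀ ω, Summable fun Z : branches ω =>
    sSup ((fun x => (EReal.exp (φ ω x)).toReal) '' (Z : Set ℝ))
  H : Set (Ω × ℝ)
  measurableSet_H : MeasurableSet H
  H_subset : ∀ ω x, (ω, x) ∈ H → x ∈ toRandomIntervalMap.X ω

namespace RandomOpenSystem

variable {Ω : Type*} [MeasurableSpace Ω] {P : Measure Ω} (R : RandomOpenSystem Ω P)

/-- The weight `g_{ω,c} = e^{φ_ω}`. -/
def weight (ω : Ω) (x : ℝ) : ℝ := (EReal.exp (R.φ ω x)).toReal

/-- `S_ω^1 = ∑_Z sup_Z g_{ω,c}`, the sum over the branch intervals. -/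
def weightSum (ω : Ω) : ℝ := ∑' Z : R.branches ω, sSup (R.weight ω '' (Z : Set ℝ))

/-- `g_{ω,c}^n = exp (S_n φ_ω)`, the exponential of the Birkhoff sum. -/
def weightN (n : ℕ) (ω : Ω) (x : ℝ) : ℝ :=
  ∏ i ∈ Finset.range n, R.weight (R.θ^[i] ω) (R.iter i ω x)

/-- `J_ω = X_ω \ H_ω`. -/
def J (ω : Ω) : Set ℝ := {x ∈ R.X ω | (ω, x) ∉ R.H}

/-- The set `K_{ω,n-1}` of the points of `X_ω` that are outside the hole at the times
`0, …, n - 1`. -/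
def survivor (n : ℕ) (ω : Ω) : Set ℝ :=
  {x ∈ R.X ω | ∀ i < n, R.iter i ω x ∈ R.J (R.θ^[i] ω)}

/-- `‖g_ω^n‖_∞`, where `g_ω^n` is the restriction of `g_{ω,c}^n` to `K_{ω,n-1}`. -/
def normWeight (n : ℕ) (ω : Ω) : ℝ := sSup (R.weightN n ω '' R.survivor n ω)

/-- The open transfer operator
`ℒ_ω f (x) = ∑_{y ∈ X_ω, T_ω y = x} f y * 𝟙_{J_ω} y * g_{ω,c} y`. -/
def transfer (ω : Ω) (f : ℝ → ℝ) (x : ℝ) : ℝ :=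
  ∑' y : {y : ℝ // y ∈ R.J ω ∧ R.T ω y = x}, f y * R.weight ω y

/-- `ℒ_ω^n = ℒ_{θ^{n-1}ω} ∘ ⋯ ∘ ℒ_ω`, from functions on `X_ω` to functions on `X_{θ^n ω}`. -/
def transferN : ℕ → Ω → (ℝ → ℝ) → ℝ → ℝ
  | 0, _, f => f
  | n + 1, ω, f => transferN n (R.θ ω) (R.transfer ω f)

/-- `𝟙_ω`, the indicator function of `J_ω`. -/
def one (ω : Ω) : ℝ → ℝ := (R.J ω).indicator 1

/-- `S_{θ^n ω, n}`: the set of the points of `X_{θ^n ω}` at which `ℒ_ω^n 𝟙_ω` does not vanish. -/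
def supp (n : ℕ) (ω : Ω) : Set ℝ :=
  {x ∈ R.X (R.θ^[n] ω) | R.transferN n ω (R.one ω) x ≠ 0}

/-- `S_{ω,∞} = ⋂_{n ≥ 1} S_{ω,n}`. -/
def suppInfty (ω : Ω) : Set ℝ := ⋂ n ≥ 1, R.supp n (R.θ.symm^[n] ω)

/-- The random functional
`F_ω f = lim_n inf_{x ∈ S_{θ^n ω, n}} ℒ_ω^n f (x) / ℒ_ω^n 𝟙_ω (x)`. -/
def F (ω : Ω) (f : ℝ → ℝ) : ℝ :=
  limUnder atTop fun n : ℕ =>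
    ⨅ x : R.supp n ω, R.transferN n ω f x / R.transferN n ω (R.one ω) x

/-- `ρ_ω = F_{θω} (ℒ_ω 𝟙_ω)`. -/
def rho (ω : Ω) : ℝ := R.F (R.θ ω) (R.transfer ω (R.one ω))

/-- `ρ_ω^n = ∏_{i < n} ρ_{θ^i ω}`. -/
def rhoN (n : ℕ) (ω : Ω) : ℝ := ∏ i ∈ Finset.range n, R.rho (R.θ^[i] ω)

/-- The semi-normalized open operator `ℒ̃_ω^n = (ρ_ω^n)⁻¹ ℒ_ω^n`. -/
def normTransferN (n : ℕ) (ω : Ω) (f : ℝ → ℝ) (x : ℝ) : ℝ :=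
  (R.rhoN n ω)⁻¹ * R.transferN n ω f x

/-- The collection `P_{ω,n}(a,b)` of the finite partitions `𝒰` of `I` such that every `U ∈ 𝒰`
satisfies `var_U (g_ω^n) ≤ a ‖g_ω^n‖` and `∑_{Z ∈ 𝒵_ω^n} sup_{Z ∩ U} g_ω^n ≤ b ‖g_ω^n‖`. Here
`g_ω^n` lives on `K_{ω,n-1}`, so variations and suprema are over points of `K_{ω,n-1}`. -/
def IsAdmissible (a b : ℝ) (n : ℕ) (ω : Ω) (𝒰 : Set (Set ℝ)) : Prop :=
  IsFinitePartition 𝒰 (Icc R.c R.d) ∧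
  ∀ U ∈ 𝒰,
    eVariationOn (R.weightN n ω) (U ∩ R.survivor n ω) ≤ ENNReal.ofReal (a * R.normWeight n ω) ∧
    ∑' Z : R.cylinders n ω, ⨆ x ∈ (Z : Set ℝ) ∩ U ∩ R.survivor n ω,
      ENNReal.ofReal (R.weightN n ω x) ≤ ENNReal.ofReal (b * R.normWeight n ω)

/-- `𝒱` is a finite partition of `X_ω` into intervals of `X_ω` that refines `𝒰`, and each of its
elements is either contained in `K_{ω,n-1}` or disjoint from it. -/
def IsAdaptedRefinement (n : ℕ) (ω : Ω) (𝒰 𝒱 : Set (Set ℝ)) : Prop :=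
  IsFinitePartition 𝒱 (R.X ω) ∧
  ∀ V ∈ 𝒱, R.IsFiberInterval ω V ∧ (∃ U ∈ 𝒰, V ⊆ U) ∧
    (V ⊆ R.survivor n ω ∨ Disjoint V (R.survivor n ω))

/-- The elements of `𝒱` contained in `K_{ω,n-1}` whose indicator function has `F_ω > 0`. -/
def good (n : ℕ) (ω : Ω) (𝒱 : Set (Set ℝ)) : Set (Set ℝ) :=
  {V ∈ 𝒱 | V ⊆ R.survivor n ω ∧ 0 < R.F ω (V.indicator 1)}

/-- The elements of `𝒱` contained in `K_{ω,n-1}` whose indicator function has `F_ω = 0`. -/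
def bad (n : ℕ) (ω : Ω) (𝒱 : Set (Set ℝ)) : Set (Set ℝ) :=
  {V ∈ 𝒱 | V ⊆ R.survivor n ω ∧ R.F ω (V.indicator 1) = 0}

/-- Two distinct intervals `U`, `V` of `X_ω` are contiguous if they share a boundary point (for
disjoint intervals this means that their closures meet), or if they are separated by a component of
`⋃_{i < n} T_ω^{-i} H_{θ^i ω}`, that is, all points of `X_ω` lying between them belong to that
set. -/
def Contiguous (n : ℕ) (ω : Ω) (U V : Set ℝ) : Prop :=
  U ≠ V ∧ ((closure U ∩ closure V).Nonempty ∨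
    ∀ x ∈ R.X ω, x ∉ U → x ∉ V → (∃ u ∈ U, ∃ v ∈ V, (u < x ∧ x < v) ∨ (v < x ∧ x < u)) →
      ∃ i < n, (R.θ^[i] ω, R.iter i ω x) ∈ R.H)

/-- `η_ω^n`: the maximal number of contiguous bad elements, i.e. the largest cardinality of a class
of bad elements that are linked by chains of bad elements in which consecutive ones are
contiguous. It is `0` if there are no bad elements. -/
def eta (n : ℕ) (ω : Ω) (𝒱 : Set (Set ℝ)) : ℕ :=
  sSup ((fun U => {V | Relation.ReflTransGen
    (fun A B => A ∈ R.bad n ω 𝒱 ∧ B ∈ R.bad n ω 𝒱 ∧ R.Contiguous n ω A B) U V}.ncard) ''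
      R.bad n ω 𝒱)

/-- The Lasota–Yorke coefficient
`C_{ω,n} = (ρ_ω^n)⁻¹ (a + 2 b + 1 + (2 a + 4 b) η_ω^n) ‖g_ω^n‖`. -/
def lyCoeff (a b : ℝ) (𝒱 : Ω → ℕ → Set (Set ℝ)) (n : ℕ) (ω : Ω) : ℝ :=
  (R.rhoN n ω)⁻¹ *
    ((a + 2 * b + 1 + (2 * a + 4 * b) * (R.eta n ω (𝒱 ω n) : ℝ)) * R.normWeight n ω)

/-- `N` is a positive integer with `-∞ < ∫ log C_{ω,N} dP < 0`. -/
def IsContractionTime (a b : ℝ) (𝒱 : Ω → ℕ → Set (Set ℝ)) (N : ℕ) : Prop :=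
  1 ≤ N ∧ Integrable (fun ω => Real.log (R.lyCoeff a b 𝒱 N ω)) P ∧
    ∫ ω, Real.log (R.lyCoeff a b 𝒱 N ω) ∂P < 0

/-- `ξ = -(1 / N) ∫ log C_{ω,N} dP`. -/
def xi (a b : ℝ) (𝒱 : Ω → ℕ → Set (Set ℝ)) (N : ℕ) : ℝ :=
  -(1 / (N : ℝ)) * ∫ ω, Real.log (R.lyCoeff a b 𝒱 N ω) ∂P

end RandomOpenSystem

end

/-! The proof combines a Lasota–Yorke inequality for a fixed number of steps with an ergodic
iteration of it along backward orbits.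

Fixed `n`. `ℒ_ω^n f` is a sum, over the surviving partition elements `U` and the cylinders `C`, of
`f * g_ω^n` on `C ∩ U` carried forward by a monotone branch. Each summand has at most the variation
of `f * g_ω^n` on `C ∩ U` plus two boundary jumps (`pushforward_le`), and admissibility turns the
sum over `C` into `‖g‖ var_U f + (a + 2b) ‖g‖ sup_U |f|`. It remains to sum `sup_U |f|` over `U`
(`sum_sSup_abs_le_of_ordered`). On a good `U` the supremum is at most infimum plus variation, and
the infima sum to at most `F |f| / (2δ)`, because `F` is superadditive and `F 𝟙_U ≥ 2δ`. A bad
element is compared with the last good element to its left. A run of bad elements not interrupted by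
a good one is linked by contiguity, hence has at most `η` members. Bad elements with no good one to
their left are covered by `|f| ≤ F |f| + var f`. The coefficient of `var f` that results is exactly
`C_{ω,n}`.

Iteration. Since `F (ℒ f) ≥ ρ F f` for nonnegative `f` (`rho_mul_F_le`), `F` does not decrease along
the normalized operators, so the final value `F_ω (ℒ̃^n |f|)` dominates every error term. Blocks of
length `N = N_c` contract on average. As `θ^N` need not be ergodic, the maximal ergodic theorem is
used only to find a phase `s < N` at which the products of the block coefficients decay
exponentially (`Ergodic.ae_exists_bddAbove_birkhoffSum_iterate`). The remaining coefficients have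
logarithms dominated by an integrable function, so they grow subexponentially along the orbit. The
incomplete blocks at the two ends are crossed by single steps. `exists_exp_bound_of_block` puts this
together with a constant depending on `ω` only through one integer, which can be chosen measurably.
-/

/-! ### Calculus of the variation on subsets of a linear order. -/

namespace eVariationOn

/-- A monotone sequence in `s ∪ t` crosses from `s` to `t` at most once. Its sum splits at the
crossing, which costs a single jump. -/
theorem union_le_add {α E : Type*} [LinearOrder α] [PseudoEMetricSpace E] (f : α → E)
    {s t : Set α} {C : ℝ≥0∞} (h : ∀ x ∈ s, ∀ y ∈ t, x ≤ y)
    (hC : ∀ x ∈ s, ∀ y ∈ t, edist (f x) (f y) ≤ C) :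
    eVariationOn f (s ∪ t) ≤ eVariationOn f s + C + eVariationOn f t := by
  refine iSup_le ?_
  rintro ⟨n, u, hu, hus⟩
  simp only
  by_cases hall : ∀ i ≤ n, u i ∈ s
  · refine (sum_le_of_monotoneOn_Iic (hu.monotoneOn _) hall).trans ?_
    rw [add_assoc]
    exact le_self_add
  push Not at hall
  classical
  obtain ⟨hkn, hks⟩ := Nat.find_spec hall
  set k := Nat.find hall
  have hmin : ∀ i < k, u i ∈ s := fun i hi => by
    have := Nat.find_min hall hi
    push Not at this
    exact this (hi.le.trans hkn)
  -- A return to `s` after index `k` would force `u i = u k`, since `u k ∈ t` lies to the right of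
  -- `s`.
  have ht : ∀ i ≥ k, u i ∈ t := fun i hi => by
    refine (hus i).resolve_left fun hs => ?_
    have hkt := (hus k).resolve_left hks
    exact hks ((le_antisymm (hu hi) (h _ hs _ hkt)) ▸ hs)
  have hright : ∑ i ∈ Finset.Ico k n, edist (f (u (i + 1))) (f (u i)) ≤ eVariationOn f t :=
    sum_le_of_monotoneOn_Icc (hu.monotoneOn _) fun i hi => ht i hi.1
  rcases Nat.eq_zero_or_pos k with hk0 | hk0
  · rw [hk0, ← Finset.range_eq_Ico] at hright
    exact hright.trans le_add_self
  obtain ⟨j, hj⟩ : ∃ j, k = j + 1 := ⟨k - 1, by omega⟩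
  rw [← Finset.sum_range_add_sum_Ico _ hkn, hj, Finset.sum_range_succ]
  rw [hj] at hright
  refine add_le_add (add_le_add ?_ ?_) hright
  · exact sum_le_of_monotoneOn_Iic (hu.monotoneOn _) fun i hi => hmin i (by omega)
  · rw [edist_comm]
    exact hC _ (hmin j (by omega)) _ (ht _ (by omega))

theorem sum_le_of_ordered {ι α E : Type*} [LinearOrder α] [PseudoEMetricSpace E] (f : α → E)
    {A : ι → Set α} (t : Finset ι)
    (hA : ∀ i ∈ t, ∀ j ∈ t, i ≠ j →
      (∀ x ∈ A i, ∀ y ∈ A j, x < y) ∨ (∀ x ∈ A i, ∀ y ∈ A j, y < x)) :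
    ∑ i ∈ t, eVariationOn f (A i) ≤ eVariationOn f (⋃ i ∈ t, A i) := by
  classical
  rcases isEmpty_or_nonempty α with hα | hα
  · simp [eVariationOn.subsingleton f (subsingleton_of_subsingleton)]
  -- The induction inserts the sets by increasing representative. The arbitrary representative of an
  -- empty set is harmless: the order claims about that set are vacuous.
  let r : ι → α := fun i => if h : (A i).Nonempty then h.some else Classical.arbitrary α
  have hr : ∀ i, (A i).Nonempty → r i ∈ A i := fun i h => by simp [r, h, h.some_mem]
  induction t using Finset.induction_on_max_value r with
  | empty => simp
  | insert a s has hmax ih =>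
    rw [Finset.sum_insert has, Finset.set_biUnion_insert, add_comm, union_comm]
    refine (add_le_add_left (ih fun i hi j hj => hA i (Finset.mem_insert_of_mem hi) j
      (Finset.mem_insert_of_mem hj)) _).trans (add_le_union f ?_)
    intro x hx y hy
    simp only [mem_iUnion] at hx
    obtain ⟨i, hi, hx⟩ := hx
    rcases hA i (Finset.mem_insert_of_mem hi) a (Finset.mem_insert_self _ _)
      (fun h => has (h ▸ hi)) with h | h
    · exact (h x hx y hy).le
    · exact absurd (h _ (hr i ⟨x, hx⟩) _ (hr a ⟨y, hy⟩)) (hmax i hi).not_gt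

theorem tsum_le_of_ordered {ι α E : Type*} [LinearOrder α] [PseudoEMetricSpace E] (f : α → E)
    {A : ι → Set α} {s : Set α} (hs : ∀ i, A i ⊆ s)
    (hA : ∀ i j, i ≠ j → (∀ x ∈ A i, ∀ y ∈ A j, x < y) ∨ (∀ x ∈ A i, ∀ y ∈ A j, y < x)) :
    ∑' i, eVariationOn f (A i) ≤ eVariationOn f s := by
  rw [ENNReal.tsum_eq_iSup_sum]
  exact iSup_le fun t => (sum_le_of_ordered f t fun i _ j _ => hA i j).trans
    (mono f (iUnion₂_subset fun i _ => hs i))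

theorem mul_le {α : Type*} [LinearOrder α] (f g : α → ℝ) {s : Set α} {Cf Cg : ℝ≥0∞}
    (hf : ∀ x ∈ s, ‖f x‖ₑ ≤ Cf) (hg : ∀ x ∈ s, ‖g x‖ₑ ≤ Cg) :
    eVariationOn (fun x => f x * g x) s ≤ Cg * eVariationOn f s + Cf * eVariationOn g s := by
  refine iSup_le ?_
  rintro ⟨n, u, hu, hus⟩
  simp only
  calc ∑ i ∈ Finset.range n, edist (f (u (i + 1)) * g (u (i + 1))) (f (u i) * g (u i))
      ≤ ∑ i ∈ Finset.range n, (Cg * edist (f (u (i + 1))) (f (u i))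
          + Cf * edist (g (u (i + 1))) (g (u i))) := by
        refine Finset.sum_le_sum fun i _ => ?_
        rw [edist_eq_enorm_sub, edist_eq_enorm_sub, edist_eq_enorm_sub]
        have : f (u (i + 1)) * g (u (i + 1)) - f (u i) * g (u i)
            = g (u (i + 1)) * (f (u (i + 1)) - f (u i))
              + f (u i) * (g (u (i + 1)) - g (u i)) := by ring
        rw [this]
        refine (enorm_add_le _ _).trans ?_
        rw [enorm_mul, enorm_mul]
        gcongr
        · exact hg _ (hus _)
        · exact hf _ (hus _)
    _ ≤ _ := by
        rw [Finset.sum_add_distrib, ← Finset.mul_sum, ← Finset.mul_sum]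
        gcongr <;> exact sum_le hu hus

/-- Pointwise convergence is enough: every increment of `H` is the sum of the increments of the `h
i`, and the finite sum over the points of subdivision commutes with the sum over `i`. -/
theorem le_tsum_of_hasSum {ι α : Type*} [LinearOrder α] {h : ι → α → ℝ} {H : α → ℝ} {s : Set α}
    (hH : ∀ x ∈ s, HasSum (fun i => h i x) (H x)) :
    eVariationOn H s ≤ ∑' i, eVariationOn (h i) s := by
  refine iSup_le ?_
  rintro ⟨n, u, hu, hus⟩
  simp only
  calc ∑ k ∈ Finset.range n, edist (H (u (k + 1))) (H (u k))
      ≤ ∑ k ∈ Finset.range n, ∑' i, edist (h i (u (k + 1))) (h i (u k)) := by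
        refine Finset.sum_le_sum fun k _ => ?_
        simp only [edist_eq_enorm_sub]
        have hsum := (hH _ (hus (k + 1))).sub (hH _ (hus k))
        refine le_of_tendsto hsum.enorm (Eventually.of_forall fun t => ?_)
        exact (enorm_sum_le _ _).trans (ENNReal.sum_le_tsum t)
    _ = ∑' i, ∑ k ∈ Finset.range n, edist (h i (u (k + 1))) (h i (u k)) :=
        (Summable.tsum_finsetSum fun _ _ => ENNReal.summable).symm
    _ ≤ _ := ENNReal.tsum_le_tsum fun i => sum_le hu hus

/-- The variation of a function pushed forward along one monotone branch `Φ` on `A` and extended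
by zero: the two jumps at the ends of the image cost twice the supremum. -/
theorem pushforward_le {α β : Type*} [LinearOrder α] [LinearOrder β] {Φ : α → β} {A : Set α}
    {Y : Set β} (hΦ : StrictMonoOn Φ A ∨ StrictAntiOn Φ A)
    (hconv : ∀ y₁ ∈ A, ∀ y₂ ∈ A, ∀ x ∈ Y, Φ y₁ ≤ x → x ≤ Φ y₂ → x ∈ Φ '' A)
    {h : β → ℝ} {G : α → ℝ} (hG : ∀ y ∈ A, h (Φ y) = G y) (h0 : ∀ x ∈ Y, x ∉ Φ '' A → h x = 0)
    {C : ℝ≥0∞} (hC : ∀ y ∈ A, ‖G y‖ₑ ≤ C) :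
    eVariationOn h Y ≤ eVariationOn G A + 2 * C := by
  classical
  set B := Φ '' A with hB
  rcases isEmpty_or_nonempty α with hα | hα
  · have : eVariationOn h Y = 0 := by
      refine eVariationOn.constant_on ?_
      rintro _ ⟨x, hx, rfl⟩ _ ⟨y, hy, rfl⟩
      have hBe : B = ∅ := by simp [hB, Set.eq_empty_of_isEmpty A]
      rw [h0 x hx (by simp [hBe]), h0 y hy (by simp [hBe])]
    simp [this]
  rcases B.eq_empty_or_nonempty with hBe | ⟨b₀, hb₀⟩
  · have : eVariationOn h Y = 0 := by
      refine eVariationOn.constant_on ?_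
      rintro _ ⟨x, hx, rfl⟩ _ ⟨y, hy, rfl⟩
      rw [h0 x hx (by simp [hBe]), h0 y hy (by simp [hBe])]
    simp [this]
  have hinj : InjOn Φ A := hΦ.elim StrictMonoOn.injOn StrictAntiOn.injOn
  -- On the image, `h` is `G` composed with the inverse branch, which is monotone or antitone and so
  -- does not increase the variation.
  have hBvar : eVariationOn h B ≤ eVariationOn G A := by
    have hψ : ∀ x ∈ B, Function.invFunOn Φ A x ∈ A := fun x hx => Function.invFunOn_mem hx
    have hψ' : ∀ x ∈ B, Φ (Function.invFunOn Φ A x) = x := fun x hx => Function.invFunOn_eq hx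
    have heq : EqOn h (G ∘ Function.invFunOn Φ A) B := fun x hx => by
      simp only [Function.comp]
      rw [← hG _ (hψ x hx), hψ' x hx]
    rw [eVariationOn.congr heq]
    rcases hΦ with hm | hm
    · refine eVariationOn.comp_le_of_monotoneOn G _ (fun x hx y hy hxy => ?_) hψ
      rw [← hm.le_iff_le (hψ x hx) (hψ y hy), hψ' x hx, hψ' y hy]
      exact hxy
    · refine eVariationOn.comp_le_of_antitoneOn G _ (fun x hx y hy hxy => ?_) hψ
      rw [← hm.le_iff_ge (hψ x hx) (hψ y hy), hψ' x hx, hψ' y hy]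
      exact hxy
  have hnorm : ∀ x ∈ B, ‖h x‖ₑ ≤ C := by
    rintro _ ⟨y, hy, rfl⟩
    rw [hG y hy]
    exact hC y hy
  -- By `hconv` the points of `Y` outside the image lie entirely to its left (`L`) or to its right
  -- (`M`). Both parts carry the value zero, so only the two crossings cost anything.
  let L : Set β := {x ∈ Y | x ∉ B ∧ ∃ b ∈ B, x < b}
  let M : Set β := {x ∈ Y | x ∉ B ∧ ∃ b ∈ B, b < x}
  have hcv : ∀ b₁ ∈ B, ∀ b₂ ∈ B, ∀ x ∈ Y, b₁ ≤ x → x ≤ b₂ → x ∈ B := by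
    rintro _ ⟨y₁, h₁, rfl⟩ _ ⟨y₂, h₂, rfl⟩ x hx hx1 hx2
    exact hconv _ h₁ _ h₂ x hx hx1 hx2
  have hLB : ∀ x ∈ L, ∀ b ∈ B, x < b := by
    rintro x ⟨hxY, hxB, b', hb', hlt⟩ b hb
    by_contra hle
    exact hxB (hcv b hb b' hb' x hxY (not_lt.mp hle) hlt.le)
  have hBM : ∀ b ∈ B, ∀ x ∈ M, b < x := by
    rintro b hb x ⟨hxY, hxB, b', hb', hlt⟩
    by_contra hle
    exact hxB (hcv b' hb' b hb x hxY hlt.le (not_lt.mp hle))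
  have hLM : ∀ x ∈ L, ∀ y ∈ M, x < y := fun x hx y hy =>
    (hLB x hx b₀ hb₀).trans (hBM b₀ hb₀ y hy)
  have hL0 : ∀ x ∈ L, h x = 0 := fun x hx => h0 x hx.1 hx.2.1
  have hM0 : ∀ x ∈ M, h x = 0 := fun x hx => h0 x hx.1 hx.2.1
  have hYsub : Y ⊆ (L ∪ B) ∪ M := by
    intro x hx
    by_cases hxB : x ∈ B
    · exact Or.inl (Or.inr hxB)
    rcases lt_trichotomy x b₀ with hlt | heq | hlt
    · exact Or.inl (Or.inl ⟨hx, hxB, b₀, hb₀, hlt⟩)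
    · exact absurd (heq ▸ hb₀) hxB
    · exact Or.inr ⟨hx, hxB, b₀, hb₀, hlt⟩
  have zero_on : ∀ S : Set β, (∀ x ∈ S, h x = 0) → eVariationOn h S = 0 := by
    intro S hS
    refine eVariationOn.constant_on ?_
    rintro _ ⟨x, hx, rfl⟩ _ ⟨y, hy, rfl⟩
    rw [hS x hx, hS y hy]
  calc eVariationOn h Y ≤ eVariationOn h ((L ∪ B) ∪ M) := eVariationOn.mono h hYsub
    _ ≤ eVariationOn h (L ∪ B) + C + eVariationOn h M := by
        refine union_le_add h ?_ ?_
        · rintro x (hx | hx) y hy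
          exacts [(hLM x hx y hy).le, (hBM x hx y hy).le]
        · rintro x (hx | hx) y hy
          · simp [hL0 x hx, hM0 y hy]
          · rw [hM0 y hy, edist_zero_right]
            exact hnorm x hx
    _ ≤ (eVariationOn h L + C + eVariationOn h B) + C + eVariationOn h M := by
        gcongr
        refine union_le_add h (fun x hx y hy => (hLB x hx y hy).le) fun x hx y hy => ?_
        rw [hL0 x hx, edist_zero_left]
        exact hnorm y hy
    _ ≤ eVariationOn G A + 2 * C := by
        rw [zero_on L hL0, zero_on M hM0, zero_add, add_zero, two_mul, add_comm C, add_assoc]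
        gcongr

end eVariationOn

theorem BoundedVariationOn.abs_le_abs_add {α : Type*} [LinearOrder α] {f : α → ℝ} {s : Set α}
    (hf : BoundedVariationOn f s) {x y : α} (hx : x ∈ s) (hy : y ∈ s) :
    |f x| ≤ |f y| + (eVariationOn f s).toReal := by
  have h1 := hf.dist_le hx hy
  rw [Real.dist_eq] at h1
  have h2 := abs_sub_abs_le_abs_sub (f x) (f y)
  linarith

/-! ### Maximal ergodic theorem and growth along orbits. -/

/-- The maximal function `max (0, h, h + h ∘ τ, …)` of the first `n` Birkhoff sums. -/
def birkhoffMax {Ω : Type*} (τ : Ω → Ω) (h : Ω → ℝ) : ℕ → Ω → ℝ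
  | 0, _ => 0
  | n + 1, ω => max 0 (h ω + birkhoffMax τ h n (τ ω))

section birkhoffMax

variable {Ω : Type*} {τ : Ω → Ω} {h : Ω → ℝ}

theorem birkhoffMax_nonneg (n : ℕ) (ω : Ω) : 0 ≤ birkhoffMax τ h n ω := by
  cases n with
  | zero => exact le_rfl
  | succ n => exact le_max_left _ _

theorem birkhoffMax_le_succ (n : ℕ) (ω : Ω) :
    birkhoffMax τ h n ω ≤ birkhoffMax τ h (n + 1) ω := by
  induction n generalizing ω with
  | zero => exact birkhoffMax_nonneg _ _
  | succ n ih =>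
    rw [birkhoffMax, birkhoffMax]
    gcongr
    exact ih _

theorem birkhoffMax_mono (ω : Ω) : Monotone fun n => birkhoffMax τ h n ω :=
  monotone_nat_of_le_succ fun n => birkhoffMax_le_succ n ω

theorem birkhoffSum_le_birkhoffMax (n : ℕ) (ω : Ω) :
    birkhoffSum τ h n ω ≤ birkhoffMax τ h n ω := by
  induction n generalizing ω with
  | zero => simp [birkhoffMax]
  | succ n ih =>
    rw [birkhoffSum_succ', birkhoffMax]
    exact (add_le_add_right (ih _) _).trans (le_max_right _ _)

variable [MeasurableSpace Ω] {P : Measure Ω}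

theorem measurable_birkhoffMax (hτ : Measurable τ) (hh : Measurable h) (n : ℕ) :
    Measurable (birkhoffMax τ h n) := by
  induction n with
  | zero => exact measurable_const
  | succ n ih => exact measurable_const.max (hh.add (ih.comp hτ))

theorem integrable_birkhoffMax (hτ : MeasurePreserving τ P P) (hh : Integrable h P) (n : ℕ) :
    Integrable (birkhoffMax τ h n) P := by
  induction n with
  | zero => exact integrable_zero _ _ _
  | succ n ih => exact (integrable_zero _ _ _).sup (hh.add (hτ.integrable_comp_of_integrable ih))

/-- The maximal ergodic theorem, in the case that almost every point has a positive Birkhoff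
sum. -/
theorem integral_nonneg_of_ae_exists_birkhoffSum_pos (hτ : MeasurePreserving τ P P)
    (hh : Integrable h P) (hm : Measurable h) (hpos : ∀ᵐ ω ∂P, ∃ n, 0 < birkhoffSum τ h n ω) :
    0 ≤ ∫ ω, h ω ∂P := by
  set A : ℕ → Set Ω := fun n => {ω | 0 < birkhoffMax τ h (n + 1) ω}
  have hA : ∀ n, MeasurableSet (A n) := fun n =>
    measurableSet_lt measurable_const (measurable_birkhoffMax hτ.measurable hm (n + 1))
  have key : ∀ n, 0 ≤ ∫ ω, (A n).indicator h ω ∂P := by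
    intro n
    have h1 : Integrable (fun ω => birkhoffMax τ h n (τ ω)) P :=
      hτ.integrable_comp_of_integrable (integrable_birkhoffMax hτ hh n)
    have h2 := integrable_birkhoffMax hτ hh (n + 1)
    have h3 : ∫ ω, birkhoffMax τ h n (τ ω) ∂P = ∫ ω, birkhoffMax τ h n ω ∂P := by
      have hasm : AEStronglyMeasurable (birkhoffMax τ h n) (Measure.map τ P) := by
        rw [hτ.map_eq]
        exact (integrable_birkhoffMax hτ hh n).aestronglyMeasurable
      rw [← integral_map hτ.measurable.aemeasurable hasm, hτ.map_eq]
    have h4 : ∫ ω, birkhoffMax τ h n ω ∂P ≤ ∫ ω, birkhoffMax τ h (n + 1) ω ∂P :=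
      integral_mono (integrable_birkhoffMax hτ hh n) h2 fun ω => birkhoffMax_le_succ n ω
    -- Garsia's pointwise inequality: on `A n` the difference equals `h`, and off `A n` it is at
    -- most zero. Its integral is nonnegative by invariance of `P` and monotonicity in `n`.
    have h5 : ∫ ω, (birkhoffMax τ h (n + 1) ω - birkhoffMax τ h n (τ ω)) ∂P
        ≤ ∫ ω, (A n).indicator h ω ∂P := by
      refine integral_mono (h2.sub h1) (hh.indicator (hA n)) fun ω => ?_
      by_cases hω : ω ∈ A n
      · have hω' : 0 < birkhoffMax τ h (n + 1) ω := hω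
        simp only [indicator_of_mem hω]
        rw [birkhoffMax] at hω' ⊢
        rcases lt_max_iff.mp hω' with h0 | h0
        · exact absurd h0 (lt_irrefl 0)
        · rw [max_eq_right h0.le]
          linarith
      · have hω' : ¬ 0 < birkhoffMax τ h (n + 1) ω := hω
        simp only [indicator_of_notMem hω]
        have := birkhoffMax_nonneg (τ := τ) (h := h) n (τ ω)
        linarith [not_lt.mp hω']
    rw [integral_sub h2 h1] at h5
    linarith
  have hlim : Tendsto (fun n => ∫ ω, (A n).indicator h ω ∂P) atTop (nhds (∫ ω, h ω ∂P)) := by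
    refine tendsto_integral_of_dominated_convergence (fun ω => ‖h ω‖)
      (fun n => (hh.indicator (hA n)).aestronglyMeasurable) hh.norm
      (fun n => Eventually.of_forall fun ω => norm_indicator_le_norm_self _ _) ?_
    filter_upwards [hpos] with ω ⟨m, hω⟩
    refine tendsto_const_nhds.congr' ?_
    filter_upwards [eventually_ge_atTop m] with n hn
    refine (indicator_of_mem ?_ _).symm
    exact (hω.trans_le (birkhoffSum_le_birkhoffMax m ω)).trans_le
      (birkhoffMax_mono ω (hn.trans n.le_succ))
  exact ge_of_tendsto' hlim key

/-- If `T` is ergodic and `∫ h < 0`, then for almost every `ω` one of the points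
`ω, T ω, …, T^(N-1) ω` has Birkhoff sums under `T^N` that are bounded above. -/
theorem Ergodic.ae_exists_bddAbove_birkhoffSum_iterate {T : Ω → Ω} (hT : Ergodic T P)
    [IsProbabilityMeasure P] (hh : Integrable h P) (hm : Measurable h) (hneg : ∫ ω, h ω ∂P < 0)
    {N : ℕ} (hN : 1 ≤ N) :
    ∀ᵐ ω ∂P, ∃ s < N, BddAbove (range fun m => birkhoffSum T^[N] h m (T^[s] ω)) := by
  have hτ : MeasurePreserving T^[N] P P := hT.toMeasurePreserving.iterate N
  set B : Set Ω := {ω | BddAbove (range fun m => birkhoffSum T^[N] h m ω)} with hB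
  have hBinv : ∀ ω, T^[N] ω ∈ B ↔ ω ∈ B := by
    intro ω
    constructor
    · rintro ⟨K, hK⟩
      refine ⟨max 0 (h ω + K), ?_⟩
      rintro _ ⟨m, rfl⟩
      cases m with
      | zero => simp
      | succ m =>
        refine le_max_of_le_right ?_
        simp only [birkhoffSum_succ']
        exact add_le_add_right (hK ⟨m, rfl⟩) _
    · rintro ⟨K, hK⟩
      refine ⟨K - h ω, ?_⟩
      rintro _ ⟨m, rfl⟩
      have := hK ⟨m + 1, rfl⟩
      simp only [birkhoffSum_succ'] at this
      simp only
      linarith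
  have hsum : ∀ m, Measurable (birkhoffSum T^[N] h m) := fun m => by
    unfold birkhoffSum
    exact Finset.measurable_fun_sum _ fun k _ => hm.comp (hτ.measurable.iterate k)
  have hBm : MeasurableSet B := by
    have : B = ⋃ K : ℕ, ⋂ m : ℕ, {ω | birkhoffSum T^[N] h m ω ≤ K} := by
      ext ω
      simp only [hB, mem_ofPred_eq, mem_iUnion, mem_iInter]
      constructor
      · rintro ⟨K, hK⟩
        obtain ⟨k, hk⟩ := exists_nat_ge K
        exact ⟨k, fun m => (hK ⟨m, rfl⟩).trans hk⟩
      · rintro ⟨K, hK⟩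
        refine ⟨K, ?_⟩
        rintro _ ⟨m, rfl⟩
        exact hK m
    rw [this]
    exact .iUnion fun K => .iInter fun m => measurableSet_le (hsum m) measurable_const
  -- `B` is invariant only under `T^N`, which need not be ergodic. The union of its preimages over
  -- one period is invariant under `T` itself, hence null or of full measure.
  set E : Set Ω := {ω | ∃ s < N, T^[s] ω ∈ B} with hE
  have hEm : MeasurableSet E := by
    have : E = ⋃ s ∈ Finset.range N, T^[s] ⁻¹' B := by
      ext ω
      simp [hE]
    rw [this]
    exact .biUnion (Finset.countable_toSet _) fun s _ => hT.measurable.iterate s hBm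
  have hEinv : T ⁻¹' E = E := by
    ext ω
    simp only [hE, mem_preimage, mem_ofPred_eq, ← Function.iterate_succ_apply]
    constructor
    · rintro ⟨s, hs, hsB⟩
      rcases Nat.lt_or_ge (s + 1) N with h1 | h1
      · exact ⟨s + 1, h1, hsB⟩
      · have : s.succ = N := by omega
        rw [this] at hsB
        exact ⟨0, by omega, (hBinv ω).mp hsB⟩
    · rintro ⟨s, hs, hsB⟩
      cases s with
      | zero =>
        refine ⟨N - 1, by omega, ?_⟩
        have : (N - 1).succ = N := by omega
        rw [this]
        exact (hBinv ω).mpr hsB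
      | succ s => exact ⟨s, by omega, hsB⟩
  rcases hT.toPreErgodic.ae_mem_or_ae_notMem hEm hEinv with hmem | hnot
  · exact hmem
  · exfalso
    -- If `E` were null, almost every point would have Birkhoff sums that are unbounded above, in
    -- particular a positive one, against `∫ h < 0`.
    refine hneg.not_ge (integral_nonneg_of_ae_exists_birkhoffSum_pos hτ hh hm ?_)
    filter_upwards [hnot] with ω hω
    by_contra! hcon
    refine hω ⟨0, by omega, 0, ?_⟩
    rintro _ ⟨m, rfl⟩
    exact hcon m

/-- Borel–Cantelli: integrability makes the probabilities of `h > ε j` summable, invariance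
transfers this to `h ∘ τ^j`, and so `h (τ^j ω) ≤ ε j` for all large `j`. -/
theorem MeasureTheory.MeasurePreserving.ae_bddAbove_sub_mul [IsProbabilityMeasure P]
    (hτ : MeasurePreserving τ P P) (hh : Integrable h P) (hm : Measurable h) (h0 : 0 ≤ h) {ε : ℝ}
    (hε : 0 < ε) : ∀ᵐ ω ∂P, BddAbove (range fun j : ℕ => h (τ^[j] ω) - ε * j) := by
  have h1 : ∑' j : ℕ, P {ω | h ω / ε ∈ Ioi (j : ℝ)} < ∞ := by
    let : MeasureSpace Ω := ⟨P⟩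
    have : IsProbabilityMeasure (volume : Measure Ω) := ‹IsProbabilityMeasure P›
    exact ProbabilityTheory.tsum_prob_mem_Ioi_lt_top (X := fun ω => h ω / ε) (hh.div_const ε)
      fun ω => div_nonneg (h0 ω) hε.le
  have h2 : ∀ j : ℕ, P (τ^[j] ⁻¹' {ω | h ω / ε ∈ Ioi (j : ℝ)})
      = P {ω | h ω / ε ∈ Ioi (j : ℝ)} := fun j =>
    (hτ.iterate j).measure_preimage
      ((hm.div_const ε) measurableSet_Ioi).nullMeasurableSet
  have h3 := ae_eventually_notMem (μ := P)
    (s := fun j : ℕ => τ^[j] ⁻¹' {ω | h ω / ε ∈ Ioi (j : ℝ)}) (by simp only [h2]; exact h1.ne)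
  filter_upwards [h3] with ω hω
  obtain ⟨m, hm⟩ := eventually_atTop.mp hω
  obtain ⟨K, hK⟩ := ((Finset.range m).image fun j : ℕ => h (τ^[j] ω) - ε * j).bddAbove
  refine ⟨max 0 K, ?_⟩
  rintro _ ⟨j, rfl⟩
  rcases Nat.lt_or_ge j m with hj | hj
  · refine le_max_of_le_right (hK ?_)
    simp only [Finset.coe_image, mem_image]
    exact ⟨j, by simpa using hj, rfl⟩
  · refine le_max_of_le_left ?_
    have := hm j hj
    simp only [mem_preimage, mem_ofPred_eq, mem_Ioi, not_lt, div_le_iff₀ hε] at this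
    linarith

end birkhoffMax

/-! ### Itineraries and cylinders in the fiber spaces. -/

/-- Disjoint traces of intervals on a set `X` are ordered. -/
theorem ordered_of_disjoint_trace {α : Type*} [LinearOrder α] {X A B : Set α}
    (hA : A.OrdConnected) (hB : B.OrdConnected) (hd : Disjoint (A ∩ X) (B ∩ X)) :
    (∀ x ∈ A ∩ X, ∀ y ∈ B ∩ X, x < y) ∨ (∀ x ∈ A ∩ X, ∀ y ∈ B ∩ X, y < x) := by
  by_contra! hcon
  obtain ⟨⟨x₁, hx₁, y₁, hy₁, h₁⟩, x₂, hx₂, y₂, hy₂, h₂⟩ := hcon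
  rw [Set.disjoint_left] at hd
  rcases le_total x₂ y₁ with h | h
  · exact hd ⟨hA.out hx₂.1 hx₁.1 ⟨h, h₁⟩, hy₁.2⟩ hy₁
  · exact hd hx₂ ⟨hB.out hy₁.1 hy₂.1 ⟨h, h₂⟩, hx₂.2⟩

namespace RandomIntervalMap

variable {Ω : Type*} [MeasurableSpace Ω] {P : Measure Ω} (R : RandomIntervalMap Ω P) {ω : Ω}
  {x y : ℝ} {n : ℕ}

theorem iter_add (m n : ℕ) (ω : Ω) (x : ℝ) :
    R.iter (n + m) ω x = R.iter m (R.θ^[n] ω) (R.iter n ω x) := by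
  induction n generalizing ω x with
  | zero => simp [iter]
  | succ n ih =>
    rw [Nat.succ_add]
    exact ih _ _

variable {R}

theorem iter_mem_Icc (hx : x ∈ Icc R.c R.d) (n : ℕ) : R.iter n ω x ∈ Icc R.c R.d := by
  induction n generalizing ω x with
  | zero => exact hx
  | succ n ih => exact ih (R.mapsTo ω hx)

theorem mem_X_iff :
    x ∈ R.X ω ↔ x ∈ Icc R.c R.d ∧ ∀ k, R.iter k ω x ∉ R.disc (R.θ^[k] ω) := by
  simp only [X, sing, Set.mem_sdiff, mem_ofPred_eq, not_and, not_exists]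
  exact ⟨fun h => ⟨h.1, h.2 h.1⟩, fun h => ⟨h.1, fun _ => h.2⟩⟩

theorem mem_Icc_of_mem_X (hx : x ∈ R.X ω) : x ∈ Icc R.c R.d := hx.1

theorem iter_mem_X (hx : x ∈ R.X ω) (n : ℕ) : R.iter n ω x ∈ R.X (R.θ^[n] ω) := by
  rw [mem_X_iff] at hx ⊢
  refine ⟨iter_mem_Icc hx.1 n, fun k => ?_⟩
  rw [← R.iter_add, ← Function.iterate_add_apply, add_comm k n]
  exact hx.2 (n + k)

theorem map_mem_X (hx : x ∈ R.X ω) : R.T ω x ∈ R.X (R.θ ω) := iter_mem_X hx 1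

theorem notMem_disc_of_mem_interior {Z : Set ℝ} (hZ : Z ∈ R.branches ω) (hx : x ∈ interior Z) :
    x ∉ R.disc ω := fun h => h.2 Z hZ hx

theorem exists_mem_interior (hx : x ∈ R.X ω) : ∃ Z ∈ R.branches ω, x ∈ interior Z := by
  have h := (mem_X_iff.mp hx).2 0
  simp only [disc, mem_ofPred_eq, not_and, not_forall, not_not] at h
  obtain ⟨Z, hZ, hxZ⟩ := h (mem_Icc_of_mem_X hx)
  exact ⟨Z, hZ, hxZ⟩

theorem branch_unique {Z Z' : Set ℝ} (hZ : Z ∈ R.branches ω) (hZ' : Z' ∈ R.branches ω)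
    (hx : x ∈ Z) (hx' : x ∈ Z') : Z = Z' :=
  (R.disjoint ω).elim_set hZ hZ' x hx hx'

theorem mem_interior_of_mem {Z : Set ℝ} (hx : x ∈ R.X ω) (hZ : Z ∈ R.branches ω) (hxZ : x ∈ Z) :
    x ∈ interior Z := by
  obtain ⟨Z', hZ', hxZ'⟩ := exists_mem_interior hx
  rwa [branch_unique hZ hZ' hxZ (interior_subset hxZ')]

variable (R) in
/-- The open interval on which `T_ω^n` follows the branch itinerary `Z`. -/
def itinerary (n : ℕ) (ω : Ω) (Z : ℕ → Set ℝ) : Set ℝ :=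
  {x | ∀ i < n, R.iter i ω x ∈ interior (Z i)}

variable (R) in
theorem itinerary_succ (n : ℕ) (ω : Ω) (Z : ℕ → Set ℝ) :
    R.itinerary (n + 1) ω Z =
      interior (Z 0) ∩ R.T ω ⁻¹' R.itinerary n (R.θ ω) fun i => Z (i + 1) := by
  ext x
  constructor
  · intro h
    exact ⟨h 0 (Nat.succ_pos _), fun i hi => h (i + 1) (Nat.succ_lt_succ hi)⟩
  · rintro ⟨h0, h⟩ i hi
    cases i with
    | zero => exact h0
    | succ i => exact h i (Nat.lt_of_succ_lt_succ hi)

/-- Peeling off the first map, a monotone map pulls order-connected sets back to order-connected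
sets, while continuity and strict monotonicity compose. -/
theorem itinerary_regular {Z : ℕ → Set ℝ} (hZ : ∀ i < n, Z i ∈ R.branches (R.θ^[i] ω)) :
    (R.itinerary n ω Z).OrdConnected ∧ ContinuousOn (R.iter n ω) (R.itinerary n ω Z) ∧
      (StrictMonoOn (R.iter n ω) (R.itinerary n ω Z) ∨
        StrictAntiOn (R.iter n ω) (R.itinerary n ω Z)) := by
  induction n generalizing ω Z with
  | zero =>
    have : R.itinerary 0 ω Z = univ := by
      ext x
      simp [itinerary]
    rw [this]
    exact ⟨ordConnected_univ, continuousOn_id, Or.inl fun x _ y _ h => h⟩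
  | succ n ih =>
    obtain ⟨h1, h2, h3⟩ := ih (ω := R.θ ω) (Z := fun i => Z (i + 1))
      fun i hi => hZ (i + 1) (Nat.succ_lt_succ hi)
    have hZ0 : Z 0 ∈ R.branches ω := hZ 0 (Nat.succ_pos _)
    have hint : (interior (Z 0)).OrdConnected := (R.interval ω _ hZ0).1.interior
    have hmono := R.monotoneOn ω _ hZ0
    rw [itinerary_succ]
    set D := R.itinerary n (R.θ ω) fun i => Z (i + 1)
    have hmaps : MapsTo (R.T ω) (interior (Z 0) ∩ R.T ω ⁻¹' D) D := fun x hx => hx.2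
    have hsub : interior (Z 0) ∩ R.T ω ⁻¹' D ⊆ Z 0 := fun x hx => interior_subset hx.1
    refine ⟨⟨fun x hx y hy z hz => ?_⟩, ?_, ?_⟩
    · have hzi : z ∈ interior (Z 0) := hint.out hx.1 hy.1 hz
      refine ⟨hzi, ?_⟩
      rcases hmono with h | h
      · exact h1.out hx.2 hy.2 ⟨h.monotoneOn (hsub hx) (interior_subset hzi) hz.1,
          h.monotoneOn (interior_subset hzi) (hsub hy) hz.2⟩
      · exact h1.out hy.2 hx.2 ⟨h.antitoneOn (interior_subset hzi) (hsub hy) hz.2,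
          h.antitoneOn (hsub hx) (interior_subset hzi) hz.1⟩
    · exact h2.comp ((R.continuousOn ω _ hZ0).mono hsub) hmaps
    · rcases hmono with h | h <;> rcases h3 with h' | h'
      · exact Or.inl (h'.comp (h.mono hsub) hmaps)
      · exact Or.inr (h'.comp_strictMonoOn (h.mono hsub) hmaps)
      · exact Or.inr (h'.comp_strictAntiOn (h.mono hsub) hmaps)
      · exact Or.inl (h'.comp (h.mono hsub) hmaps)

/-- The intermediate value theorem gives the preimage. It avoids the singular set: before time `n`
its orbit is interior to branches, and from time `n` on it is the orbit of `x`. Thus a branch has a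
convex image within the fiber space, although that space has dense complement in `I`. -/
theorem exists_iter_eq_of_mem_X {Z : ℕ → Set ℝ} (hZ : ∀ i < n, Z i ∈ R.branches (R.θ^[i] ω))
    {y₁ y₂ : ℝ} (h₁ : y₁ ∈ R.itinerary n ω Z) (h₂ : y₂ ∈ R.itinerary n ω Z) (hX₁ : y₁ ∈ R.X ω)
    (hX₂ : y₂ ∈ R.X ω) (hx : x ∈ R.X (R.θ^[n] ω)) (hle₁ : R.iter n ω y₁ ≤ x)
    (hle₂ : x ≤ R.iter n ω y₂) :
    ∃ y ∈ uIcc y₁ y₂, y ∈ R.itinerary n ω Z ∧ y ∈ R.X ω ∧ R.iter n ω y = x := by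
  obtain ⟨hord, hcont, -⟩ := itinerary_regular hZ
  have hsub : uIcc y₁ y₂ ⊆ R.itinerary n ω Z := hord.uIcc_subset h₁ h₂
  obtain ⟨y, hy, hyx⟩ := intermediate_value_uIcc (hcont.mono hsub)
    (Icc_subset_uIcc ⟨hle₁, hle₂⟩)
  refine ⟨y, hy, hsub hy, ?_, hyx⟩
  rw [mem_X_iff]
  refine ⟨ordConnected_Icc.uIcc_subset hX₁.1 hX₂.1 hy, fun k => ?_⟩
  rcases Nat.lt_or_ge k n with hk | hk
  · exact notMem_disc_of_mem_interior (hZ k hk) (hsub hy k hk)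
  · obtain ⟨m, rfl⟩ := Nat.exists_eq_add_of_le hk
    rw [R.iter_add, hyx, add_comm n m, Function.iterate_add_apply]
    exact (mem_X_iff.mp hx).2 m

/-- A point of the fiber space that belongs to a branch is interior to it, so cylinders are traces
of the itinerary sets, where `T^n` is known to be continuous and monotone. -/
theorem mem_cylinders_iff {C : Set ℝ} :
    C ∈ R.cylinders n ω ↔ C.Nonempty ∧ ∃ Z : ℕ → Set ℝ,
      (∀ i < n, Z i ∈ R.branches (R.θ^[i] ω)) ∧ C = R.itinerary n ω Z ∩ R.X ω := by
  simp only [cylinders, mem_ofPred_eq]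
  refine and_congr_right fun _ => exists_congr fun Z => and_congr_right fun hZ => ?_
  have : {x ∈ R.X ω | ∀ i < n, R.iter i ω x ∈ Z i} = R.itinerary n ω Z ∩ R.X ω := by
    ext x
    constructor
    · rintro ⟨hx, h⟩
      exact ⟨fun i hi => mem_interior_of_mem (iter_mem_X hx i) (hZ i hi) (h i hi), hx⟩
    · rintro ⟨h, hx⟩
      exact ⟨hx, fun i hi => interior_subset (h i hi)⟩
  rw [this]

theorem exists_mem_cylinder (n : ℕ) (hx : x ∈ R.X ω) : ∃ C ∈ R.cylinders n ω, x ∈ C := by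
  have h : ∀ i, ∃ Z ∈ R.branches (R.θ^[i] ω), R.iter i ω x ∈ interior Z := fun i =>
    exists_mem_interior (iter_mem_X hx i)
  choose Z hZ hxZ using h
  exact ⟨R.itinerary n ω Z ∩ R.X ω, mem_cylinders_iff.mpr
    ⟨⟨x, fun i _ => hxZ i, hx⟩, Z, fun i _ => hZ i, rfl⟩, fun i _ => hxZ i, hx⟩

theorem cylinder_unique {C C' : Set ℝ} (hC : C ∈ R.cylinders n ω) (hC' : C' ∈ R.cylinders n ω)
    (hx : x ∈ C) (hx' : x ∈ C') : C = C' := by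
  obtain ⟨-, Z, hZ, rfl⟩ := hC
  obtain ⟨-, Z', hZ', rfl⟩ := hC'
  ext y
  have : ∀ i < n, Z i = Z' i := fun i hi => branch_unique (hZ i hi) (hZ' i hi) (hx.2 i hi)
    (hx'.2 i hi)
  exact and_congr_right fun _ => forall₂_congr fun i hi => by rw [this i hi]

end RandomIntervalMap

/-! ### The open transfer operator and its iterates. -/

namespace RandomOpenSystem

variable {Ω : Type*} [MeasurableSpace Ω] {P : Measure Ω} {R : RandomOpenSystem Ω P} {ω : Ω}
  {x y : ℝ} {n : ℕ} {f : ℝ → ℝ} {M : ℝ}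

open RandomIntervalMap

theorem weight_nonneg : 0 ≤ R.weight ω x := ENNReal.toReal_nonneg

theorem bddAbove_weight_image {Z : Set ℝ} (hZ : Z ∈ R.branches ω) :
    BddAbove (R.weight ω '' Z) := by
  have hbv : BoundedVariationOn (R.weight ω) (Icc R.c R.d) := R.weight_bv ω
  have hc : R.c ∈ Icc R.c R.d := left_mem_Icc.mpr R.lt.le
  refine ⟨|R.weight ω R.c| + (eVariationOn (R.weight ω) (Icc R.c R.d)).toReal, ?_⟩
  rintro _ ⟨x, hx, rfl⟩
  exact (le_abs_self _).trans (hbv.abs_le_abs_add (R.subset ω Z hZ hx) hc)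

theorem weight_le_sSup {Z : Set ℝ} (hZ : Z ∈ R.branches ω) (hx : x ∈ Z) :
    R.weight ω x ≤ sSup (R.weight ω '' Z) :=
  le_csSup (bddAbove_weight_image hZ) (mem_image_of_mem _ hx)

theorem sSup_weight_nonneg (Z : Set ℝ) : 0 ≤ sSup (R.weight ω '' Z) := by
  refine Real.sSup_nonneg ?_
  rintro _ ⟨x, -, rfl⟩
  exact weight_nonneg

theorem weightSum_nonneg : 0 ≤ R.weightSum ω := tsum_nonneg fun _ => sSup_weight_nonneg _

theorem weight_le_weightSum (hx : x ∈ R.X ω) : R.weight ω x ≤ R.weightSum ω := by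
  obtain ⟨Z, hZ, hxZ⟩ := exists_mem_interior hx
  exact (weight_le_sSup hZ (interior_subset hxZ)).trans
    ((R.weight_summable ω).le_tsum (⟨Z, hZ⟩ : R.branches ω) fun _ _ => sSup_weight_nonneg _)

theorem J_subset_X : R.J ω ⊆ R.X ω := fun _ h => h.1

/-- `T_ω` is injective on each branch, so a fiber meets each branch at most once. This bounds sums
of weights over fibers by `weightSum`. -/
theorem exists_branch_injective (x : ℝ) :
    ∃ e : {y : ℝ // y ∈ R.J ω ∧ R.T ω y = x} → R.branches ω, Function.Injective e ∧
      ∀ y, (y : ℝ) ∈ (e y : Set ℝ) := by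
  have h : ∀ y : {y : ℝ // y ∈ R.J ω ∧ R.T ω y = x}, ∃ Z ∈ R.branches ω, (y : ℝ) ∈ interior Z :=
    fun y => exists_mem_interior (J_subset_X y.2.1)
  choose Z hZ hyZ using h
  refine ⟨fun y => ⟨Z y, hZ y⟩, fun y₁ y₂ h => ?_, fun y => interior_subset (hyZ y)⟩
  have hZe : Z y₁ = Z y₂ := congrArg Subtype.val h
  have hinj : InjOn (R.T ω) (Z y₁) :=
    (R.monotoneOn ω _ (hZ y₁)).elim StrictMonoOn.injOn StrictAntiOn.injOn
  exact Subtype.ext (hinj (interior_subset (hyZ y₁)) (hZe ▸ interior_subset (hyZ y₂))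
    (y₁.2.2.trans y₂.2.2.symm))

theorem summable_weight_fiber (x : ℝ) :
    Summable (fun y : {y : ℝ // y ∈ R.J ω ∧ R.T ω y = x} => R.weight ω y) ∧
      ∑' y : {y : ℝ // y ∈ R.J ω ∧ R.T ω y = x}, R.weight ω y ≤ R.weightSum ω := by
  obtain ⟨e, he, hmem⟩ := exists_branch_injective (R := R) (ω := ω) x
  have hs : Summable fun Z : R.branches ω => sSup (R.weight ω '' (Z : Set ℝ)) :=
    R.weight_summable ω
  have hle : ∀ y : {y : ℝ // y ∈ R.J ω ∧ R.T ω y = x}, R.weight ω y ≤ sSup (R.weight ω '' (e y : Set ℝ)) := fun y =>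
    weight_le_sSup (e y).2 (hmem y)
  have h1 := Summable.of_nonneg_of_le (fun _ => weight_nonneg) hle (hs.comp_injective he)
  refine ⟨h1, (h1.tsum_le_tsum hle (hs.comp_injective he)).trans ?_⟩
  exact tsum_comp_le_tsum_of_inj hs (fun _ => sSup_weight_nonneg _) he

theorem summable_transfer (hf : ∀ y ∈ R.J ω, |f y| ≤ M) (x : ℝ) :
    Summable fun y : {y : ℝ // y ∈ R.J ω ∧ R.T ω y = x} => f y * R.weight ω y := by
  refine Summable.of_norm_bounded ((summable_weight_fiber x).1.mul_left M) fun y => ?_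
  rw [norm_mul, Real.norm_eq_abs, Real.norm_of_nonneg weight_nonneg]
  exact mul_le_mul_of_nonneg_right (hf y y.2.1) weight_nonneg

theorem transfer_mono {g : ℝ → ℝ} {M' : ℝ} (hf : ∀ y ∈ R.J ω, |f y| ≤ M)
    (hg : ∀ y ∈ R.J ω, |g y| ≤ M') (h : ∀ y ∈ R.J ω, f y ≤ g y) (x : ℝ) :
    R.transfer ω f x ≤ R.transfer ω g x :=
  (summable_transfer hf x).tsum_le_tsum
    (fun y => mul_le_mul_of_nonneg_right (h y y.2.1) weight_nonneg) (summable_transfer hg x)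

theorem transfer_const_mul (c : ℝ) (f : ℝ → ℝ) :
    R.transfer ω (fun y => c * f y) = fun x => c * R.transfer ω f x := by
  ext x
  simp only [transfer, mul_assoc, tsum_mul_left]

theorem transfer_add {g : ℝ → ℝ} {M' : ℝ} (hf : ∀ y ∈ R.J ω, |f y| ≤ M)
    (hg : ∀ y ∈ R.J ω, |g y| ≤ M') :
    R.transfer ω (fun y => f y + g y) = fun x => R.transfer ω f x + R.transfer ω g x := by
  ext x
  simp only [transfer, add_mul]
  exact (summable_transfer hf x).tsum_add (summable_transfer hg x)

theorem abs_transfer_le_transfer_abs (hf : ∀ y ∈ R.J ω, |f y| ≤ M) (x : ℝ) :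
    |R.transfer ω f x| ≤ R.transfer ω (fun y => |f y|) x := by
  have h := (summable_transfer hf x).norm
  refine (norm_tsum_le_tsum_norm h).trans_eq (tsum_congr fun y => ?_)
  rw [norm_mul, Real.norm_eq_abs, Real.norm_of_nonneg weight_nonneg]

theorem abs_transfer_le (hf : ∀ y ∈ R.J ω, |f y| ≤ M) (hM : 0 ≤ M) (x : ℝ) :
    |R.transfer ω f x| ≤ M * R.weightSum ω := by
  refine (abs_transfer_le_transfer_abs hf x).trans ?_
  have h1 := (summable_weight_fiber (R := R) (ω := ω) x)
  calc R.transfer ω (fun y => |f y|) x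
      ≤ ∑' y : {y : ℝ // y ∈ R.J ω ∧ R.T ω y = x}, M * R.weight ω y :=
        (summable_transfer (f := fun y => |f y|) (fun y hy => (abs_abs _).trans_le (hf y hy))
          x).tsum_le_tsum (fun y => mul_le_mul_of_nonneg_right (hf y y.2.1) weight_nonneg)
          (h1.1.mul_left M)
    _ = M * ∑' y : {y : ℝ // y ∈ R.J ω ∧ R.T ω y = x}, R.weight ω y := tsum_mul_left
    _ ≤ _ := mul_le_mul_of_nonneg_left h1.2 hM

theorem transfer_congr {g : ℝ → ℝ} (h : ∀ y ∈ R.J ω, f y = g y) :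
    R.transfer ω f = R.transfer ω g := by
  ext x
  exact tsum_congr fun y => by rw [h y y.2.1]

theorem transferN_add (m n : ℕ) (ω : Ω) (f : ℝ → ℝ) :
    R.transferN (n + m) ω f = R.transferN m (R.θ^[n] ω) (R.transferN n ω f) := by
  induction n generalizing ω f with
  | zero => simp [transferN]
  | succ n ih =>
    rw [Nat.succ_add]
    exact ih _ _

theorem transferN_succ' (n : ℕ) (ω : Ω) (f : ℝ → ℝ) :
    R.transferN (n + 1) ω f = R.transfer (R.θ^[n] ω) (R.transferN n ω f) := transferN_add 1 n ω f

theorem transferN_const_mul (c : ℝ) (f : ℝ → ℝ) (n : ℕ) (ω : Ω) :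
    R.transferN n ω (fun y => c * f y) = fun x => c * R.transferN n ω f x := by
  induction n generalizing ω f with
  | zero => rfl
  | succ n ih => rw [transferN, transfer_const_mul, ih, transferN]

/-- `f` is bounded on the fiber `X_ω`. -/
def IsBddOn (R : RandomOpenSystem Ω P) (ω : Ω) (f : ℝ → ℝ) : Prop :=
  ∃ M, 0 ≤ M ∧ ∀ x ∈ R.X ω, |f x| ≤ M

theorem IsBddOn.transfer (hf : R.IsBddOn ω f) : R.IsBddOn (R.θ ω) (R.transfer ω f) := by
  obtain ⟨M, hM, h⟩ := hf
  exact ⟨M * R.weightSum ω, mul_nonneg hM weightSum_nonneg, fun x _ =>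
    abs_transfer_le (fun y hy => h y (J_subset_X hy)) hM x⟩

theorem IsBddOn.transferN (hf : R.IsBddOn ω f) (n : ℕ) :
    R.IsBddOn (R.θ^[n] ω) (R.transferN n ω f) := by
  induction n generalizing ω f with
  | zero => exact hf
  | succ n ih => exact ih hf.transfer

theorem IsBddOn.abs (hf : R.IsBddOn ω f) : R.IsBddOn ω fun x => |f x| := by
  obtain ⟨M, hM, h⟩ := hf
  exact ⟨M, hM, fun x hx => (abs_abs _).trans_le (h x hx)⟩

theorem IsBddOn.const_mul (hf : R.IsBddOn ω f) (c : ℝ) : R.IsBddOn ω fun x => c * f x := by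
  obtain ⟨M, hM, h⟩ := hf
  refine ⟨|c| * M, mul_nonneg (abs_nonneg _) hM, fun x hx => ?_⟩
  rw [abs_mul]
  exact mul_le_mul_of_nonneg_left (h x hx) (abs_nonneg _)

theorem IsBddOn.add {g : ℝ → ℝ} (hf : R.IsBddOn ω f) (hg : R.IsBddOn ω g) :
    R.IsBddOn ω fun x => f x + g x := by
  obtain ⟨M, hM, h⟩ := hf
  obtain ⟨M', hM', h'⟩ := hg
  exact ⟨M + M', add_nonneg hM hM', fun x hx =>
    (abs_add_le _ _).trans (add_le_add (h x hx) (h' x hx))⟩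

theorem isBddOn_indicator (U : Set ℝ) : R.IsBddOn ω (U.indicator 1) := by
  refine ⟨1, zero_le_one, fun x _ => ?_⟩
  by_cases hx : x ∈ U <;> simp [hx]

theorem isBddOn_one : R.IsBddOn ω (R.one ω) := isBddOn_indicator _

theorem isBddOn_zero : R.IsBddOn ω fun _ => 0 := ⟨0, le_rfl, fun _ _ => abs_zero.le⟩

theorem isBddOn_of_boundedVariationOn (hf : BoundedVariationOn f (R.X ω)) : R.IsBddOn ω f := by
  rcases (R.X ω).eq_empty_or_nonempty with h | ⟨y, hy⟩
  · exact ⟨0, le_rfl, fun x hx => absurd hx (by simp [h])⟩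
  · exact ⟨|f y| + (eVariationOn f (R.X ω)).toReal,
      add_nonneg (abs_nonneg _) ENNReal.toReal_nonneg, fun x hx => hf.abs_le_abs_add hx hy⟩

theorem transferN_add_fun {g : ℝ → ℝ} (hf : R.IsBddOn ω f) (hg : R.IsBddOn ω g) (n : ℕ) :
    R.transferN n ω (fun y => f y + g y) = fun x => R.transferN n ω f x + R.transferN n ω g x := by
  induction n generalizing ω f g with
  | zero => rfl
  | succ n ih =>
    have h : R.transfer ω (fun y => f y + g y)
        = fun x => R.transfer ω f x + R.transfer ω g x := by
      obtain ⟨M, -, h⟩ := hf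
      obtain ⟨M', -, h'⟩ := hg
      exact transfer_add (fun y hy => h y (J_subset_X hy)) fun y hy => h' y (J_subset_X hy)
    rw [RandomOpenSystem.transferN, h, ih hf.transfer hg.transfer]
    rfl

theorem transferN_mono {g : ℝ → ℝ} (hf : R.IsBddOn ω f) (hg : R.IsBddOn ω g)
    (h : ∀ y ∈ R.X ω, f y ≤ g y) (n : ℕ) (hx : x ∈ R.X (R.θ^[n] ω)) :
    R.transferN n ω f x ≤ R.transferN n ω g x := by
  induction n generalizing ω f g with
  | zero => exact h x hx
  | succ n ih =>
    refine ih (ω := R.θ ω) hf.transfer hg.transfer (fun y _ => ?_) hx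
    obtain ⟨M, -, hM⟩ := hf
    obtain ⟨M', -, hM'⟩ := hg
    exact transfer_mono (fun y hy => hM y (J_subset_X hy)) (fun y hy => hM' y (J_subset_X hy))
      (fun y hy => h y (J_subset_X hy)) y

theorem transferN_nonneg (hf : ∀ y ∈ R.X ω, 0 ≤ f y) (n : ℕ) (hx : x ∈ R.X (R.θ^[n] ω)) :
    0 ≤ R.transferN n ω f x := by
  induction n generalizing ω f with
  | zero => exact hf x hx
  | succ n ih => exact ih (ω := R.θ ω) (fun y _ => tsum_nonneg fun z =>
      mul_nonneg (hf z (J_subset_X z.2.1)) weight_nonneg) hx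

theorem abs_transferN_le (hf : R.IsBddOn ω f) (n : ℕ) (hx : x ∈ R.X (R.θ^[n] ω)) :
    |R.transferN n ω f x| ≤ R.transferN n ω (fun y => |f y|) x := by
  have hneg : R.transferN n ω (fun y => -1 * |f y|) = fun x => -1 * R.transferN n ω _ x :=
    transferN_const_mul _ _ _ _
  rw [abs_le]
  constructor
  · have := transferN_mono (hf.abs.const_mul (-1)) hf
      (fun y _ => by linarith [neg_abs_le (f y)]) n hx
    rw [hneg] at this
    linarith
  · exact transferN_mono hf hf.abs (fun y _ => le_abs_self _) n hx

/-- For `n ≥ 1` the operator `ℒ_ω^n` only sees the values on `J_ω`. -/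
theorem abs_transferN_le_mul_one (hn : 1 ≤ n) (hf : ∀ y ∈ R.X ω, |f y| ≤ M)
    (hx : x ∈ R.X (R.θ^[n] ω)) : |R.transferN n ω f x| ≤ M * R.transferN n ω (R.one ω) x := by
  have hfb : R.IsBddOn ω f := ⟨max M 0, le_max_right _ _, fun y hy =>
    (hf y hy).trans (le_max_left _ _)⟩
  obtain ⟨m, rfl⟩ : ∃ m, n = m + 1 := ⟨n - 1, by omega⟩
  have h1 : R.transferN (m + 1) ω ((R.J ω).indicator f) = R.transferN (m + 1) ω f := by
    rw [transferN, transferN]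
    congr 1
    exact transfer_congr fun y hy => indicator_of_mem hy f
  have hb : R.IsBddOn ω ((R.J ω).indicator f) := by
    obtain ⟨M', hM', h⟩ := hfb
    refine ⟨M', hM', fun y hy => ?_⟩
    by_cases hyJ : y ∈ R.J ω
    · rw [indicator_of_mem hyJ]
      exact h y hy
    · simpa [indicator_of_notMem hyJ] using hM'
  have h2 : R.transferN (m + 1) ω (fun y => M * R.one ω y)
      = fun x => M * R.transferN (m + 1) ω (R.one ω) x := transferN_const_mul _ _ _ _
  rw [← h1]
  refine (abs_transferN_le hb _ hx).trans ?_
  have h3 := transferN_mono hb.abs (isBddOn_one.const_mul M) (fun y hy => ?_) (m + 1) hx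
  · rwa [h2] at h3
  · by_cases hyJ : y ∈ R.J ω
    · simpa [one, hyJ] using hf y hy
    · simp [one, hyJ]

theorem weightN_succ (n : ℕ) (ω : Ω) (y : ℝ) :
    R.weightN (n + 1) ω y = R.weight ω y * R.weightN n (R.θ ω) (R.T ω y) := by
  rw [weightN, Finset.prod_range_succ', mul_comm]
  rfl

theorem weightN_nonneg : 0 ≤ R.weightN n ω x := Finset.prod_nonneg fun _ _ => weight_nonneg

theorem weightN_le_prod (hx : x ∈ R.X ω) (n : ℕ) :
    R.weightN n ω x ≤ ∏ i ∈ Finset.range n, R.weightSum (R.θ^[i] ω) :=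
  Finset.prod_le_prod (fun _ _ => weight_nonneg) fun i _ => weight_le_weightSum (iter_mem_X hx i)

theorem mem_survivor_succ :
    y ∈ R.survivor (n + 1) ω ↔ y ∈ R.J ω ∧ R.T ω y ∈ R.survivor n (R.θ ω) := by
  constructor
  · rintro ⟨hy, h⟩
    exact ⟨h 0 (Nat.succ_pos _), map_mem_X hy, fun i hi => h (i + 1) (Nat.succ_lt_succ hi)⟩
  · rintro ⟨hy, -, h⟩
    refine ⟨J_subset_X hy, fun i hi => ?_⟩
    cases i with
    | zero => exact hy
    | succ i => exact h i (Nat.lt_of_succ_lt_succ hi)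

theorem survivor_subset_X : R.survivor n ω ⊆ R.X ω := fun _ h => h.1

/-- The preimages under `T_ω^{n+1}` surviving `n + 1` steps, sorted by their first image. -/
def fiberEquiv (R : RandomOpenSystem Ω P) (n : ℕ) (ω : Ω) (x : ℝ) :
    (Σ z : {z : ℝ // z ∈ R.survivor n (R.θ ω) ∧ R.iter n (R.θ ω) z = x},
      {y : ℝ // y ∈ R.J ω ∧ R.T ω y = z}) ≃
    {y : ℝ // y ∈ R.survivor (n + 1) ω ∧ R.iter (n + 1) ω y = x} where
  toFun p := ⟨p.2, mem_survivor_succ.mpr ⟨p.2.2.1, p.2.2.2.symm ▸ p.1.2.1⟩,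
    (congrArg _ p.2.2.2).trans p.1.2.2⟩
  invFun y := ⟨⟨R.T ω y, (mem_survivor_succ.mp y.2.1).2, y.2.2⟩, ⟨y,
    (mem_survivor_succ.mp y.2.1).1, rfl⟩⟩
  left_inv := by
    rintro ⟨⟨z, hz⟩, ⟨y, hy⟩⟩
    obtain rfl : R.T ω y = z := hy.2
    rfl
  right_inv y := rfl

/-- `ℒ_ω^n f (x)` is the sum of `f y * g_ω^n y` over the surviving preimages `y` of `x` under
`T_ω^n`. -/
theorem hasSum_transferN (hf : R.IsBddOn ω f) (hx : x ∈ R.X (R.θ^[n] ω)) :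
    HasSum (fun y : {y : ℝ // y ∈ R.survivor n ω ∧ R.iter n ω y = x} => f y * R.weightN n ω y)
      (R.transferN n ω f x) := by
  induction n generalizing ω f with
  | zero =>
    have hx' : x ∈ R.survivor 0 ω ∧ R.iter 0 ω x = x := ⟨⟨hx, fun i hi => by omega⟩, rfl⟩
    have : Unique {y : ℝ // y ∈ R.survivor 0 ω ∧ R.iter 0 ω y = x} :=
      ⟨⟨⟨x, hx'⟩⟩, fun y => Subtype.ext y.2.2⟩
    convert hasSum_unique _ using 1
    have h : ((default : {y : ℝ // y ∈ R.survivor 0 ω ∧ R.iter 0 ω y = x}) : ℝ) = x :=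
      (default : {y : ℝ // y ∈ R.survivor 0 ω ∧ R.iter 0 ω y = x}).2.2
    rw [h]
    simp [transferN, weightN]
  | succ n ih =>
    have inner : ∀ g : ℝ → ℝ, R.IsBddOn ω g →
        ∀ z : {z : ℝ // z ∈ R.survivor n (R.θ ω) ∧ R.iter n (R.θ ω) z = x},
        HasSum (fun y : {y : ℝ // y ∈ R.J ω ∧ R.T ω y = z} =>
          g y * R.weightN (n + 1) ω y) (R.transfer ω g z * R.weightN n (R.θ ω) z) := by
      intro g ⟨M, _, hM⟩ z
      have h := (summable_transfer (fun y hy => hM y (J_subset_X hy)) (z : ℝ)).hasSum.mul_right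
        (R.weightN n (R.θ ω) z)
      refine h.congr_fun ?_ 
      intro y
      rw [weightN_succ, y.2.2, mul_assoc]
    -- For the absolute values, summability over pairs reduces to iterated summability, and the
    -- outer sum is the induction hypothesis applied to `ℒ_ω |f|`.
    have hsum : Summable fun p : (Σ z : {z : ℝ // z ∈ R.survivor n (R.θ ω) ∧
        R.iter n (R.θ ω) z = x}, {y : ℝ // y ∈ R.J ω ∧ R.T ω y = z}) =>
        f p.2 * R.weightN (n + 1) ω p.2 := by
      refine Summable.of_norm ?_
      have hn : ∀ y : ℝ, ‖f y * R.weightN (n + 1) ω y‖ = |f y| * R.weightN (n + 1) ω y :=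
        fun y => by rw [norm_mul, Real.norm_eq_abs, Real.norm_of_nonneg weightN_nonneg]
      simp only [hn]
      rw [summable_sigma_of_nonneg fun _ => mul_nonneg (abs_nonneg _) weightN_nonneg]
      refine ⟨fun z => (inner _ hf.abs z).summable, ?_⟩
      simp only [(inner _ hf.abs _).tsum_eq]
      exact (ih hf.abs.transfer hx).summable
    rw [← (fiberEquiv R n ω x).hasSum_iff]
    exact HasSum.sigma_of_hasSum (ih hf.transfer hx) (inner f hf) hsum

end RandomOpenSystem

/-! ### The functional `F`: monotonicity, superadditivity, and its behavior under the operator. -/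

namespace RandomOpenSystem

variable {Ω : Type*} [MeasurableSpace Ω] {P : Measure Ω} {R : RandomOpenSystem Ω P} {ω : Ω}
  {x y c : ℝ} {n : ℕ} {f g : ℝ → ℝ} {M : ℝ}

open RandomIntervalMap

/-- `inf_{x ∈ S_{θ^n ω, n}} ℒ_ω^n f (x) / ℒ_ω^n 𝟙_ω (x)`. -/
noncomputable def ratioInf (R : RandomOpenSystem Ω P) (n : ℕ) (ω : Ω) (f : ℝ → ℝ) : ℝ :=
  ⨅ x : R.supp n ω, R.transferN n ω f x / R.transferN n ω (R.one ω) x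

theorem one_nonneg (x : ℝ) : 0 ≤ R.one ω x := indicator_nonneg (fun _ _ => zero_le_one) x

theorem transferN_one_nonneg (hx : x ∈ R.X (R.θ^[n] ω)) : 0 ≤ R.transferN n ω (R.one ω) x :=
  transferN_nonneg (fun y _ => one_nonneg y) n hx

theorem transferN_one_pos (hx : x ∈ R.supp n ω) : 0 < R.transferN n ω (R.one ω) x :=
  (transferN_one_nonneg hx.1).lt_of_ne hx.2.symm

/-- Nonemptiness keeps the infimum in `ratioInf` from taking its default value `0`. -/
theorem supp_nonempty (hsupp : ∀ ω, (R.suppInfty ω).Nonempty) (hn : 1 ≤ n) :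
    (R.supp n ω).Nonempty := by
  obtain ⟨x, hx⟩ := hsupp (R.θ^[n] ω)
  have h := mem_iInter₂.mp hx n hn
  rw [(show Function.LeftInverse R.θ.symm R.θ from R.θ.symm_apply_apply).iterate n ω] at h
  exact ⟨x, h⟩

theorem le_ratio (hn : 1 ≤ n) (hM : ∀ y ∈ R.X ω, |f y| ≤ M) (hx : x ∈ R.supp n ω) :
    -M ≤ R.transferN n ω f x / R.transferN n ω (R.one ω) x := by
  rw [le_div_iff₀ (transferN_one_pos hx)]
  linarith [neg_le_of_abs_le (abs_transferN_le_mul_one hn hM hx.1)]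

/-- Where `ℒ^n 𝟙` vanishes so does `ℒ^n f`, by `abs_transferN_le_mul_one`. The infimum over the
support therefore gives an inequality on the whole fiber, to which positive operators can be
applied. -/
theorem ratioInf_mul_le (hn : 1 ≤ n) (hf : R.IsBddOn ω f) (hx : x ∈ R.X (R.θ^[n] ω)) :
    R.ratioInf n ω f * R.transferN n ω (R.one ω) x ≤ R.transferN n ω f x := by
  obtain ⟨M, -, hM⟩ := hf
  by_cases h : R.transferN n ω (R.one ω) x = 0
  · have := abs_transferN_le_mul_one hn hM hx
    rw [h, mul_zero] at this
    rw [h, mul_zero, abs_nonpos_iff.mp this]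
  · have hs : x ∈ R.supp n ω := ⟨hx, h⟩
    rw [← le_div_iff₀ (transferN_one_pos hs)]
    refine ciInf_le (f := fun x : R.supp n ω => R.transferN n ω f x /
      R.transferN n ω (R.one ω) x) ⟨-M, ?_⟩ ⟨x, hs⟩
    rintro _ ⟨z, rfl⟩
    exact le_ratio hn hM z.2

theorem le_ratioInf (hne : (R.supp n ω).Nonempty)
    (h : ∀ x ∈ R.X (R.θ^[n] ω), c * R.transferN n ω (R.one ω) x ≤ R.transferN n ω f x) :
    c ≤ R.ratioInf n ω f := by
  have := hne.to_subtype
  refine le_ciInf fun x => ?_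
  rw [le_div_iff₀ (transferN_one_pos x.2)]
  exact h x x.2.1

theorem ratioInf_le (hne : (R.supp n ω).Nonempty) (hn : 1 ≤ n) (hM : ∀ y ∈ R.X ω, |f y| ≤ M) :
    R.ratioInf n ω f ≤ M := by
  obtain ⟨x, hx⟩ := hne
  have hpos := transferN_one_pos hx
  have h1 := ratioInf_mul_le hn ⟨max M 0, le_max_right _ _, fun y hy =>
    (hM y hy).trans (le_max_left _ _)⟩ hx.1
  exact le_of_mul_le_mul_right
    (h1.trans (le_of_abs_le (abs_transferN_le_mul_one hn hM hx.1))) hpos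

variable (hsupp : ∀ ω, (R.suppInfty ω).Nonempty)
include hsupp

theorem ratioInf_le_succ (hn : 1 ≤ n) (hf : R.IsBddOn ω f) :
    R.ratioInf n ω f ≤ R.ratioInf (n + 1) ω f := by
  refine le_ratioInf (supp_nonempty hsupp n.succ_pos) fun x _ => ?_
  rw [transferN_succ', transferN_succ']
  have h : R.transfer (R.θ^[n] ω) (fun y => R.ratioInf n ω f * R.transferN n ω (R.one ω) y)
      = fun x => R.ratioInf n ω f * R.transfer (R.θ^[n] ω) (R.transferN n ω (R.one ω)) x :=
    transfer_const_mul _ _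
  obtain ⟨M, -, hM⟩ := hf.transferN n
  obtain ⟨M', -, hM'⟩ := ((isBddOn_one (R := R) (ω := ω)).transferN n).const_mul
    (R.ratioInf n ω f)
  have h2 := transfer_mono (fun y hy => hM' y (J_subset_X hy)) (fun y hy => hM y (J_subset_X hy))
    (fun y hy => ratioInf_mul_le hn hf (J_subset_X hy)) x
  rwa [h] at h2

/-- By positivity of the operator the infima increase, and they are bounded by any bound of `|f|`,
so the `limUnder` in `F` is a genuine limit. Monotonicity starts at index `1`, since `𝟙_ω` does not
control `f` on the hole. -/
theorem tendsto_ratioInf (hf : R.IsBddOn ω f) :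
    Tendsto (fun n => R.ratioInf n ω f) atTop (nhds (R.F ω f)) := by
  have hmono : Monotone fun n => R.ratioInf (n + 1) ω f :=
    monotone_nat_of_le_succ fun n => ratioInf_le_succ hsupp n.succ_pos hf
  obtain ⟨M, -, hM⟩ := hf
  have hb : BddAbove (range fun n => R.ratioInf (n + 1) ω f) := by
    refine ⟨M, ?_⟩
    rintro _ ⟨n, rfl⟩
    exact ratioInf_le (supp_nonempty hsupp n.succ_pos) n.succ_pos hM
  exact tendsto_nhds_limUnder ⟨_, (tendsto_add_atTop_iff_nat 1).mp
    (tendsto_atTop_ciSup hmono hb)⟩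

theorem ratioInf_le_F (hn : 1 ≤ n) (hf : R.IsBddOn ω f) : R.ratioInf n ω f ≤ R.F ω f := by
  have hmono : Monotone fun k => R.ratioInf (k + n) ω f :=
    monotone_nat_of_le_succ fun k => by
      rw [Nat.succ_add]
      exact ratioInf_le_succ hsupp (by omega) hf
  have h := hmono.ge_of_tendsto ((tendsto_add_atTop_iff_nat n).mpr (tendsto_ratioInf hsupp hf)) 0
  simpa using h

theorem F_mono (hf : R.IsBddOn ω f) (hg : R.IsBddOn ω g) (h : ∀ y ∈ R.X ω, f y ≤ g y) :
    R.F ω f ≤ R.F ω g := by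
  refine le_of_tendsto_of_tendsto (tendsto_ratioInf hsupp hf) (tendsto_ratioInf hsupp hg) ?_
  filter_upwards [eventually_ge_atTop 1] with n hn
  exact le_ratioInf (supp_nonempty hsupp hn) fun x hx =>
    (ratioInf_mul_le hn hf hx).trans (transferN_mono hf hg h n hx)

theorem F_nonneg (hf : R.IsBddOn ω f) (h : ∀ y ∈ R.X ω, 0 ≤ f y) : 0 ≤ R.F ω f := by
  refine ge_of_tendsto (tendsto_ratioInf hsupp hf) ?_
  filter_upwards [eventually_ge_atTop 1] with n hn
  refine le_ratioInf (supp_nonempty hsupp hn) fun x hx => ?_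
  rw [zero_mul]
  exact transferN_nonneg h n hx

theorem F_const_mul (hc : 0 ≤ c) (hf : R.IsBddOn ω f) :
    R.F ω (fun x => c * f x) = c * R.F ω f := by
  refine tendsto_nhds_unique (tendsto_ratioInf hsupp (hf.const_mul c)) ?_
  refine ((tendsto_ratioInf hsupp hf).const_mul c).congr fun n => ?_
  rw [ratioInf, ratioInf, transferN_const_mul, Real.mul_iInf_of_nonneg hc]
  simp only [mul_div_assoc]

theorem F_add_le (hf : R.IsBddOn ω f) (hg : R.IsBddOn ω g) :
    R.F ω f + R.F ω g ≤ R.F ω fun x => f x + g x := by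
  refine le_of_tendsto_of_tendsto ((tendsto_ratioInf hsupp hf).add (tendsto_ratioInf hsupp hg))
    (tendsto_ratioInf hsupp (hf.add hg)) ?_
  filter_upwards [eventually_ge_atTop 1] with n hn
  refine le_ratioInf (supp_nonempty hsupp hn) fun x hx => ?_
  rw [transferN_add_fun hf hg, add_mul]
  exact add_le_add (ratioInf_mul_le hn hf hx) (ratioInf_mul_le hn hg hx)

/-- Superadditivity and positive homogeneity, inherited from infima, are all that is needed of
linearity. The lemma serves to bound the infima of `|f|` over good elements. -/
theorem sum_F_indicator_le {t : Finset (Set ℝ)} {m : Set ℝ → ℝ} (hm : ∀ U ∈ t, 0 ≤ m U)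
    (hf : R.IsBddOn ω f) (h : ∀ x ∈ R.X ω, ∑ U ∈ t, m U * U.indicator 1 x ≤ f x) :
    ∑ U ∈ t, m U * R.F ω (U.indicator 1) ≤ R.F ω f := by
  classical
  have key : R.IsBddOn ω (fun x => ∑ U ∈ t, m U * U.indicator 1 x) ∧
      ∑ U ∈ t, m U * R.F ω (U.indicator 1) ≤ R.F ω fun x => ∑ U ∈ t, m U * U.indicator 1 x := by
    clear h
    induction t using Finset.induction_on with
    | empty => simpa using ⟨isBddOn_zero, F_nonneg hsupp isBddOn_zero fun _ _ => le_rfl⟩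
    | insert U t hU ih =>
      obtain ⟨ih1, ih2⟩ := ih fun V hV => hm V (Finset.mem_insert_of_mem hV)
      simp only [Finset.sum_insert hU]
      have hUb := (isBddOn_indicator (R := R) (ω := ω) U).const_mul (m U)
      refine ⟨hUb.add ih1, le_trans ?_ (F_add_le hsupp hUb ih1)⟩
      rw [F_const_mul hsupp (hm U (Finset.mem_insert_self _ _)) (isBddOn_indicator U)]
      gcongr
  exact key.2.trans (F_mono hsupp key.1 hf h)

/-- On the support the quotient `ℒ^n f / ℒ^n 𝟙` is a weighted average of `f` over surviving
preimages, and `F` dominates each of the infima. -/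
theorem le_F_of_le_on_survivor (hn : 1 ≤ n) (hf : R.IsBddOn ω f)
    (h : ∀ y ∈ R.survivor n ω, c ≤ f y) : c ≤ R.F ω f := by
  refine (le_ratioInf (supp_nonempty hsupp hn) fun x hx => ?_).trans (ratioInf_le_F hsupp hn hf)
  refine hasSum_le (fun y => ?_) ((hasSum_transferN isBddOn_one hx).mul_left c)
    (hasSum_transferN hf hx)
  have hyJ : (y : ℝ) ∈ R.J ω := y.2.1.2 0 hn
  rw [one, indicator_of_mem hyJ, Pi.one_apply, one_mul]
  exact mul_le_mul_of_nonneg_right (h y y.2.1) weightN_nonneg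

omit hsupp in
theorem transfer_nonneg (hf : ∀ y ∈ R.X ω, 0 ≤ f y) (x : ℝ) : 0 ≤ R.transfer ω f x :=
  tsum_nonneg fun y => mul_nonneg (hf y (J_subset_X y.2.1)) weight_nonneg

theorem rho_nonneg : 0 ≤ R.rho ω :=
  F_nonneg hsupp isBddOn_one.transfer fun y _ => transfer_nonneg (fun y _ => one_nonneg y) y

/-- `ℒ^{n+1} f` is at least its quotient infimum times `ℒ^{n+1} 𝟙_ω = ℒ^n (ℒ 𝟙_ω)`, which is at
least the infimum converging to `ρ_ω` times `ℒ^n 𝟙_{θω}`. Let `n` tend to infinity. -/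
theorem rho_mul_F_le (hf : R.IsBddOn ω f) (h : ∀ y ∈ R.X ω, 0 ≤ f y) :
    R.rho ω * R.F ω f ≤ R.F (R.θ ω) (R.transfer ω f) := by
  have h1 := tendsto_ratioInf hsupp (isBddOn_one (R := R) (ω := ω)).transfer
  have h2 := (tendsto_add_atTop_iff_nat 1).mpr (tendsto_ratioInf hsupp hf)
  refine le_of_tendsto_of_tendsto (h1.mul h2) (tendsto_ratioInf hsupp hf.transfer) ?_
  filter_upwards [eventually_ge_atTop 1] with n hn
  have hpos : 0 ≤ R.ratioInf (n + 1) ω f :=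
    le_ratioInf (supp_nonempty hsupp n.succ_pos) fun x hx => by
      rw [zero_mul]
      exact transferN_nonneg h _ hx
  refine le_ratioInf (supp_nonempty hsupp hn) fun x hx => ?_
  have h3 := ratioInf_mul_le hn (isBddOn_one (R := R) (ω := ω)).transfer hx
  have h4 := ratioInf_mul_le (n := n + 1) n.succ_pos hf hx
  calc _ = R.ratioInf (n + 1) ω f * (R.ratioInf n (R.θ ω) (R.transfer ω (R.one ω)) *
        R.transferN n (R.θ ω) (R.one (R.θ ω)) x) := by ring
    _ ≤ R.ratioInf (n + 1) ω f * R.transferN (n + 1) ω (R.one ω) x :=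
        mul_le_mul_of_nonneg_left h3 hpos
    _ ≤ _ := h4

theorem rhoN_nonneg : 0 ≤ R.rhoN n ω := Finset.prod_nonneg fun _ _ => rho_nonneg hsupp

omit hsupp in
theorem rhoN_succ (n : ℕ) (ω : Ω) : R.rhoN (n + 1) ω = R.rho ω * R.rhoN n (R.θ ω) := by
  rw [rhoN, Finset.prod_range_succ', mul_comm]
  rfl

omit hsupp in
theorem rhoN_add (n m : ℕ) (ω : Ω) :
    R.rhoN (n + m) ω = R.rhoN n ω * R.rhoN m (R.θ^[n] ω) := by
  rw [rhoN, Finset.prod_range_add]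
  congr 1
  refine Finset.prod_congr rfl fun i _ => ?_
  rw [add_comm n i, Function.iterate_add_apply]

theorem rhoN_mul_F_le (hf : R.IsBddOn ω f) (h : ∀ y ∈ R.X ω, 0 ≤ f y) (n : ℕ) :
    R.rhoN n ω * R.F ω f ≤ R.F (R.θ^[n] ω) (R.transferN n ω f) := by
  induction n generalizing ω f with
  | zero => simp [rhoN, transferN]
  | succ n ih =>
    have h1 := ih hf.transfer fun y _ => transfer_nonneg h y
    have h2 := mul_le_mul_of_nonneg_left (rho_mul_F_le hsupp hf h)
      (rhoN_nonneg (n := n) (ω := R.θ ω) hsupp)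
    rw [rhoN_succ]
    calc _ = R.rhoN n (R.θ ω) * (R.rho ω * R.F ω f) := by ring
      _ ≤ _ := h2.trans h1

end RandomOpenSystem

/-! ### Summing suprema over good and bad intervals. -/

/-- Bounds the sum of the suprema of `|f|` over finitely many ordered sets, some of which are
`good`, by the sum of the infima over the good ones and the variation, when among the other
(bad) sets at most `η` can occur without a good one between them. -/
theorem sum_sSup_abs_le_of_ordered {f : ℝ → ℝ} {X : Set ℝ} (hf : BoundedVariationOn f X)
    {𝒢 ℬ : Finset (Set ℝ)} {r : Set ℝ → ℝ} {η M : ℝ} (hη : 0 ≤ η) (hM0 : 0 ≤ M) (hdisj : Disjoint 𝒢 ℬ)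
    (hX : ∀ U, U ∈ 𝒢 ∨ U ∈ ℬ → U ⊆ X) (hr : ∀ U, U ∈ 𝒢 ∨ U ∈ ℬ → r U ∈ U)
    (hord : ∀ U, U ∈ 𝒢 ∨ U ∈ ℬ → ∀ V, V ∈ 𝒢 ∨ V ∈ ℬ → U ≠ V →
      (∀ x ∈ U, ∀ y ∈ V, x < y) ∨ (∀ x ∈ U, ∀ y ∈ V, y < x))
    (hcard : ∀ B ⊆ ℬ, (∀ U ∈ B, ∀ V ∈ B, ∀ G ∈ 𝒢, r U < r G → ¬ r G < r V) → (B.card : ℝ) ≤ η)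
    (hM : ∀ x ∈ X, |f x| ≤ M + (eVariationOn f X).toReal) :
    ∑ U ∈ 𝒢, sSup ((fun x => |f x|) '' U) + ∑ U ∈ ℬ, sSup ((fun x => |f x|) '' U) ≤
      (1 + 2 * η) * (eVariationOn f X).toReal +
        (1 + η) * ∑ U ∈ 𝒢, sInf ((fun x => |f x|) '' U) + η * M := by
  classical
  set σ : Set ℝ → ℝ := fun U => sSup ((fun x => |f x|) '' U) with hσ
  set m : Set ℝ → ℝ := fun U => sInf ((fun x => |f x|) '' U) with hm
  set v := (eVariationOn f X).toReal
  have hlt : ∀ U, U ∈ 𝒢 ∨ U ∈ ℬ → ∀ V, V ∈ 𝒢 ∨ V ∈ ℬ → r U < r V →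
      ∀ x ∈ U, ∀ y ∈ V, x < y := by
    intro U hU V hV h
    rcases hord U hU V hV (fun e => h.ne (congrArg r e)) with h1 | h1
    · exact h1
    · exact absurd (h1 _ (hr U hU) _ (hr V hV)) h.not_gt
  have hinj : ∀ U, U ∈ 𝒢 ∨ U ∈ ℬ → ∀ V, V ∈ 𝒢 ∨ V ∈ ℬ → r U = r V → U = V := by
    intro U hU V hV h
    by_contra hne
    rcases hord U hU V hV hne with h1 | h1
    · exact (h1 _ (hr U hU) _ (hr V hV)).ne h
    · exact (h1 _ (hr U hU) _ (hr V hV)).ne h.symm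
  have hσ_le : ∀ U, U ∈ 𝒢 ∨ U ∈ ℬ → ∀ c, (∀ x ∈ U, |f x| ≤ c) → σ U ≤ c := by
    intro U hU c hc
    refine csSup_le ⟨_, mem_image_of_mem _ (hr U hU)⟩ ?_
    rintro _ ⟨x, hx, rfl⟩
    exact hc x hx
  have hσ0 : ∀ U, 0 ≤ σ U := fun U => by
    refine Real.sSup_nonneg ?_
    rintro _ ⟨x, -, rfl⟩
    exact abs_nonneg _
  -- `W` is kept free: it is `U` itself for a good set, and a good set with its run of bad ones when
  -- a bad set is compared with it.
  have hσm : ∀ U, U ∈ 𝒢 ∨ U ∈ ℬ → ∀ G, G ∈ 𝒢 ∨ G ∈ ℬ → ∀ W ⊆ X, U ⊆ W → G ⊆ W →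
      σ U ≤ m G + (eVariationOn f W).toReal := by
    intro U hU G hG W hWX hUW hGW
    refine hσ_le U hU _ fun x hx => ?_
    rw [← sub_le_iff_le_add]
    refine le_csInf ⟨_, mem_image_of_mem _ (hr G hG)⟩ ?_
    rintro _ ⟨y, hy, rfl⟩
    have := (hf.mono hWX).abs_le_abs_add (hUW hx) (hGW hy)
    simp only
    linarith
  -- `L G` is the run of bad sets whose last good predecessor is `G`, and `B₀` collects those with
  -- no good predecessor. Each has at most `η` members by `hcard`.
  set L : Set ℝ → Finset (Set ℝ) := fun G =>
    {U ∈ ℬ | r G < r U ∧ ∀ G' ∈ 𝒢, r G' < r U → r G' ≤ r G} with hL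
  set B₀ : Finset (Set ℝ) := {U ∈ ℬ | ∀ G ∈ 𝒢, ¬ r G < r U} with hB₀
  have hLmem : ∀ {G U}, U ∈ L G ↔ U ∈ ℬ ∧ r G < r U ∧ ∀ G' ∈ 𝒢, r G' < r U → r G' ≤ r G := by
    simp [hL]
  have hBmem : ∀ {U}, U ∈ B₀ ↔ U ∈ ℬ ∧ ∀ G ∈ 𝒢, ¬ r G < r U := by simp [hB₀]
  set W : Set ℝ → Set ℝ := fun G => G ∪ ⋃ U ∈ L G, U with hW
  have hWX : ∀ G ∈ 𝒢, W G ⊆ X := fun G hG => union_subset (hX G (.inl hG))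
    (iUnion₂_subset fun U hU => hX U (.inr (hLmem.mp hU).1))
  have hWmem : ∀ G ∈ 𝒢, ∀ x ∈ W G, ∃ U, (U ∈ 𝒢 ∨ U ∈ ℬ) ∧ x ∈ U ∧ r G ≤ r U ∧
      ∀ G' ∈ 𝒢, r G < r G' → r U < r G' := by
    rintro G hG x (hx | hx)
    · exact ⟨G, .inl hG, hx, le_rfl, fun _ _ h => h⟩
    · simp only [mem_iUnion] at hx
      obtain ⟨U, hU, hx⟩ := hx
      obtain ⟨hUB, h1, h2⟩ := hLmem.mp hU
      refine ⟨U, .inr hUB, hx, h1.le, fun G' hG' hlt' => ?_⟩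
      by_contra hcon
      rcases (not_lt.mp hcon).lt_or_eq with h | h
      · exact (h2 G' hG' h).not_gt hlt'
      · have := hinj G' (.inl hG') U (.inr hUB) h
        exact Finset.disjoint_left.mp hdisj hG' (this ▸ hUB)
  -- A good set together with its run ends before the next good set, so the variations over these
  -- groups add up to at most `v`, without a factor for the number of groups.
  have hWord : ∀ G ∈ 𝒢, ∀ G' ∈ 𝒢, r G < r G' → ∀ x ∈ W G, ∀ y ∈ W G', x < y := by
    intro G hG G' hG' h x hx y hy
    obtain ⟨U, hU, hxU, -, h2⟩ := hWmem G hG x hx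
    obtain ⟨V, hV, hyV, h1, -⟩ := hWmem G' hG' y hy
    exact hlt U hU V hV ((h2 G' hG' h).trans_le h1) x hxU y hyV
  have sum_var : ∀ A : Set ℝ → Set ℝ, (∀ G ∈ 𝒢, A G ⊆ W G) →
      ∑ G ∈ 𝒢, (eVariationOn f (A G)).toReal ≤ v := by
    intro A hA
    rw [← ENNReal.toReal_sum fun G hG => hf.mono ((hA G hG).trans (hWX G hG))]
    refine ENNReal.toReal_mono hf ((eVariationOn.sum_le_of_ordered f 𝒢 ?_).trans
      (eVariationOn.mono f (iUnion₂_subset fun G hG => (hA G hG).trans (hWX G hG))))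
    intro G hG G' hG' hne
    rcases lt_trichotomy (r G) (r G') with h | h | h
    · exact .inl fun x hx y hy => hWord G hG G' hG' h x (hA G hG hx) y (hA G' hG' hy)
    · exact absurd (hinj G (.inl hG) G' (.inl hG') h) hne
    · exact .inr fun x hx y hy => hWord G' hG' G hG h y (hA G' hG' hy) x (hA G hG hx)
  have hgood : ∑ U ∈ 𝒢, σ U ≤ ∑ U ∈ 𝒢, m U + v := by
    calc ∑ U ∈ 𝒢, σ U ≤ ∑ U ∈ 𝒢, (m U + (eVariationOn f U).toReal) :=
          Finset.sum_le_sum fun U hU => hσm U (.inl hU) U (.inl hU) U (hX U (.inl hU))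
            Subset.rfl Subset.rfl
      _ ≤ _ := by
          rw [Finset.sum_add_distrib]
          exact add_le_add_right (sum_var id fun G _ => subset_union_left) _
  have hcover : ℬ ⊆ B₀ ∪ 𝒢.biUnion L := by
    intro U hU
    by_cases h : ∃ G ∈ 𝒢, r G < r U
    · obtain ⟨G, hG, hmax⟩ := Finset.exists_max_image {G ∈ 𝒢 | r G < r U} r
        (by obtain ⟨G, hG, h⟩ := h; exact ⟨G, by simp [hG, h]⟩)
      simp only [Finset.mem_filter] at hG hmax
      refine Finset.mem_union_right _ (Finset.mem_biUnion.mpr ⟨G, hG.1, hLmem.mpr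
        ⟨hU, hG.2, fun G' hG' h' => hmax G' ⟨hG', h'⟩⟩⟩)
    · push Not at h
      exact Finset.mem_union_left _ (hBmem.mpr ⟨hU, fun G hG => (h G hG).not_gt⟩)
  have hpd : (𝒢 : Set (Set ℝ)).PairwiseDisjoint L := by
    intro G hG G' hG' hne
    refine Finset.disjoint_left.mpr fun U hU hU' => hne ?_
    obtain ⟨-, h1, h2⟩ := hLmem.mp hU
    obtain ⟨-, h1', h2'⟩ := hLmem.mp hU'
    exact hinj G (.inl hG) G' (.inl hG') (le_antisymm (h2' G hG h1) (h2 G' hG' h1'))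
  have hL_le : ∀ G ∈ 𝒢, ∑ U ∈ L G, σ U ≤ η * (m G + (eVariationOn f (W G)).toReal) := by
    intro G hG
    have hm0 : 0 ≤ m G := by
      refine Real.sInf_nonneg ?_
      rintro _ ⟨x, -, rfl⟩
      exact abs_nonneg _
    calc ∑ U ∈ L G, σ U ≤ (L G).card • (m G + (eVariationOn f (W G)).toReal) :=
          Finset.sum_le_card_nsmul _ _ _ fun U hU => hσm U (.inr (hLmem.mp hU).1) G (.inl hG)
            (W G) (hWX G hG) (fun x hx =>
              .inr (mem_iUnion₂.mpr ⟨U, hU, hx⟩)) subset_union_left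
      _ = ((L G).card : ℝ) * (m G + (eVariationOn f (W G)).toReal) := nsmul_eq_mul _ _
      _ ≤ _ := by
          refine mul_le_mul_of_nonneg_right (hcard _ (Finset.filter_subset _ _) ?_)
            (add_nonneg hm0 ENNReal.toReal_nonneg)
          intro U hU V hV H hH h1 h2
          obtain ⟨-, h3, -⟩ := hLmem.mp hU
          obtain ⟨-, -, h4⟩ := hLmem.mp hV
          linarith [h4 H hH h2]
  -- There is no good set to the left to compare with, so the uniform bound `hM` is used. This is
  -- the source of the term `η * M`.
  have hB_le : ∑ U ∈ B₀, σ U ≤ η * (M + v) := by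
    rcases B₀.eq_empty_or_nonempty with he | ⟨U₀, hU₀⟩
    · rw [he, Finset.sum_empty]
      exact mul_nonneg hη (add_nonneg hM0 ENNReal.toReal_nonneg)
    have hMv : 0 ≤ M + v :=
      (abs_nonneg _).trans (hM _ (hX U₀ (.inr (hBmem.mp hU₀).1) (hr _ (.inr (hBmem.mp hU₀).1))))
    calc ∑ U ∈ B₀, σ U ≤ B₀.card • (M + v) :=
          Finset.sum_le_card_nsmul _ _ _ fun U hU => hσ_le U (.inr (hBmem.mp hU).1) _
            fun x hx => hM x (hX U (.inr (hBmem.mp hU).1) hx)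
      _ = (B₀.card : ℝ) * (M + v) := nsmul_eq_mul _ _
      _ ≤ _ := by
          refine mul_le_mul_of_nonneg_right (hcard _ (Finset.filter_subset _ _) ?_) hMv
          intro U hU V hV H hH h1 h2
          exact (hBmem.mp hV).2 H hH h2
  have hbad : ∑ U ∈ ℬ, σ U ≤ η * (M + v) + η * (∑ U ∈ 𝒢, m U + v) := by
    calc ∑ U ∈ ℬ, σ U ≤ ∑ U ∈ B₀ ∪ 𝒢.biUnion L, σ U :=
          Finset.sum_le_sum_of_subset_of_nonneg hcover fun U _ _ => hσ0 U
      _ ≤ ∑ U ∈ B₀, σ U + ∑ U ∈ 𝒢.biUnion L, σ U := by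
          rw [← Finset.sum_union_inter]
          exact le_add_of_nonneg_right (Finset.sum_nonneg fun U _ => hσ0 U)
      _ = ∑ U ∈ B₀, σ U + ∑ G ∈ 𝒢, ∑ U ∈ L G, σ U := by rw [Finset.sum_biUnion hpd]
      _ ≤ η * (M + v) + ∑ G ∈ 𝒢, η * (m G + (eVariationOn f (W G)).toReal) :=
          add_le_add hB_le (Finset.sum_le_sum hL_le)
      _ ≤ _ := by
          rw [← Finset.mul_sum, Finset.sum_add_distrib]
          gcongr
          exact sum_var W fun _ _ => Subset.rfl
  linarith

/-! ### Variation of the iterated operator, branch by branch. -/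

namespace RandomOpenSystem

variable {Ω : Type*} [MeasurableSpace Ω] {P : Measure Ω} {R : RandomOpenSystem Ω P} {ω : Ω}
  {x y a b : ℝ} {n : ℕ} {f : ℝ → ℝ} {𝒰 𝒱 : Set (Set ℝ)}

open RandomIntervalMap

theorem bddAbove_weightN_image (n : ℕ) (ω : Ω) :
    BddAbove (R.weightN n ω '' R.survivor n ω) := by
  refine ⟨∏ i ∈ Finset.range n, R.weightSum (R.θ^[i] ω), ?_⟩
  rintro _ ⟨x, hx, rfl⟩
  exact weightN_le_prod (survivor_subset_X hx) n

theorem weightN_le_normWeight (hx : x ∈ R.survivor n ω) : R.weightN n ω x ≤ R.normWeight n ω :=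
  le_csSup (bddAbove_weightN_image n ω) (mem_image_of_mem _ hx)

theorem normWeight_nonneg : 0 ≤ R.normWeight n ω := by
  refine Real.sSup_nonneg ?_
  rintro _ ⟨x, -, rfl⟩
  exact weightN_nonneg

theorem normWeight_le_prod :
    R.normWeight n ω ≤ ∏ i ∈ Finset.range n, R.weightSum (R.θ^[i] ω) := by
  refine Real.sSup_le ?_ (Finset.prod_nonneg fun _ _ => weightSum_nonneg)
  rintro _ ⟨x, hx, rfl⟩
  exact weightN_le_prod (survivor_subset_X hx) n

theorem enorm_weightN : ‖R.weightN n ω x‖ₑ = ENNReal.ofReal (R.weightN n ω x) := by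
  rw [Real.enorm_eq_ofReal weightN_nonneg]

theorem IsAdaptedRefinement.unique (h : R.IsAdaptedRefinement n ω 𝒰 𝒱) {U V : Set ℝ}
    (hU : U ∈ 𝒱) (hV : V ∈ 𝒱) (hx : x ∈ U) (hx' : x ∈ V) : U = V :=
  h.1.2.2.1.elim_set hU hV x hx hx'

theorem IsAdaptedRefinement.nonempty (h : R.IsAdaptedRefinement n ω 𝒰 𝒱) {U : Set ℝ}
    (hU : U ∈ 𝒱) : U.Nonempty :=
  nonempty_iff_ne_empty.mpr fun he => h.1.2.1 (he ▸ hU)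

theorem IsAdaptedRefinement.subset_X (h : R.IsAdaptedRefinement n ω 𝒰 𝒱) {U : Set ℝ}
    (hU : U ∈ 𝒱) : U ⊆ R.X ω := by
  obtain ⟨⟨A, -, rfl⟩, -⟩ := h.2 U hU
  exact inter_subset_right

theorem IsAdaptedRefinement.ordered (h : R.IsAdaptedRefinement n ω 𝒰 𝒱) {U V : Set ℝ}
    (hU : U ∈ 𝒱) (hV : V ∈ 𝒱) (hne : U ≠ V) :
    (∀ x ∈ U, ∀ y ∈ V, x < y) ∨ (∀ x ∈ U, ∀ y ∈ V, y < x) := by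
  have hd : Disjoint U V := h.1.2.2.1 hU hV hne
  obtain ⟨⟨A, hA, rfl⟩, -⟩ := h.2 U hU
  obtain ⟨⟨B, hB, rfl⟩, -⟩ := h.2 V hV
  exact ordered_of_disjoint_trace hA hB hd

theorem IsAdaptedRefinement.exists_mem (h : R.IsAdaptedRefinement n ω 𝒰 𝒱)
    (hx : x ∈ R.survivor n ω) : ∃ U ∈ 𝒱, U ⊆ R.survivor n ω ∧ x ∈ U := by
  obtain ⟨U, hU, hxU⟩ := mem_sUnion.mp (h.1.2.2.2 ▸ survivor_subset_X hx)
  exact ⟨U, hU, (h.2 U hU).2.2.resolve_right fun hd => Set.disjoint_left.mp hd hxU hx, hxU⟩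

/-- The contribution to `ℒ_ω^n f` of the preimages in `A`, on which `T_ω^n` is injective. -/
noncomputable def branchTransfer (R : RandomOpenSystem Ω P) (n : ℕ) (ω : Ω) (f : ℝ → ℝ)
    (A : Set ℝ) : ℝ → ℝ :=
  (R.iter n ω '' A).indicator fun x =>
    f (Function.invFunOn (R.iter n ω) A x) * R.weightN n ω (Function.invFunOn (R.iter n ω) A x)

theorem branchTransfer_iter {A : Set ℝ} (hA : InjOn (R.iter n ω) A) (hy : y ∈ A) :
    R.branchTransfer n ω f A (R.iter n ω y) = f y * R.weightN n ω y := by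
  rw [branchTransfer, indicator_of_mem (mem_image_of_mem _ hy)]
  have : Function.invFunOn (R.iter n ω) A (R.iter n ω y) = y :=
    hA (Function.invFunOn_mem (mem_image_of_mem _ hy))
      hy (Function.invFunOn_eq (mem_image_of_mem _ hy))
  rw [this]

theorem injOn_cylinder {C : Set ℝ} (hC : C ∈ R.cylinders n ω) : InjOn (R.iter n ω) C := by
  obtain ⟨-, Z, hZ, rfl⟩ := mem_cylinders_iff.mp hC
  exact ((itinerary_regular hZ).2.2.elim StrictMonoOn.injOn StrictAntiOn.injOn).mono
    inter_subset_left

/-- A surviving preimage determines its pair of partition element and cylinder, and injectivity on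
the cylinder recovers it from the pair. Pairs without a preimage contribute zero. -/
theorem IsAdaptedRefinement.hasSum_branchTransfer (h : R.IsAdaptedRefinement n ω 𝒰 𝒱)
    (hf : R.IsBddOn ω f) (hx : x ∈ R.X (R.θ^[n] ω)) :
    HasSum (fun i : {U // U ∈ 𝒱 ∧ U ⊆ R.survivor n ω} × R.cylinders n ω =>
      R.branchTransfer n ω f (i.2 ∩ i.1) x) (R.transferN n ω f x) := by
  have hsum := hasSum_transferN hf hx
  have hU : ∀ y : {y : ℝ // y ∈ R.survivor n ω ∧ R.iter n ω y = x},
      ∃ U, (U ∈ 𝒱 ∧ U ⊆ R.survivor n ω) ∧ (y : ℝ) ∈ U := fun y => by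
    obtain ⟨U, h1, h2, h3⟩ := h.exists_mem y.2.1
    exact ⟨U, ⟨h1, h2⟩, h3⟩
  have hC : ∀ y : {y : ℝ // y ∈ R.survivor n ω ∧ R.iter n ω y = x},
      ∃ C, C ∈ R.cylinders n ω ∧ (y : ℝ) ∈ C := fun y =>
    exists_mem_cylinder n (survivor_subset_X y.2.1)
  choose u hu hyu using hU
  choose c hc hyc using hC
  set e : {y : ℝ // y ∈ R.survivor n ω ∧ R.iter n ω y = x} →
    {U // U ∈ 𝒱 ∧ U ⊆ R.survivor n ω} × R.cylinders n ω := fun y => (⟨u y, hu y⟩, ⟨c y, hc y⟩)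
    with he
  have hinj : Function.Injective e := by
    intro y₁ y₂ heq
    have h2 : c y₁ = c y₂ := congrArg (fun p => (p.2 : Set ℝ)) heq
    exact Subtype.ext (injOn_cylinder (hc y₁) (hyc y₁) (h2 ▸ hyc y₂)
      (y₁.2.2.trans y₂.2.2.symm))
  rw [← hinj.hasSum_iff]
  · refine hsum.congr_fun fun y => ?_
    have := branchTransfer_iter (f := f) ((injOn_cylinder (hc y)).mono inter_subset_left)
      (show (y : ℝ) ∈ c y ∩ u y from ⟨hyc y, hyu y⟩)
    rw [y.2.2] at this
    exact this
  · rintro ⟨⟨U, hU⟩, ⟨C, hC⟩⟩ hi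
    refine indicator_of_notMem ?_ _
    rintro ⟨y, ⟨hyC, hyU⟩, hyx⟩
    refine hi ⟨⟨y, hU.2 hyU, hyx⟩, ?_⟩
    simp only [he, Prod.mk.injEq, Subtype.mk.injEq]
    exact ⟨h.unique (hu _).1 hU.1 (hyu ⟨y, hU.2 hyU, hyx⟩) hyU,
      cylinder_unique (hc _) hC (hyc ⟨y, hU.2 hyU, hyx⟩) hyC⟩

/-- This is `pushforward_le` for one branch, whose convexity condition is `exists_iter_eq_of_mem_X`.
-/
theorem IsAdaptedRefinement.eVariationOn_branchTransfer_le
    (h : R.IsAdaptedRefinement n ω 𝒰 𝒱) {U C : Set ℝ} (hU : U ∈ 𝒱) (hUK : U ⊆ R.survivor n ω)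
    (hC : C ∈ R.cylinders n ω) {s : ℝ≥0∞} (hs : ∀ x ∈ U, ‖f x‖ₑ ≤ s) :
    eVariationOn (R.branchTransfer n ω f (C ∩ U)) (R.X (R.θ^[n] ω)) ≤
      eVariationOn (fun y => f y * R.weightN n ω y) (C ∩ U) +
        2 * (s * ⨆ x ∈ C ∩ U ∩ R.survivor n ω, ENNReal.ofReal (R.weightN n ω x)) := by
  have hinj := (injOn_cylinder hC).mono (inter_subset_left (t := U))
  obtain ⟨-, Z, hZ, rfl⟩ := mem_cylinders_iff.mp hC
  obtain ⟨⟨A, hA, rfl⟩, -⟩ := h.2 U hU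
  refine eVariationOn.pushforward_le (Φ := R.iter n ω) ?_ ?_
    (fun y hy => branchTransfer_iter hinj hy) (fun x _ hx => indicator_of_notMem hx _) ?_
  · have hsub : R.itinerary n ω Z ∩ R.X ω ∩ (A ∩ R.X ω) ⊆ R.itinerary n ω Z := fun y hy => hy.1.1
    exact (itinerary_regular hZ).2.2.imp (fun h => h.mono hsub) (fun h => h.mono hsub)
  · intro y₁ hy₁ y₂ hy₂ x hx h1 h2
    obtain ⟨y, hy, hyZ, hyX, rfl⟩ :=
      exists_iter_eq_of_mem_X hZ hy₁.1.1 hy₂.1.1 hy₁.1.2 hy₂.1.2 hx h1 h2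
    exact ⟨y, ⟨⟨hyZ, hyX⟩, hA.uIcc_subset hy₁.2.1 hy₂.2.1 hy, hyX⟩, rfl⟩
  · intro y hy
    rw [enorm_mul, enorm_weightN]
    gcongr
    · exact hs y hy.2
    · exact le_iSup₂_of_le y ⟨hy, hUK hy.2⟩ le_rfl

theorem cylinder_inter_ordered (U : Set ℝ) {C C' : Set ℝ}
    (hC : C ∈ R.cylinders n ω) (hC' : C' ∈ R.cylinders n ω) (hne : C ≠ C') :
    (∀ x ∈ C ∩ U, ∀ y ∈ C' ∩ U, x < y) ∨ (∀ x ∈ C ∩ U, ∀ y ∈ C' ∩ U, y < x) := by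
  have hd : Disjoint C C' := Set.disjoint_left.mpr fun x hx hx' =>
    hne (cylinder_unique hC hC' hx hx')
  obtain ⟨-, Z, hZ, rfl⟩ := mem_cylinders_iff.mp hC
  obtain ⟨-, Z', hZ', rfl⟩ := mem_cylinders_iff.mp hC'
  exact (ordered_of_disjoint_trace (itinerary_regular hZ).1 (itinerary_regular hZ').1 hd).imp
    (fun h x hx y hy => h x hx.1 y hy.1) (fun h x hx y hy => h x hx.1 y hy.1)

theorem IsAdaptedRefinement.eVariationOn_transferN_le (h : R.IsAdaptedRefinement n ω 𝒰 𝒱)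
    (had : R.IsAdmissible a b n ω 𝒰) (hf : R.IsBddOn ω f) {𝒦 : Finset (Set ℝ)}
    (h𝒦 : ∀ U, U ∈ 𝒦 ↔ U ∈ 𝒱 ∧ U ⊆ R.survivor n ω) {s : Set ℝ → ℝ≥0∞}
    (hs : ∀ U ∈ 𝒦, ∀ x ∈ U, ‖f x‖ₑ ≤ s U) :
    eVariationOn (R.transferN n ω f) (R.X (R.θ^[n] ω)) ≤
      ∑ U ∈ 𝒦, (ENNReal.ofReal (R.normWeight n ω) * eVariationOn f U +
        s U * ENNReal.ofReal (a * R.normWeight n ω) +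
        2 * (s U * ENNReal.ofReal (b * R.normWeight n ω))) := by
  calc eVariationOn (R.transferN n ω f) (R.X (R.θ^[n] ω))
      ≤ ∑' i : {U // U ∈ 𝒱 ∧ U ⊆ R.survivor n ω} × R.cylinders n ω,
          eVariationOn (R.branchTransfer n ω f (i.2 ∩ i.1)) (R.X (R.θ^[n] ω)) :=
        eVariationOn.le_tsum_of_hasSum fun x hx => h.hasSum_branchTransfer hf hx
    _ ≤ ∑' i : {U // U ∈ 𝒱 ∧ U ⊆ R.survivor n ω} × R.cylinders n ω,
          (eVariationOn (fun y => f y * R.weightN n ω y) (i.2 ∩ i.1) + 2 * (s i.1 *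
            ⨆ x ∈ (i.2 : Set ℝ) ∩ i.1 ∩ R.survivor n ω, ENNReal.ofReal (R.weightN n ω x))) :=
        ENNReal.tsum_le_tsum fun i => h.eVariationOn_branchTransfer_le i.1.2.1 i.1.2.2 i.2.2
          (hs i.1 ((h𝒦 _).mpr i.1.2))
    _ = ∑' U : {U // U ∈ 𝒱 ∧ U ⊆ R.survivor n ω}, ∑' C : R.cylinders n ω,
          (eVariationOn (fun y => f y * R.weightN n ω y) (C ∩ U) + 2 * (s U *
            ⨆ x ∈ (C : Set ℝ) ∩ U ∩ R.survivor n ω, ENNReal.ofReal (R.weightN n ω x))) :=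
        ENNReal.tsum_prod (f := fun (U : {U // U ∈ 𝒱 ∧ U ⊆ R.survivor n ω})
          (C : R.cylinders n ω) => eVariationOn (fun y => f y * R.weightN n ω y) (C ∩ U) +
            2 * (s U * ⨆ x ∈ (C : Set ℝ) ∩ U ∩ R.survivor n ω,
              ENNReal.ofReal (R.weightN n ω x)))
    _ ≤ ∑' U : {U // U ∈ 𝒱 ∧ U ⊆ R.survivor n ω},
          (ENNReal.ofReal (R.normWeight n ω) * eVariationOn f U +
            s U * ENNReal.ofReal (a * R.normWeight n ω) +
            2 * (s U * ENNReal.ofReal (b * R.normWeight n ω))) := by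
        refine ENNReal.tsum_le_tsum fun U => ?_
        obtain ⟨U, hU, hUK⟩ := U
        obtain ⟨-, ⟨V, hV, hUV⟩, -⟩ := h.2 U hU
        obtain ⟨hvar, hsup⟩ := had.2 V hV
        rw [ENNReal.tsum_add, ENNReal.tsum_mul_left, ENNReal.tsum_mul_left]
        have hsU := hs U ((h𝒦 U).mpr ⟨hU, hUK⟩)
        refine add_le_add ?_ ?_
        -- The pieces `C ∩ U` are ordered, so their variations sum to at most the variation over
        -- `U`, and the product rule is applied only once, on `U`.
        · refine (eVariationOn.tsum_le_of_ordered _ (s := U) (fun C => inter_subset_right)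
            fun C C' hne => cylinder_inter_ordered U C.2 C'.2
              fun e => hne (Subtype.ext e)).trans ?_
          refine (eVariationOn.mul_le f (R.weightN n ω) hsU (Cg := ENNReal.ofReal
            (R.normWeight n ω)) fun x hx => ?_).trans ?_
          · rw [enorm_weightN]
            exact ENNReal.ofReal_le_ofReal (weightN_le_normWeight (hUK hx))
          · gcongr
            exact (eVariationOn.mono _ (subset_inter hUV hUK)).trans hvar
        · gcongr
          refine le_trans (ENNReal.tsum_le_tsum fun C => ?_) hsup
          exact biSup_mono fun x hx => ⟨⟨hx.1.1, hUV hx.1.2⟩, hx.2⟩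
    _ = _ := by
        have : ∀ g : Set ℝ → ℝ≥0∞, ∑' U : {U // U ∈ 𝒱 ∧ U ⊆ R.survivor n ω}, g U
            = ∑ U ∈ 𝒦, g U := fun g => by
          rw [← Finset.tsum_subtype]
          exact (Equiv.subtypeEquivRight fun U => (h𝒦 U).symm).tsum_eq
            (fun U : {U // U ∈ 𝒦} => g U)
        exact this fun U => ENNReal.ofReal (R.normWeight n ω) * eVariationOn f U +
          s U * ENNReal.ofReal (a * R.normWeight n ω) +
          2 * (s U * ENNReal.ofReal (b * R.normWeight n ω))

end RandomOpenSystem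

/-! ### Chains of bad elements and the Lasota–Yorke inequality. -/

namespace RandomOpenSystem

variable {Ω : Type*} [MeasurableSpace Ω] {P : Measure Ω} {R : RandomOpenSystem Ω P} {ω : Ω}
  {x y a b : ℝ} {n : ℕ} {f : ℝ → ℝ} {𝒰 𝒱 : Set (Set ℝ)}

open RandomIntervalMap

variable (R) in
/-- Two bad elements that are contiguous. -/
def BadLink (n : ℕ) (ω : Ω) (𝒱 : Set (Set ℝ)) (A B : Set ℝ) : Prop :=
  A ∈ R.bad n ω 𝒱 ∧ B ∈ R.bad n ω 𝒱 ∧ R.Contiguous n ω A B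

theorem Contiguous.symm {U V : Set ℝ} (h : R.Contiguous n ω U V) : R.Contiguous n ω V U := by
  refine ⟨h.1.symm, h.2.imp (fun h' => inter_comm (closure U) _ ▸ h') fun h' x hx hxV hxU => ?_⟩
  rintro ⟨v, hv, u, hu, hvu⟩
  exact h' x hx hxU hxV ⟨u, hu, v, hv, hvu.symm⟩

/-- Two elements contained in `K_{ω,n-1}` without a further such element between them are
contiguous. -/
theorem IsAdaptedRefinement.contiguous (h : R.IsAdaptedRefinement n ω 𝒰 𝒱) {U V : Set ℝ}
    (hU : U ∈ 𝒱) (hV : V ∈ 𝒱) (hUV : ∀ x ∈ U, ∀ y ∈ V, x < y)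
    (hno : ∀ W ∈ 𝒱, W ⊆ R.survivor n ω → (∀ x ∈ U, ∀ y ∈ W, x < y) →
      ¬ ∀ x ∈ W, ∀ y ∈ V, x < y) : R.Contiguous n ω U V := by
  obtain ⟨u₀, hu₀⟩ := h.nonempty hU
  refine ⟨fun e => (hUV u₀ hu₀ u₀ (e ▸ hu₀)).false, .inr fun x hx hxU hxV hbetw => ?_⟩
  obtain ⟨u, hu, v, hv, huv⟩ := hbetw
  have hxuv : u < x ∧ x < v := huv.resolve_right fun h' =>
    ((hUV u hu v hv).trans (h'.1.trans h'.2)).false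
  obtain ⟨W, hW, hxW⟩ := mem_sUnion.mp (h.1.2.2.2.symm ▸ hx)
  have h1 : ∀ z ∈ U, ∀ y ∈ W, z < y :=
    (h.ordered hU hW fun e => hxU (e ▸ hxW)).resolve_right fun h' =>
      (hxuv.1.trans (h' u hu x hxW)).false
  have h2 : ∀ z ∈ W, ∀ y ∈ V, z < y :=
    (h.ordered hW hV fun e => hxV (e ▸ hxW)).resolve_right fun h' =>
      (hxuv.2.trans (h' x hxW v hv)).false
  -- The element containing `x` lies between `U` and `V`, so it cannot survive. Being adapted, it is
  -- then disjoint from the survivor set, and `x` falls into the hole.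
  have hWK : ¬ W ⊆ R.survivor n ω := fun hK => hno W hW hK h1 h2
  have hxK : x ∉ R.survivor n ω := fun hxK =>
    Set.disjoint_left.mp ((h.2 W hW).2.2.resolve_left hWK) hxW hxK
  by_contra! hcon
  exact hxK ⟨hx, fun i hi => ⟨iter_mem_X hx i, hcon i hi⟩⟩

/-- Induction on the number of surviving elements strictly between: any such element is bad, because
no good one lies there, and it splits the problem in two. With none left, the two ends are
contiguous. -/
theorem IsAdaptedRefinement.badLink_chain (h : R.IsAdaptedRefinement n ω 𝒰 𝒱)
    (hF : ∀ U : Set ℝ, 0 ≤ R.F ω (U.indicator 1)) {U V : Set ℝ}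
    (hU : U ∈ R.bad n ω 𝒱) (hV : V ∈ R.bad n ω 𝒱) (hUV : ∀ x ∈ U, ∀ y ∈ V, x < y)
    (hno : ∀ G ∈ R.good n ω 𝒱, (∀ x ∈ U, ∀ y ∈ G, x < y) → ¬ ∀ x ∈ G, ∀ y ∈ V, x < y) :
    Relation.ReflTransGen (R.BadLink n ω 𝒱) U V ∧ Relation.ReflTransGen (R.BadLink n ω 𝒱) V U := by
  set S : Set ℝ → Set ℝ → Set (Set ℝ) := fun U V => {W ∈ 𝒱 | W ⊆ R.survivor n ω ∧
    (∀ x ∈ U, ∀ y ∈ W, x < y) ∧ ∀ x ∈ W, ∀ y ∈ V, x < y} with hS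
  have hfin : ∀ U V, (S U V).Finite := fun U V => h.1.1.subset fun W hW => hW.1
  induction hk : (S U V).ncard using Nat.strong_induction_on generalizing U V with
  | _ k ih =>
    by_cases hex : (S U V).Nonempty
    · obtain ⟨W, hW, hWK, h1, h2⟩ := hex
      obtain ⟨w, hw⟩ := h.nonempty hW
      have hWbad : W ∈ R.bad n ω 𝒱 := by
        refine ⟨hW, hWK, le_antisymm (not_lt.mp fun hpos => ?_) (hF W)⟩
        exact hno W ⟨hW, hWK, hpos⟩ h1 h2
      have hWmem : W ∈ S U V := ⟨hW, hWK, h1, h2⟩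
      have hss1 : S U W ⊂ S U V := by
        refine ⟨fun T hT => ⟨hT.1, hT.2.1, hT.2.2.1, fun x hx y hy =>
          (hT.2.2.2 x hx w hw).trans (h2 w hw y hy)⟩, fun hsub => ?_⟩
        exact ((hsub hWmem).2.2.2 w hw w hw).false
      have hss2 : S W V ⊂ S U V := by
        refine ⟨fun T hT => ⟨hT.1, hT.2.1, fun x hx y hy =>
          (h1 x hx w hw).trans (hT.2.2.1 w hw y hy), hT.2.2.2⟩, fun hsub => ?_⟩
        exact ((hsub hWmem).2.2.1 w hw w hw).false
      obtain ⟨r1, r2⟩ := ih _ (hk ▸ Set.ncard_lt_ncard hss1 (hfin _ _)) hU hWbad h1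
        (fun G hG hUG hGW => hno G hG hUG fun x hx y hy =>
          (hGW x hx w hw).trans (h2 w hw y hy)) rfl
      obtain ⟨r3, r4⟩ := ih _ (hk ▸ Set.ncard_lt_ncard hss2 (hfin _ _)) hWbad hV h2
        (fun G hG hWG hGV => hno G hG (fun x hx y hy =>
          (h1 x hx w hw).trans (hWG w hw y hy)) hGV) rfl
      exact ⟨r1.trans r3, r4.trans r2⟩
    · have hc := h.contiguous hU.1 hV.1 hUV fun W hW hWK h1 h2 => hex ⟨W, hW, hWK, h1, h2⟩
      exact ⟨.single ⟨hU, hV, hc⟩, .single ⟨hV, hU, hc.symm⟩⟩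

/-- A mutually linked family sits inside one class. Finiteness of the partition keeps `ncard` and
`sSup` in the definition of `eta` from taking default values. -/
theorem IsAdaptedRefinement.card_le_eta (h : R.IsAdaptedRefinement n ω 𝒰 𝒱)
    {B : Finset (Set ℝ)} (hB : ∀ U ∈ B, U ∈ R.bad n ω 𝒱)
    (hlink : ∀ U ∈ B, ∀ V ∈ B, Relation.ReflTransGen (R.BadLink n ω 𝒱) U V) :
    B.card ≤ R.eta n ω 𝒱 := by
  rcases B.eq_empty_or_nonempty with rfl | ⟨U, hU⟩
  · simp
  have hbad : (R.bad n ω 𝒱).Finite := h.1.1.subset fun V hV => hV.1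
  have hclass : {V | Relation.ReflTransGen (R.BadLink n ω 𝒱) U V} ⊆ R.bad n ω 𝒱 := by
    intro V hV
    rcases Relation.ReflTransGen.cases_tail hV with rfl | ⟨W, -, hWV⟩
    · exact hB _ hU
    · exact hWV.2.1
  calc B.card = (B : Set (Set ℝ)).ncard := (Set.ncard_coe_finset B).symm
    _ ≤ {V | Relation.ReflTransGen (R.BadLink n ω 𝒱) U V}.ncard :=
        Set.ncard_le_ncard (fun V hV => hlink U hU V hV) (hbad.subset hclass)
    _ ≤ _ := le_csSup (hbad.image _).bddAbove ⟨U, hB U hU, rfl⟩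

/-- The Lasota–Yorke inequality for `ℒ_ω^n`. -/
theorem eVariationOn_transferN_le (hsupp : ∀ ω, (R.suppInfty ω).Nonempty) (ha : 0 ≤ a)
    (hb : 1 ≤ b) (hn : 1 ≤ n) (h𝒰 : R.IsAdmissible a b n ω 𝒰)
    (h𝒱 : R.IsAdaptedRefinement n ω 𝒰 𝒱) {δ : ℝ} (hδ : 0 < δ)
    (hgood : ∀ U ∈ R.good n ω 𝒱, 2 * δ ≤ R.F ω (U.indicator 1))
    (hf : BoundedVariationOn f (R.X ω)) :
    eVariationOn (R.transferN n ω f) (R.X (R.θ^[n] ω)) ≤ ENNReal.ofReal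
      ((a + 2 * b + 1 + (2 * a + 4 * b) * (R.eta n ω 𝒱 : ℝ)) * R.normWeight n ω *
          (eVariationOn f (R.X ω)).toReal +
        (a + 2 * b) * ((1 + (R.eta n ω 𝒱 : ℝ)) / (2 * δ) + (R.eta n ω 𝒱 : ℝ)) *
          R.normWeight n ω * R.F ω fun x => |f x|) := by
  classical
  have hfb : R.IsBddOn ω f := isBddOn_of_boundedVariationOn hf
  set 𝒦 : Finset (Set ℝ) := {U ∈ h𝒱.1.1.toFinset | U ⊆ R.survivor n ω} with h𝒦def
  have h𝒦 : ∀ U, U ∈ 𝒦 ↔ U ∈ 𝒱 ∧ U ⊆ R.survivor n ω := fun U => by simp [h𝒦def]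
  have hF0 : ∀ U : Set ℝ, 0 ≤ R.F ω (U.indicator 1) := fun U =>
    F_nonneg hsupp (isBddOn_indicator U) fun y _ => indicator_nonneg (fun _ _ => zero_le_one) y
  set 𝒢 : Finset (Set ℝ) := {U ∈ 𝒦 | 0 < R.F ω (U.indicator 1)} with h𝒢def
  set ℬ : Finset (Set ℝ) := {U ∈ 𝒦 | ¬ 0 < R.F ω (U.indicator 1)} with hℬdef
  have h𝒢 : ∀ U, U ∈ 𝒢 ↔ U ∈ R.good n ω 𝒱 := fun U => by
    rw [h𝒢def, Finset.mem_filter, h𝒦, and_assoc]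
    rfl
  have hℬ : ∀ U, U ∈ ℬ → U ∈ R.bad n ω 𝒱 := fun U hU => by
    obtain ⟨h1, h2⟩ := Finset.mem_filter.mp hU
    exact ⟨((h𝒦 U).mp h1).1, ((h𝒦 U).mp h1).2, le_antisymm (not_lt.mp h2) (hF0 U)⟩
  have hK : ∀ U, U ∈ 𝒢 ∨ U ∈ ℬ → U ∈ 𝒱 ∧ U ⊆ R.survivor n ω := fun U hU =>
    (h𝒦 U).mp (hU.elim (fun h => (Finset.mem_filter.mp h).1) fun h => (Finset.mem_filter.mp h).1)
  set r : Set ℝ → ℝ := fun U => if h : U.Nonempty then h.some else 0 with hrdef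
  have hr : ∀ U, U ∈ 𝒱 → r U ∈ U := fun U hU => by
    simp [hrdef, h𝒱.nonempty hU, (h𝒱.nonempty hU).some_mem]
  have hrlt : ∀ U ∈ 𝒱, ∀ V ∈ 𝒱, r U < r V → ∀ x ∈ U, ∀ y ∈ V, x < y := fun U hU V hV hlt =>
    (h𝒱.ordered hU hV fun e => hlt.ne (congrArg r e)).resolve_right fun h' =>
      (hlt.trans (h' _ (hr U hU) _ (hr V hV))).false
  set v := (eVariationOn f (R.X ω)).toReal with hv
  set M := R.F ω fun x => |f x| with hMdef
  set η : ℝ := (R.eta n ω 𝒱 : ℝ) with hη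
  set g := R.normWeight n ω
  have hg0 : 0 ≤ g := normWeight_nonneg
  have hη0 : 0 ≤ η := Nat.cast_nonneg _
  have hM0 : 0 ≤ M := F_nonneg hsupp hfb.abs fun _ _ => abs_nonneg _
  -- `|f x| - v` is a lower bound for `|f|` on the survivors, hence a lower bound for `F |f|`.
  have hMx : ∀ x ∈ R.X ω, |f x| ≤ M + v := fun x hx => by
    rw [← sub_le_iff_le_add]
    refine le_F_of_le_on_survivor hsupp hn hfb.abs fun y hy => ?_
    linarith [hf.abs_le_abs_add hx (survivor_subset_X hy)]
  set σ : Set ℝ → ℝ := fun U => sSup ((fun x => |f x|) '' U)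
  set m : Set ℝ → ℝ := fun U => sInf ((fun x => |f x|) '' U)
  have hσ0 : ∀ U, 0 ≤ σ U := fun U => by
    refine Real.sSup_nonneg ?_
    rintro _ ⟨x, -, rfl⟩
    exact abs_nonneg _
  have hm0 : ∀ U, 0 ≤ m U := fun U => by
    refine Real.sInf_nonneg ?_
    rintro _ ⟨x, -, rfl⟩
    exact abs_nonneg _
  have hσ : ∀ U ∈ 𝒦, ∀ x ∈ U, ‖f x‖ₑ ≤ ENNReal.ofReal (σ U) := by
    intro U hU x hx
    rw [Real.enorm_eq_ofReal_abs]
    refine ENNReal.ofReal_le_ofReal (le_csSup ⟨M + v, ?_⟩ (mem_image_of_mem _ hx))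
    rintro _ ⟨y, hy, rfl⟩
    exact hMx y (h𝒱.subset_X ((h𝒦 U).mp hU).1 hy)
  have hcard : ∀ B ⊆ ℬ, (∀ U ∈ B, ∀ V ∈ B, ∀ G ∈ 𝒢, r U < r G → ¬ r G < r V) →
      (B.card : ℝ) ≤ η := by
    intro B hB hno
    refine Nat.cast_le.mpr (h𝒱.card_le_eta (fun U hU => hℬ U (hB hU)) fun U hU V hV => ?_)
    have hUb := hℬ U (hB hU)
    have hVb := hℬ V (hB hV)
    have hnog : ∀ U ∈ B, ∀ V ∈ B, ∀ G ∈ R.good n ω 𝒱, (∀ x ∈ U, ∀ y ∈ G, x < y) →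
        ¬ ∀ x ∈ G, ∀ y ∈ V, x < y := fun U hU V hV G hG h1 h2 =>
      hno U hU V hV G ((h𝒢 G).mpr hG)
        (h1 _ (hr U (hℬ U (hB hU)).1) _ (hr G hG.1))
        (h2 _ (hr G hG.1) _ (hr V (hℬ V (hB hV)).1))
    by_cases hne : U = V
    · rw [hne]
    rcases h𝒱.ordered hUb.1 hVb.1 hne with hlt | hlt
    · exact (h𝒱.badLink_chain hF0 hUb hVb hlt (hnog U hU V hV)).1
    · exact (h𝒱.badLink_chain hF0 hVb hUb (fun x hx y hy => hlt y hy x hx)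
        (hnog V hV U hU)).2
  have hsumσ := sum_sSup_abs_le_of_ordered hf hη0 hM0
    (Finset.disjoint_filter_filter_not 𝒦 𝒦 fun U => 0 < R.F ω (U.indicator 1))
    (fun U hU => h𝒱.subset_X (hK U hU).1) (fun U hU => hr U (hK U hU).1)
    (fun U hU V hV hne => h𝒱.ordered (hK U hU).1 (hK V hV).1 hne) hcard hMx
  rw [Finset.sum_filter_add_sum_filter_not] at hsumσ
  -- Disjointness of the good elements makes the step function with values `inf_U |f|` lie below
  -- `|f|`.
  have hsumm : ∑ U ∈ 𝒢, m U ≤ M / (2 * δ) := by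
    rw [le_div_iff₀ (by positivity), Finset.sum_mul]
    refine (Finset.sum_le_sum fun U hU => mul_le_mul_of_nonneg_left
      (hgood U ((h𝒢 U).mp hU)) (hm0 U)).trans
      (sum_F_indicator_le hsupp (fun U _ => hm0 U) hfb.abs fun x hx => ?_)
    by_cases hex : ∃ U ∈ 𝒢, x ∈ U
    · obtain ⟨U, hU, hxU⟩ := hex
      rw [Finset.sum_eq_single U]
      · rw [indicator_of_mem hxU, Pi.one_apply, mul_one]
        refine csInf_le ⟨0, ?_⟩ (mem_image_of_mem _ hxU)
        rintro _ ⟨y, -, rfl⟩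
        exact abs_nonneg _
      · intro V hV hne
        rw [indicator_of_notMem, mul_zero]
        exact fun hxV => hne (h𝒱.unique (hK V (.inl hV)).1 (hK U (.inl hU)).1 hxV hxU)
      · exact fun h => absurd hU h
    · push Not at hex
      rw [Finset.sum_eq_zero fun U hU => by rw [indicator_of_notMem (hex U hU), mul_zero]]
      exact abs_nonneg _
  have hsumv : ∑ U ∈ 𝒦, (eVariationOn f U).toReal ≤ v := by
    rw [← ENNReal.toReal_sum fun U hU => hf.mono (h𝒱.subset_X ((h𝒦 U).mp hU).1)]
    exact ENNReal.toReal_mono hf ((eVariationOn.sum_le_of_ordered f 𝒦 fun U hU V hV hne =>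
      h𝒱.ordered ((h𝒦 U).mp hU).1 ((h𝒦 V).mp hV).1 hne).trans
      (eVariationOn.mono f (iUnion₂_subset fun U hU => h𝒱.subset_X ((h𝒦 U).mp hU).1)))
  refine (h𝒱.eVariationOn_transferN_le h𝒰 hfb h𝒦 hσ).trans ?_
  have hterm : ∀ U ∈ 𝒦, ENNReal.ofReal g * eVariationOn f U +
      ENNReal.ofReal (σ U) * ENNReal.ofReal (a * g) +
      2 * (ENNReal.ofReal (σ U) * ENNReal.ofReal (b * g)) =
      ENNReal.ofReal (g * (eVariationOn f U).toReal + (a + 2 * b) * g * σ U) := by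
    intro U hU
    have hfin : eVariationOn f U ≠ ⊤ := hf.mono (h𝒱.subset_X ((h𝒦 U).mp hU).1)
    have hσU := hσ0 U
    conv_lhs => rw [← ENNReal.ofReal_toReal hfin,
      show (2 : ℝ≥0∞) = ENNReal.ofReal 2 by simp,
      ← ENNReal.ofReal_mul hg0, ← ENNReal.ofReal_mul hσU, ← ENNReal.ofReal_mul hσU,
      ← ENNReal.ofReal_mul zero_le_two, ← ENNReal.ofReal_add (by positivity) (by positivity),
      ← ENNReal.ofReal_add (by positivity) (by positivity)]
    congr 1
    ring
  rw [Finset.sum_congr rfl hterm, ← ENNReal.ofReal_sum_of_nonneg fun U _ => by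
    have := hσ0 U
    positivity]
  refine ENNReal.ofReal_le_ofReal ?_
  rw [Finset.sum_add_distrib, ← Finset.mul_sum, ← Finset.mul_sum]
  have h1 : (1 + η) * ∑ U ∈ 𝒢, m U ≤ (1 + η) * (M / (2 * δ)) :=
    mul_le_mul_of_nonneg_left hsumm (by positivity)
  -- Multiplying by `(a + 2b) g` and adding `g v` produces the coefficient `a + 2b + 1 + (2a + 4b)
  -- η` of `g v`.
  have h2 : ∑ U ∈ 𝒦, σ U ≤ (1 + 2 * η) * v + ((1 + η) / (2 * δ) + η) * M := by
    refine hsumσ.trans ?_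
    have : ((1 + η) / (2 * δ) + η) * M = (1 + η) * (M / (2 * δ)) + η * M := by ring
    linarith
  calc _ ≤ g * v + (a + 2 * b) * g * ((1 + 2 * η) * v + ((1 + η) / (2 * δ) + η) * M) := by gcongr
    _ = _ := by ring

end RandomOpenSystem

/-! ### Deterministic iteration and measurable selection. -/

/-- For `V + Φ` the inhomogeneous step becomes multiplicative: `E (V + Φ) + Φ ≤ 2 E (V + Φ)` as `E ≥
1`. In the application the index runs backwards in time, `0` being the final fiber. -/
theorem add_le_pow_mul_of_step {V e : ℕ → ℝ} {Φ E : ℝ} {n : ℕ} (hV : ∀ j, 0 ≤ V j) (hΦ : 0 ≤ Φ)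
    (hE : 1 ≤ E) (hstep : ∀ j, j + 1 ≤ n → V j ≤ e (j + 1) * V (j + 1) + e (j + 1) * Φ) (j r : ℕ)
    (hr : j + r ≤ n) (he : ∀ i ≤ j + r, e i ≤ E) :
    V j + Φ ≤ (2 * E) ^ r * (V (j + r) + Φ) := by
  induction r with
  | zero => simp
  | succ r ih =>
    refine (ih (by omega) fun i hi => he i (by omega)).trans ?_
    rw [pow_succ, mul_assoc]
    refine mul_le_mul_of_nonneg_left ?_ (by positivity)
    have h1 := hstep (j + r) (by omega)
    have h2 := he (j + r + 1) (by omega)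
    have h3 := mul_le_mul_of_nonneg_right h2 (hV (j + r + 1))
    have h4 := mul_le_mul_of_nonneg_right h2 hΦ
    have h5 : Φ ≤ E * Φ := le_mul_of_one_le_left hΦ hE
    have h6 : 0 ≤ E * V (j + r + 1) := mul_nonneg (by linarith) (hV _)
    rw [← add_assoc]
    linarith

theorem le_prod_mul_add_of_block {V c e : ℕ → ℝ} {Φ : ℝ} {n N : ℕ} (hc : ∀ j, 0 ≤ c j)
    (hblock : ∀ j, j + N ≤ n → V j ≤ c (j + N) * V (j + N) + e (j + N) * Φ) (s m : ℕ)
    (hm : s + m * N ≤ n) :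
    V s ≤ (∏ k ∈ Finset.range m, c (s + (k + 1) * N)) * V (s + m * N) +
      (∑ k ∈ Finset.range m, (∏ i ∈ Finset.range k, c (s + (i + 1) * N)) *
        e (s + (k + 1) * N)) * Φ := by
  induction m with
  | zero => simp
  | succ m ih =>
    have hm' : s + m * N + N = s + (m + 1) * N := by ring
    have h1 := ih (by omega)
    have h2 := hblock (s + m * N) (by omega)
    rw [hm'] at h2
    rw [Finset.prod_range_succ, Finset.sum_range_succ]
    have h3 := mul_le_mul_of_nonneg_left h2
      (Finset.prod_nonneg fun k (_ : k ∈ Finset.range m) => hc (s + (k + 1) * N))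
    linarith

/-- Iterating a contraction over blocks of length `N`, started at the phase `s`, together with a
rough one-step bound for the incomplete blocks at both ends. -/
theorem exists_exp_bound_of_block (N : ℕ) {α ε lam : ℝ} (K : ℝ) (hα : 0 < α)
    (hε : 0 ≤ ε) (hN : 1 ≤ N) (hlam : N * (α + N * ε) ≤ lam) (hK : 0 ≤ K) :
    ∃ Ψ : ℝ, 0 < Ψ ∧ ∀ (n s : ℕ) (V c e : ℕ → ℝ) (Φ : ℝ), s < N → (∀ j, 0 ≤ V j) → 0 ≤ Φ →
      (∀ j, 0 ≤ c j) → (∀ j, e j ≤ Real.exp (K + ε * j)) →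
      (∀ m : ℕ, ∏ k ∈ Finset.range m, c (s + (k + 1) * N) ≤ Real.exp (K - lam * m)) →
      (∀ j, j + N ≤ n → V j ≤ c (j + N) * V (j + N) + e (j + N) * Φ) →
      (∀ j, j + 1 ≤ n → V j ≤ e (j + 1) * V (j + 1) + e (j + 1) * Φ) →
      V 0 ≤ Ψ * Real.exp (-α * n) * V n + Ψ * Φ := by
  have hN' : (1 : ℝ) ≤ N := by exact_mod_cast hN
  -- `B` pays for the at most `N` single steps next to index `0`, `A` for the geometric series of
  -- error terms, and `D` for the incomplete block next to index `n`.
  set B : ℝ := (2 * Real.exp (K + ε * N)) ^ N with hB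
  set A : ℝ := Real.exp (2 * K + 2 * ε * N) * (1 - Real.exp (-α))⁻¹ with hA
  set D : ℝ := 2 ^ N * Real.exp (K + N * K + 2 * N * (α + N * ε)) with hD
  have hone : ∀ t : ℝ, 0 ≤ t → 1 ≤ Real.exp (K + ε * t) := fun t ht =>
    Real.one_le_exp (by positivity)
  have hlt1 : Real.exp (-α) < 1 := by
    rw [← Real.exp_zero]
    exact Real.exp_lt_exp.mpr (by linarith)
  have hA0 : 0 ≤ A := mul_nonneg (Real.exp_pos _).le (inv_nonneg.mpr (by linarith))
  have hB1 : 1 ≤ B := one_le_pow₀ (by linarith [hone N (by linarith)])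
  have hD0 : 0 ≤ D := by positivity
  refine ⟨B * (D + A + 1 + Real.exp (α * N)), by positivity, ?_⟩
  intro n s V c e Φ hs hV hΦ hc he hprod hblock hstep
  have hx0 := Real.exp_pos (-α * n)
  have hαN := Real.exp_pos (α * N)
  have hfirst : ∀ r ≤ N, r ≤ n → V 0 + Φ ≤ B * (V r + Φ) := by
    intro r hrN hrn
    have hE := hone N (by linarith)
    have h := add_le_pow_mul_of_step hV hΦ hE hstep 0 r (by omega) fun i hi =>
      (he i).trans (Real.exp_le_exp.mpr (by
        have : (i : ℝ) ≤ N := by exact_mod_cast (by omega : i ≤ N)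
        gcongr))
    rw [zero_add] at h
    exact h.trans (mul_le_mul_of_nonneg_right (pow_le_pow_right₀ (by linarith) hrN)
      (add_nonneg (hV r) hΦ))
  rcases Nat.lt_or_ge n s with hns | hns
  · have h := hfirst n (by omega) le_rfl
    have h1 : 1 ≤ Real.exp (α * N) * Real.exp (-α * n) := by
      rw [← Real.exp_add]
      refine Real.one_le_exp ?_
      have : (n : ℝ) ≤ N := by exact_mod_cast (by omega : n ≤ N)
      nlinarith
    have h2 : V n ≤ Real.exp (α * N) * Real.exp (-α * n) * V n :=
      le_mul_of_one_le_left (hV n) h1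
    have h3 : 0 ≤ B * (D + A + 1) * Real.exp (-α * n) * V n := by
      have := hV n
      positivity
    have h4 : 0 ≤ B * (D + A + Real.exp (α * N)) * Φ := by positivity
    have h5 := mul_le_mul_of_nonneg_left h2 (by linarith : 0 ≤ B)
    linarith
  · set m := (n - s) / N with hm
    have hdm : N * m + (n - s) % N = n - s := Nat.div_add_mod (n - s) N
    have hr : (n - s) % N < N := Nat.mod_lt _ (by omega)
    set r := (n - s) % N with hrdef
    have hq : s + m * N + r = n := by
      have : N * m = m * N := mul_comm _ _
      omega
    have h1 := hfirst s hs.le hns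
    have h2 := le_prod_mul_add_of_block (V := V) hc hblock s m (by omega)
    have h3 := add_le_pow_mul_of_step hV hΦ (hone n (Nat.cast_nonneg n)) hstep (s + m * N) r hq.le
      fun i hi => (he i).trans (Real.exp_le_exp.mpr (by
        have : (i : ℝ) ≤ n := by exact_mod_cast (by omega : i ≤ n)
        gcongr))
    rw [hq] at h3
    have h4 : (2 * Real.exp (K + ε * n)) ^ r ≤ (2 * Real.exp (K + ε * n)) ^ N :=
      pow_le_pow_right₀ (by linarith [hone n (Nat.cast_nonneg n)]) hr.le
    have h5 : V (s + m * N) ≤ (2 * Real.exp (K + ε * n)) ^ N * (V n + Φ) := by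
      have := mul_le_mul_of_nonneg_right h4 (add_nonneg (hV n) hΦ)
      linarith
    -- The incomplete block costs up to `exp (N ε n)`. The contraction absorbs it and keeps the rate
    -- `α`, since `lam ≥ N (α + N ε)` and `N m ≥ n - 2 N`.
    have h6 : Real.exp (K - lam * m) * (2 * Real.exp (K + ε * n)) ^ N ≤
        D * Real.exp (-α * n) := by
      rw [mul_pow, ← Real.exp_nat_mul, hD]
      calc Real.exp (K - lam * m) * (2 ^ N * Real.exp (N * (K + ε * n)))
          = 2 ^ N * Real.exp (K - lam * m + N * (K + ε * n)) := by
            rw [Real.exp_add]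
            ring
        _ ≤ 2 ^ N * Real.exp (K + N * K + 2 * N * (α + N * ε) + -α * n) := by
            refine mul_le_mul_of_nonneg_left (Real.exp_le_exp.mpr ?_) (by positivity)
            have hn2 : (n : ℝ) - 2 * N ≤ N * m := by
              have : (n : ℝ) = s + m * N + r := by exact_mod_cast hq.symm
              have hs' : (s : ℝ) ≤ N := by exact_mod_cast hs.le
              have hr' : (r : ℝ) ≤ N := by exact_mod_cast hr.le
              nlinarith
            have h7 : N * (α + N * ε) * m ≤ lam * m :=
              mul_le_mul_of_nonneg_right hlam (Nat.cast_nonneg m)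
            have h8 : (α + N * ε) * (n - 2 * N) ≤ (α + N * ε) * (N * m) :=
              mul_le_mul_of_nonneg_left hn2 (by positivity)
            nlinarith
        _ = _ := by
            rw [Real.exp_add]
            ring
    -- Per block the error coefficient may grow by `exp (N ε)`, but `lam ≥ α + N ε`, so the terms
    -- decay at least like `exp (-α k)`.
    have h7 : ∑ k ∈ Finset.range m, (∏ i ∈ Finset.range k, c (s + (i + 1) * N)) *
        e (s + (k + 1) * N) ≤ A := by
      calc _ ≤ ∑ k ∈ Finset.range m, Real.exp (2 * K + 2 * ε * N) * Real.exp (-α) ^ k := by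
            refine Finset.sum_le_sum fun k _ => ?_
            refine (mul_le_mul_of_nonneg_left (he _)
              (Finset.prod_nonneg fun i _ => hc _)).trans ?_
            refine (mul_le_mul_of_nonneg_right (hprod k) (Real.exp_pos _).le).trans ?_
            rw [← Real.exp_nat_mul, ← Real.exp_add, ← Real.exp_add]
            refine Real.exp_le_exp.mpr ?_
            push_cast
            have hs' : ε * s ≤ ε * N :=
              mul_le_mul_of_nonneg_left (by exact_mod_cast hs.le) hε
            have h8 : α + N * ε ≤ lam :=
              (le_mul_of_one_le_left (by positivity) hN').trans hlam
            have h9 := mul_le_mul_of_nonneg_right h8 (Nat.cast_nonneg (α := ℝ) k)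
            nlinarith
        _ ≤ A := by
            rw [← Finset.mul_sum]
            refine mul_le_mul_of_nonneg_left ?_ (Real.exp_pos _).le
            rw [← tsum_geometric_of_lt_one (Real.exp_pos _).le hlt1]
            exact (summable_geometric_of_lt_one (Real.exp_pos _).le hlt1).sum_le_tsum _
              fun k _ => pow_nonneg (Real.exp_pos _).le k
    have h8 : V s ≤ D * Real.exp (-α * n) * (V n + Φ) + A * Φ := by
      have h9 := mul_le_mul_of_nonneg_right (hprod m) (hV (s + m * N))
      have h10 := mul_le_mul_of_nonneg_left h5 (Real.exp_pos (K - lam * m)).le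
      have h11 := mul_le_mul_of_nonneg_right h6 (add_nonneg (hV n) hΦ)
      have h12 := mul_le_mul_of_nonneg_right h7 hΦ
      linarith
    have h9 : Real.exp (-α * n) ≤ 1 := Real.exp_le_one_iff.mpr (by
      have := mul_nonneg hα.le (Nat.cast_nonneg (α := ℝ) n)
      linarith)
    have h10 : D * Real.exp (-α * n) * Φ ≤ D * Φ :=
      mul_le_mul_of_nonneg_right (mul_le_of_le_one_right hD0 h9) hΦ
    have h11 := mul_le_mul_of_nonneg_left (show V s + Φ ≤ D * Real.exp (-α * n) * V n +
      (D + A + 1) * Φ by linarith) (by linarith : 0 ≤ B)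
    have h12 : 0 ≤ B * (A + 1 + Real.exp (α * N)) * Real.exp (-α * n) * V n := by
      have := hV n
      positivity
    have h13 : 0 ≤ B * Real.exp (α * N) * Φ := by positivity
    linarith

/-- The least admissible index depends measurably on `ω`. The extra alternative in the search makes
it total, with value `0` where no index works. -/
theorem exists_measurable_nat_mem {Ω : Type*} [MeasurableSpace Ω] {Q : ℕ → Set Ω}
    (hQ : ∀ k, MeasurableSet (Q k)) :
    ∃ K : Ω → ℕ, Measurable K ∧ ∀ ω, (∃ k, ω ∈ Q k) → ω ∈ Q (K ω) := by
  classical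
  have hex : ∀ ω, ∃ k, ω ∈ Q k ∨ ∀ k', ω ∉ Q k' := fun ω => by
    by_cases h : ∃ k, ω ∈ Q k
    · exact ⟨h.choose, .inl h.choose_spec⟩
    · push Not at h
      exact ⟨0, .inr h⟩
  refine ⟨fun ω => Nat.find (hex ω), measurable_find hex fun k => ?_, fun ω h => ?_⟩
  · have : {ω | ω ∈ Q k ∨ ∀ k', ω ∉ Q k'} = Q k ∪ (⋃ k', Q k')ᶜ := by
      ext ω
      simp
    rw [this]
    exact (hQ k).union (MeasurableSet.iUnion hQ).compl
  · obtain ⟨k, hk⟩ := h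
    exact (Nat.find_spec (hex ω)).resolve_right fun h' => h' k hk

/-! ### The normalized operator and its Lasota–Yorke coefficients. -/

namespace RandomOpenSystem

variable {Ω : Type*} [MeasurableSpace Ω] {P : Measure Ω} {R : RandomOpenSystem Ω P} {ω : Ω}
  {x y a b : ℝ} {n : ℕ} {f : ℝ → ℝ} {𝒱 : Ω → ℕ → Set (Set ℝ)} {δ : Ω → ℕ → ℝ}

open RandomIntervalMap

theorem normTransferN_eq (n : ℕ) (ω : Ω) (f : ℝ → ℝ) :
    R.normTransferN n ω f = fun x => (R.rhoN n ω)⁻¹ * R.transferN n ω f x := rfl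

theorem normTransferN_add (p q : ℕ) (ω : Ω) (f : ℝ → ℝ) :
    R.normTransferN (p + q) ω f =
      R.normTransferN q (R.θ^[p] ω) (R.normTransferN p ω f) := by
  ext x
  rw [normTransferN_eq p, normTransferN_eq q, transferN_const_mul, normTransferN, transferN_add,
    rhoN_add, mul_inv]
  ring

theorem IsBddOn.normTransferN (hf : R.IsBddOn ω f) (n : ℕ) :
    R.IsBddOn (R.θ^[n] ω) (R.normTransferN n ω f) := (hf.transferN n).const_mul _

theorem normTransferN_zero (ω : Ω) (f : ℝ → ℝ) : R.normTransferN 0 ω f = f := by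
  ext x
  simp [RandomOpenSystem.normTransferN, rhoN, RandomOpenSystem.transferN]

theorem normTransferN_nonneg (hsupp : ∀ ω, (R.suppInfty ω).Nonempty)
    (hf : ∀ y ∈ R.X ω, 0 ≤ f y) (n : ℕ) (hx : x ∈ R.X (R.θ^[n] ω)) :
    0 ≤ R.normTransferN n ω f x :=
  mul_nonneg (inv_nonneg.mpr (rhoN_nonneg hsupp)) (transferN_nonneg hf n hx)

theorem abs_normTransferN_le (hsupp : ∀ ω, (R.suppInfty ω).Nonempty) (hf : R.IsBddOn ω f) (n : ℕ)
    (hx : x ∈ R.X (R.θ^[n] ω)) :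
    |R.normTransferN n ω f x| ≤ R.normTransferN n ω (fun y => |f y|) x := by
  rw [RandomOpenSystem.normTransferN, abs_mul, abs_of_nonneg (inv_nonneg.mpr (rhoN_nonneg hsupp))]
  exact mul_le_mul_of_nonneg_left (abs_transferN_le hf n hx) (inv_nonneg.mpr (rhoN_nonneg hsupp))

/-- `rhoN_mul_F_le` divided by `ρ^n`. It allows all error terms of the iteration to be replaced by
the one at the final time. -/
theorem F_le_F_normTransferN (hsupp : ∀ ω, (R.suppInfty ω).Nonempty) (hf : R.IsBddOn ω f)
    (h : ∀ y ∈ R.X ω, 0 ≤ f y) (hρ : 0 < R.rhoN n ω) :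
    R.F ω f ≤ R.F (R.θ^[n] ω) (R.normTransferN n ω f) := by
  rw [normTransferN_eq, F_const_mul hsupp (inv_nonneg.mpr hρ.le) (hf.transferN n),
    le_inv_mul_iff₀ hρ]
  exact rhoN_mul_F_le hsupp hf h n

theorem eVariationOn_const_mul_le (c : ℝ) (f : ℝ → ℝ) (s : Set ℝ) :
    eVariationOn (fun x => c * f x) s ≤ ‖c‖ₑ * eVariationOn f s := by
  -- The bound `⊤` for `f` is harmless: it multiplies the variation of a constant, and `⊤ * 0 = 0`.
  have h := eVariationOn.mul_le (fun _ => c) f (s := s) (Cf := ‖c‖ₑ) (Cg := ⊤)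
    (fun _ _ => le_rfl) fun _ _ => le_top
  have h0 : eVariationOn (fun _ : ℝ => c) s = 0 :=
    eVariationOn.constant_on fun _ ⟨_, _, h⟩ _ ⟨_, _, h'⟩ => h.symm.trans h'
  simpa [h0] using h

variable (R) in
/-- The coefficient of `F_ω |f|` in the Lasota–Yorke inequality for `ℒ̃_ω^n`. -/
noncomputable def lyConst (a b : ℝ) (𝒱 : Ω → ℕ → Set (Set ℝ)) (δ : Ω → ℕ → ℝ) (n : ℕ) (ω : Ω) :
    ℝ :=
  (R.rhoN n ω)⁻¹ * ((a + 2 * b) * ((1 + (R.eta n ω (𝒱 ω n) : ℝ)) / (2 * δ ω n) +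
    (R.eta n ω (𝒱 ω n) : ℝ)) * R.normWeight n ω)

variable (R) in
/-- An upper bound for the logarithms of both Lasota–Yorke coefficients. -/
noncomputable def lyLogBound (a b : ℝ) (𝒱 : Ω → ℕ → Set (Set ℝ)) (δ : Ω → ℕ → ℝ) (n : ℕ) (ω : Ω) :
    ℝ :=
  ∑ i ∈ Finset.range n, |Real.log (R.rho (R.θ^[i] ω))| +
    ∑ i ∈ Finset.range n, |Real.log (R.weightSum (R.θ^[i] ω))| +
    Real.log (3 * a + 6 * b + 1) + |Real.log (R.eta n ω (𝒱 ω n) : ℝ)| + |Real.log (δ ω n)|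

theorem lyLogBound_nonneg (ha : 0 ≤ a) (hb : 1 ≤ b) : 0 ≤ R.lyLogBound a b 𝒱 δ n ω := by
  have : 0 ≤ Real.log (3 * a + 6 * b + 1) := Real.log_nonneg (by linarith)
  unfold lyLogBound
  positivity

theorem integrable_lyLogBound [IsProbabilityMeasure P]
    (hS : Integrable (fun ω => Real.log (R.weightSum ω)) P)
    (hrho : Integrable (fun ω => Real.log (R.rho ω)) P)
    (hδ : Integrable (fun ω => Real.log (δ ω n)) P)
    (hη : Integrable (fun ω => Real.log (R.eta n ω (𝒱 ω n) : ℝ)) P) :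
    Integrable (R.lyLogBound a b 𝒱 δ n) P := by
  have hθ : ∀ i, MeasurePreserving R.θ^[i] P P := fun i =>
    R.ergodic.toMeasurePreserving.iterate i
  exact ((((integrable_finsetSum _ fun i _ => (hθ i).integrable_comp_of_integrable hrho.abs).add
    (integrable_finsetSum _ fun i _ => (hθ i).integrable_comp_of_integrable hS.abs)).add
      (integrable_const _)).add hη.abs).add hδ.abs

/-- Valid for every real `t`, including `t = 0` where `Real.log` is `0`, so `η = 0` needs no
separate treatment. -/
theorem le_exp_abs_log (t : ℝ) : t ≤ Real.exp |Real.log t| :=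
  (Real.le_exp_log t).trans (Real.exp_le_exp.mpr (le_abs_self _))

theorem inv_le_exp_abs_log {t : ℝ} : t⁻¹ ≤ Real.exp |Real.log t| := by
  rw [← abs_neg, ← Real.log_inv]
  exact le_exp_abs_log _

theorem inv_rhoN_mul_normWeight_le (hsupp : ∀ ω, (R.suppInfty ω).Nonempty) :
    (R.rhoN n ω)⁻¹ * R.normWeight n ω ≤
      Real.exp (∑ i ∈ Finset.range n, |Real.log (R.rho (R.θ^[i] ω))| +
        ∑ i ∈ Finset.range n, |Real.log (R.weightSum (R.θ^[i] ω))|) := by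
  rw [Real.exp_add, Real.exp_sum, Real.exp_sum, rhoN, ← Finset.prod_inv_distrib]
  refine mul_le_mul (Finset.prod_le_prod (fun i _ => inv_nonneg.mpr (rho_nonneg hsupp))
    fun i _ => inv_le_exp_abs_log) (normWeight_le_prod.trans (Finset.prod_le_prod
    (fun i _ => weightSum_nonneg) fun i _ => le_exp_abs_log _)) normWeight_nonneg (by positivity)

theorem lyCoeff_nonneg (hsupp : ∀ ω, (R.suppInfty ω).Nonempty) (ha : 0 ≤ a) (hb : 1 ≤ b) :
    0 ≤ R.lyCoeff a b 𝒱 n ω := by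
  have h1 := inv_nonneg.mpr (rhoN_nonneg (n := n) (ω := ω) hsupp)
  have h2 := normWeight_nonneg (R := R) (n := n) (ω := ω)
  have h3 : 0 ≤ b := by linarith
  unfold lyCoeff
  positivity

theorem one_le_exp_abs_log_cast (k : ℕ) : 1 ≤ Real.exp |Real.log (k : ℝ)| :=
  Real.one_le_exp (abs_nonneg _)

theorem lyCoeff_le_exp (hsupp : ∀ ω, (R.suppInfty ω).Nonempty) (ha : 0 ≤ a) (hb : 1 ≤ b) :
    R.lyCoeff a b 𝒱 n ω ≤ Real.exp (R.lyLogBound a b 𝒱 δ n ω) := by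
  set E := Real.exp |Real.log (R.eta n ω (𝒱 ω n) : ℝ)| with hE
  have h1 : 1 ≤ E := one_le_exp_abs_log_cast _
  have h2 : (R.eta n ω (𝒱 ω n) : ℝ) ≤ E := le_exp_abs_log _
  have h3 : 1 ≤ Real.exp |Real.log (δ ω n)| := Real.one_le_exp (abs_nonneg _)
  have hpos : 0 < 3 * a + 6 * b + 1 := by linarith
  have h4 : a + 2 * b + 1 + (2 * a + 4 * b) * (R.eta n ω (𝒱 ω n) : ℝ) ≤
      (3 * a + 6 * b + 1) * E := by
    have h5 := mul_le_mul_of_nonneg_left h2 (by linarith : 0 ≤ 2 * a + 4 * b)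
    have h6 := mul_le_mul_of_nonneg_left h1 (by linarith : 0 ≤ a + 2 * b + 1)
    linarith
  unfold lyLogBound
  rw [Real.exp_add, Real.exp_add, Real.exp_add, Real.exp_log hpos, lyCoeff, ← hE]
  have h0 := inv_nonneg.mpr (rhoN_nonneg (n := n) (ω := ω) hsupp)
  have hw := normWeight_nonneg (R := R) (n := n) (ω := ω)
  calc _ = ((R.rhoN n ω)⁻¹ * R.normWeight n ω) *
        (a + 2 * b + 1 + (2 * a + 4 * b) * (R.eta n ω (𝒱 ω n) : ℝ)) := by ring
    _ ≤ Real.exp (∑ i ∈ Finset.range n, |Real.log (R.rho (R.θ^[i] ω))| +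
        ∑ i ∈ Finset.range n, |Real.log (R.weightSum (R.θ^[i] ω))|) *
          ((3 * a + 6 * b + 1) * E) := by
        have : 0 ≤ b := by linarith
        refine mul_le_mul (inv_rhoN_mul_normWeight_le hsupp) h4 (by positivity) (by positivity)
    _ ≤ _ := by
        rw [← mul_assoc]
        exact le_mul_of_one_le_right (by positivity) h3

theorem lyConst_le_exp (hsupp : ∀ ω, (R.suppInfty ω).Nonempty) (ha : 0 ≤ a) (hb : 1 ≤ b)
    (hδ : 0 < δ ω n) :
    R.lyConst a b 𝒱 δ n ω ≤ Real.exp (R.lyLogBound a b 𝒱 δ n ω) := by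
  set E := Real.exp |Real.log (R.eta n ω (𝒱 ω n) : ℝ)| with hE
  have h1 : 1 ≤ E := one_le_exp_abs_log_cast _
  have h2 : (R.eta n ω (𝒱 ω n) : ℝ) ≤ E := le_exp_abs_log _
  set D := Real.exp |Real.log (δ ω n)| with hD
  have h3 : 1 ≤ D := Real.one_le_exp (abs_nonneg _)
  have hDδ : (δ ω n)⁻¹ ≤ D := inv_le_exp_abs_log
  have hpos : 0 < 3 * a + 6 * b + 1 := by linarith
  have h4 : (1 + (R.eta n ω (𝒱 ω n) : ℝ)) / (2 * δ ω n) ≤ E * D := by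
    have : (1 + (R.eta n ω (𝒱 ω n) : ℝ)) / (2 * δ ω n) =
        ((1 + (R.eta n ω (𝒱 ω n) : ℝ)) / 2) * (δ ω n)⁻¹ := by
      rw [div_mul_eq_div_div, div_eq_mul_inv _ (δ ω n)]
    rw [this]
    exact mul_le_mul (by linarith) hDδ (inv_nonneg.mpr hδ.le) (by positivity)
  have h5 : (a + 2 * b) * ((1 + (R.eta n ω (𝒱 ω n) : ℝ)) / (2 * δ ω n) +
      (R.eta n ω (𝒱 ω n) : ℝ)) ≤ (3 * a + 6 * b + 1) * E * D := by
    have h6 : (R.eta n ω (𝒱 ω n) : ℝ) ≤ E * D :=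
      h2.trans (le_mul_of_one_le_right (by positivity) h3)
    have h7 := mul_le_mul_of_nonneg_left (add_le_add h4 h6) (by linarith : 0 ≤ a + 2 * b)
    have h8 : 0 ≤ (a + 2 * b + 1) * (E * D) := mul_nonneg (by linarith) (by positivity)
    linarith
  unfold lyLogBound
  rw [Real.exp_add, Real.exp_add, Real.exp_add, Real.exp_log hpos, lyConst, ← hE, ← hD]
  have h0 := inv_nonneg.mpr (rhoN_nonneg (n := n) (ω := ω) hsupp)
  have hw := normWeight_nonneg (R := R) (n := n) (ω := ω)
  calc _ = ((R.rhoN n ω)⁻¹ * R.normWeight n ω) *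
        ((a + 2 * b) * ((1 + (R.eta n ω (𝒱 ω n) : ℝ)) / (2 * δ ω n) +
          (R.eta n ω (𝒱 ω n) : ℝ))) := by ring
    _ ≤ Real.exp (∑ i ∈ Finset.range n, |Real.log (R.rho (R.θ^[i] ω))| +
        ∑ i ∈ Finset.range n, |Real.log (R.weightSum (R.θ^[i] ω))|) *
          ((3 * a + 6 * b + 1) * E * D) := by
        have : 0 ≤ b := by linarith
        refine mul_le_mul (inv_rhoN_mul_normWeight_le hsupp) h5 (by positivity) (by positivity)
    _ = _ := by ring

section LasotaYorke

variable (hsupp : ∀ ω, (R.suppInfty ω).Nonempty) (ha : 0 ≤ a) (hb : 1 ≤ b)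
  {𝒰 : Ω → ℕ → Set (Set ℝ)} (h𝒰 : ∀ ω, ∀ n ≥ 1, R.IsAdmissible a b n ω (𝒰 ω n))
  (h𝒱 : ∀ ω, ∀ n ≥ 1, R.IsAdaptedRefinement n ω (𝒰 ω n) (𝒱 ω n))
  (hδ_pos : ∀ ω, ∀ n ≥ 1, 0 < δ ω n)
  (hgood : ∀ ω, ∀ n ≥ 1, ∀ U ∈ R.good n ω (𝒱 ω n), 2 * δ ω n ≤ R.F ω (U.indicator 1))
include hsupp ha hb h𝒰 h𝒱 hδ_pos hgood

/-- The Lasota–Yorke inequality for `ℒ̃_ω^n`. -/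
theorem eVariationOn_normTransferN_le (hn : 1 ≤ n) (hf : BoundedVariationOn f (R.X ω)) :
    eVariationOn (R.normTransferN n ω f) (R.X (R.θ^[n] ω)) ≤ ENNReal.ofReal
      (R.lyCoeff a b 𝒱 n ω * (eVariationOn f (R.X ω)).toReal +
        R.lyConst a b 𝒱 δ n ω * R.F ω fun x => |f x|) := by
  have h := RandomOpenSystem.eVariationOn_transferN_le hsupp ha hb hn (h𝒰 ω n hn) (h𝒱 ω n hn)
    (hδ_pos ω n hn) (hgood ω n hn) hf
  have hρ := inv_nonneg.mpr (rhoN_nonneg (n := n) (ω := ω) hsupp)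
  rw [normTransferN_eq]
  refine (eVariationOn_const_mul_le _ _ _).trans ((mul_le_mul_right h _).trans ?_)
  rw [Real.enorm_eq_ofReal hρ, ← ENNReal.ofReal_mul hρ, lyCoeff, lyConst]
  refine ENNReal.ofReal_le_ofReal (le_of_eq ?_)
  ring

theorem boundedVariationOn_normTransferN (hf : BoundedVariationOn f (R.X ω)) (n : ℕ) :
    BoundedVariationOn (R.normTransferN n ω f) (R.X (R.θ^[n] ω)) := by
  rcases Nat.eq_zero_or_pos n with rfl | hn
  · rw [normTransferN_zero]
    exact hf
  · exact ne_top_of_le_ne_top ENNReal.ofReal_ne_top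
      (eVariationOn_normTransferN_le hsupp ha hb h𝒰 h𝒱 hδ_pos hgood hn hf)

/-- One step of the iteration of the Lasota–Yorke inequality: `p` steps have been made, `q` are
made now, and `r` are left. -/
theorem toReal_eVariationOn_normTransferN_add_le {p q r : ℕ} (hq : 1 ≤ q)
    (hρ : 0 < R.rhoN (q + r) (R.θ^[p] ω)) (hf : BoundedVariationOn f (R.X ω)) :
    (eVariationOn (R.normTransferN (p + q) ω f) (R.X (R.θ^[p + q] ω))).toReal ≤
      R.lyCoeff a b 𝒱 q (R.θ^[p] ω) *
          (eVariationOn (R.normTransferN p ω f) (R.X (R.θ^[p] ω))).toReal +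
        R.lyConst a b 𝒱 δ q (R.θ^[p] ω) * R.F (R.θ^[p + (q + r)] ω)
          (R.normTransferN (p + (q + r)) ω fun x => |f x|) := by
  have hfb := isBddOn_of_boundedVariationOn hf
  have hp := boundedVariationOn_normTransferN hsupp ha hb h𝒰 h𝒱 hδ_pos hgood hf p
  have h := eVariationOn_normTransferN_le hsupp ha hb h𝒰 h𝒱 hδ_pos hgood hq hp
  have hpb := isBddOn_of_boundedVariationOn hp
  have hθ : ∀ k, R.θ^[p + k] ω = R.θ^[k] (R.θ^[p] ω) := fun k => by
    rw [add_comm, Function.iterate_add_apply]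
  -- The error term at time `p` is first bounded through positivity, then carried over the remaining
  -- `q + r` steps. This makes it the same for all steps of the iteration.
  have hF : R.F (R.θ^[p] ω) (fun x => |R.normTransferN p ω f x|) ≤ R.F (R.θ^[p + (q + r)] ω)
      (R.normTransferN (p + (q + r)) ω fun x => |f x|) := by
    rw [hθ, normTransferN_add]
    exact (F_mono hsupp hpb.abs (hfb.abs.normTransferN p)
      fun y hy => abs_normTransferN_le hsupp hfb p hy).trans
      (F_le_F_normTransferN hsupp (hfb.abs.normTransferN p) (fun y hy =>
        normTransferN_nonneg hsupp (fun _ _ => abs_nonneg _) p hy) hρ)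
  have hF0 : 0 ≤ R.F (R.θ^[p] ω) (fun x => |R.normTransferN p ω f x|) :=
    F_nonneg hsupp hpb.abs fun _ _ => abs_nonneg _
  have hC := lyCoeff_nonneg (R := R) (𝒱 := 𝒱) (n := q) (ω := R.θ^[p] ω) hsupp ha hb
  have hD : 0 ≤ R.lyConst a b 𝒱 δ q (R.θ^[p] ω) := by
    have h1 := inv_nonneg.mpr (rhoN_nonneg (n := q) (ω := R.θ^[p] ω) hsupp)
    have h2 := normWeight_nonneg (R := R) (n := q) (ω := R.θ^[p] ω)
    have h3 : 0 ≤ b := by linarith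
    have h4 := (hδ_pos (R.θ^[p] ω) q hq).le
    unfold lyConst
    positivity
  rw [← normTransferN_add, ← hθ] at h
  refine (ENNReal.toReal_mono ENNReal.ofReal_ne_top h).trans ?_
  rw [ENNReal.toReal_ofReal (by positivity)]
  gcongr

end LasotaYorke

end RandomOpenSystem

/-! ### Iteration along backward orbits. -/

namespace RandomOpenSystem

variable {Ω : Type*} [MeasurableSpace Ω] {P : Measure Ω} {R : RandomOpenSystem Ω P} {a b : ℝ}
  {𝒱 : Ω → ℕ → Set (Set ℝ)}

theorem iterate_symm_apply (k j : ℕ) (ω : Ω) :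
    R.θ^[k] (R.θ.symm^[k + j] ω) = R.θ.symm^[j] ω := by
  rw [Function.iterate_add_apply]
  exact (show Function.LeftInverse R.θ R.θ.symm from R.θ.apply_symm_apply).iterate k _

theorem rhoN_pos_of_backward {ω : Ω} (h : ∀ j, 0 < R.rho (R.θ.symm^[j] ω)) (n : ℕ) :
    0 < R.rhoN n (R.θ.symm^[n] ω) := by
  refine Finset.prod_pos fun i hi => ?_
  obtain ⟨k, rfl⟩ := Nat.exists_eq_add_of_le (Finset.mem_range.mp hi).le
  rw [iterate_symm_apply]
  exact h k

theorem xi_pos {N : ℕ} (h : R.IsContractionTime a b 𝒱 N) : 0 < R.xi a b 𝒱 N := by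
  have hN : (0 : ℝ) < N := by exact_mod_cast h.1
  unfold xi
  rw [neg_mul, neg_pos]
  exact mul_neg_of_pos_of_neg (by positivity) h.2.2

/-- A block arriving at `θ^{-j} ω` has its coefficient at its starting fiber `θ^{-(j+N)} ω`, hence
the shift of `L` by `N` in the summed function. -/
theorem lyCoeff_prod_le_exp {N s m : ℕ} {ω : Ω} {L : Ω → ℝ} {lam K : ℝ}
    (hsupp : ∀ ω, (R.suppInfty ω).Nonempty) (ha : 0 ≤ a) (hb : 1 ≤ b)
    (hL : ∀ j, Real.log (R.lyCoeff a b 𝒱 N (R.θ.symm^[j] ω)) = L (R.θ.symm^[j] ω))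
    (hK : birkhoffSum R.θ.symm^[N] (fun ω => L (R.θ.symm^[N] ω) + lam) m (R.θ.symm^[s] ω) ≤ K) :
    ∏ k ∈ Finset.range m, R.lyCoeff a b 𝒱 N (R.θ.symm^[s + (k + 1) * N] ω) ≤
      Real.exp (K - lam * m) := by
  have h1 : ∏ k ∈ Finset.range m, R.lyCoeff a b 𝒱 N (R.θ.symm^[s + (k + 1) * N] ω) ≤
      Real.exp (∑ k ∈ Finset.range m, L (R.θ.symm^[s + (k + 1) * N] ω)) := by
    rw [Real.exp_sum]
    refine Finset.prod_le_prod (fun k _ => lyCoeff_nonneg hsupp ha hb) fun k _ => ?_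
    rw [← hL]
    exact Real.le_exp_log _
  refine h1.trans (Real.exp_le_exp.mpr ?_)
  have h2 : birkhoffSum R.θ.symm^[N] (fun ω => L (R.θ.symm^[N] ω) + lam) m (R.θ.symm^[s] ω) =
      ∑ k ∈ Finset.range m, L (R.θ.symm^[s + (k + 1) * N] ω) + lam * m := by
    rw [birkhoffSum, Finset.sum_add_distrib, Finset.sum_const, Finset.card_range, nsmul_eq_mul,
      mul_comm lam]
    congr 1
    refine Finset.sum_congr rfl fun k _ => ?_
    rw [← Function.iterate_mul, ← Function.iterate_add_apply, ← Function.iterate_add_apply]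
    congr 2
    ring
  linarith

theorem exists_lasotaYorke_of_lt_xi [IsProbabilityMeasure P]
    (hS : Integrable (fun ω => Real.log (R.weightSum ω)) P)
    (hsupp : ∀ ω, (R.suppInfty ω).Nonempty)
    (hrho_pos : ∀ᵐ ω ∂P, 0 < R.rho ω)
    (hrho : Integrable (fun ω => Real.log (R.rho ω)) P)
    (ha : 0 ≤ a) (hb : 1 ≤ b) {𝒰 : Ω → ℕ → Set (Set ℝ)}
    (h𝒰 : ∀ ω, ∀ n ≥ 1, R.IsAdmissible a b n ω (𝒰 ω n))
    (h𝒱 : ∀ ω, ∀ n ≥ 1, R.IsAdaptedRefinement n ω (𝒰 ω n) (𝒱 ω n))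
    {δ : Ω → ℕ → ℝ} (hδ_pos : ∀ ω, ∀ n ≥ 1, 0 < δ ω n)
    (hδ : ∀ n ≥ 1, Integrable (fun ω => Real.log (δ ω n)) P)
    (hgood : ∀ ω, ∀ n ≥ 1, ∀ U ∈ R.good n ω (𝒱 ω n), 2 * δ ω n ≤ R.F ω (U.indicator 1))
    (hη : ∀ n ≥ 1, Integrable (fun ω => Real.log (R.eta n ω (𝒱 ω n) : ℝ)) P)
    {N : ℕ} (hN : R.IsContractionTime a b 𝒱 N) {ε : ℝ} (hε : 0 < ε) (hεξ : ε < R.xi a b 𝒱 N) :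
    ∃ C : Ω → ℝ, Measurable C ∧ (∀ ω, 0 < C ω) ∧
      ∀ᵐ ω ∂P, ∀ n, ∀ f : ℝ → ℝ, BoundedVariationOn f (R.X (R.θ.symm^[n] ω)) →
        eVariationOn (R.normTransferN n (R.θ.symm^[n] ω) f) (R.X ω) ≤
          ENNReal.ofReal
            (C ω * Real.exp (-(R.xi a b 𝒱 N - ε) * n) *
                (eVariationOn f (R.X (R.θ.symm^[n] ω))).toReal +
              C ω * R.F ω (R.normTransferN n (R.θ.symm^[n] ω) fun x => |f x|)) := by
  obtain ⟨hN1, hCint, -⟩ := hN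
  have hN1' : (1 : ℝ) ≤ N := by exact_mod_cast hN1
  have hσ : Ergodic R.θ.symm P := R.ergodic.symm
  have hσj : ∀ j, MeasurePreserving R.θ.symm^[j] P P := fun j => hσ.toMeasurePreserving.iterate j
  have all_iter : ∀ {p : Ω → Prop}, (∀ᵐ ω ∂P, p ω) → ∀ᵐ ω ∂P, ∀ j, p (R.θ.symm^[j] ω) :=
    fun hp => ae_all_iff.mpr fun j => (hσj j).quasiMeasurePreserving.ae hp
  set ξ := R.xi a b 𝒱 N with hξ
  -- measurable versions of the logarithms of the coefficients
  set L : Ω → ℝ := hCint.1.mk _ with hLdef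
  have hLm : Measurable L := hCint.1.stronglyMeasurable_mk.measurable
  have hLeq : ∀ᵐ ω ∂P, Real.log (R.lyCoeff a b 𝒱 N ω) = L ω := hCint.1.ae_eq_mk
  have hLint : Integrable L P := hCint.congr hLeq
  have hLval : ∫ ω, L ω ∂P = -(N * ξ) := by
    rw [← integral_congr_ae hLeq, hξ, xi]
    field_simp
  have hd₀ : Integrable (fun ω => R.lyLogBound a b 𝒱 δ 1 ω + R.lyLogBound a b 𝒱 δ N ω) P :=
    (integrable_lyLogBound hS hrho (hδ 1 le_rfl) (hη 1 le_rfl)).add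
      (integrable_lyLogBound hS hrho (hδ N hN1) (hη N hN1))
  -- A single function serves the one-step and the `N`-step coefficients. The absolute value makes
  -- it nonnegative everywhere, as the growth lemma requires.
  set d : Ω → ℝ := fun ω => |hd₀.1.mk _ ω| with hddef
  have hdm : Measurable d := hd₀.1.stronglyMeasurable_mk.measurable.abs
  have hdint : Integrable d P := (hd₀.congr hd₀.1.ae_eq_mk).abs
  have hdle : ∀ᵐ ω ∂P, R.lyLogBound a b 𝒱 δ 1 ω + R.lyLogBound a b 𝒱 δ N ω ≤ d ω := by
    filter_upwards [hd₀.1.ae_eq_mk] with ω hω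
    rw [hω]
    exact le_abs_self _
  -- the parameters of the iteration
  set lam : ℝ := N * ξ - ε / 2 with hlam
  set κ : ℝ := ε / (2 * N) with hκ
  have hκ0 : 0 < κ := by positivity
  have hNκ : N * κ = ε / 2 := by
    rw [hκ]
    field_simp
  -- The left side equals `N ξ - N ε / 2`, so `N ≥ 1` suffices. The remaining gap `ε / 2` between
  -- `lam` and `N ξ` makes the mean in `hneg` negative.
  have hparam : N * ((ξ - ε) + N * κ) ≤ lam := by
    rw [hNκ, hlam]
    nlinarith
  have hh : Integrable (fun ω => L (R.θ.symm^[N] ω) + lam) P :=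
    ((hσj N).integrable_comp_of_integrable hLint).add (integrable_const _)
  have hhm : Measurable (fun ω => L (R.θ.symm^[N] ω) + lam) :=
    (hLm.comp (hσj N).measurable).add_const _
  have hneg : ∫ ω, (L (R.θ.symm^[N] ω) + lam) ∂P < 0 := by
    have hcomp : ∫ ω, L (R.θ.symm^[N] ω) ∂P = ∫ ω, L ω ∂P := by
      rw [← integral_map (hσj N).measurable.aemeasurable hLm.aestronglyMeasurable,
        (hσj N).map_eq]
    have hLN : Integrable (fun ω => L (R.θ.symm^[N] ω)) P :=
      (hσj N).integrable_comp_of_integrable hLint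
    rw [integral_add hLN (integrable_const _), hcomp, hLval, integral_const, probReal_univ,
      one_smul, hlam]
    linarith
  -- All dependence on `ω` is gathered in one integer bound `K`. The phase `s` need not be selected
  -- measurably, because the constant `Ψ` is uniform over `s < N`.
  set Q : ℕ → Set Ω := fun K => {ω | (∃ s < N, ∀ m : ℕ,
    birkhoffSum R.θ.symm^[N] (fun ω => L (R.θ.symm^[N] ω) + lam) m (R.θ.symm^[s] ω) ≤ K) ∧
    ∀ j : ℕ, d (R.θ.symm^[j] ω) - κ * j ≤ K} with hQ
  have hQm : ∀ K, MeasurableSet (Q K) := by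
    intro K
    have hsum : ∀ m, Measurable (birkhoffSum R.θ.symm^[N]
        (fun ω => L (R.θ.symm^[N] ω) + lam) m) := fun m => by
      unfold birkhoffSum
      exact Finset.measurable_fun_sum _ fun k _ => hhm.comp ((hσj N).measurable.iterate k)
    refine MeasurableSet.inter (s₁ := {ω | ∃ s < N, ∀ m : ℕ, birkhoffSum R.θ.symm^[N]
      (fun ω => L (R.θ.symm^[N] ω) + lam) m (R.θ.symm^[s] ω) ≤ K})
      (s₂ := {ω | ∀ j : ℕ, d (R.θ.symm^[j] ω) - κ * j ≤ K}) ?_ ?_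
    · have : {ω | ∃ s < N, ∀ m : ℕ, birkhoffSum R.θ.symm^[N]
          (fun ω => L (R.θ.symm^[N] ω) + lam) m (R.θ.symm^[s] ω) ≤ K} =
          ⋃ s, ⋃ _ : s < N, ⋂ m, {ω | birkhoffSum R.θ.symm^[N]
            (fun ω => L (R.θ.symm^[N] ω) + lam) m (R.θ.symm^[s] ω) ≤ K} := by
        ext ω
        simp
      rw [this]
      exact .iUnion fun s => .iUnion fun _ => .iInter fun m =>
        measurableSet_le ((hsum m).comp (hσj s).measurable) measurable_const
    · have : {ω | ∀ j : ℕ, d (R.θ.symm^[j] ω) - κ * j ≤ K} =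
          ⋂ j : ℕ, {ω | d (R.θ.symm^[j] ω) - κ * j ≤ K} := by
        ext ω
        simp
      rw [this]
      exact .iInter fun j =>
        measurableSet_le ((hdm.comp (hσj j).measurable).sub_const _) measurable_const
  obtain ⟨K, hKm, hK⟩ := exists_measurable_nat_mem hQm
  choose Ψ hΨ0 hΨ using fun k : ℕ => exists_exp_bound_of_block N (α := ξ - ε) (ε := κ)
    (lam := lam) (k : ℝ) (by linarith) hκ0.le hN1 hparam (Nat.cast_nonneg k)
  refine ⟨fun ω => Ψ (K ω), (measurable_from_top (f := Ψ)).comp hKm, fun ω => hΨ0 _, ?_⟩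
  filter_upwards [hσ.ae_exists_bddAbove_birkhoffSum_iterate hh hhm hneg hN1,
    hσ.toMeasurePreserving.ae_bddAbove_sub_mul hdint hdm (fun ω => abs_nonneg _) hκ0,
    all_iter hLeq, all_iter hdle, all_iter hrho_pos] with ω hω1 hω2 hωL hωd hωρ
  have hQω : ω ∈ Q (K ω) := by
    refine hK ω ?_
    obtain ⟨s, hs, K₁, hK₁⟩ := hω1
    obtain ⟨K₂, hK₂⟩ := hω2
    obtain ⟨k, hk⟩ := exists_nat_ge (max K₁ K₂)
    exact ⟨k, ⟨s, hs, fun m => (hK₁ ⟨m, rfl⟩).trans ((le_max_left _ _).trans hk)⟩,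
      fun j => (hK₂ ⟨j, rfl⟩).trans ((le_max_right _ _).trans hk)⟩
  obtain ⟨⟨s, hs, hsum⟩, hdK⟩ := hQω
  intro n f hf
  have hfb := isBddOn_of_boundedVariationOn hf
  have hθn : R.θ^[n] (R.θ.symm^[n] ω) = ω := iterate_symm_apply n 0 ω
  have hfin := boundedVariationOn_normTransferN hsupp ha hb h𝒰 h𝒱 hδ_pos hgood hf n
  rw [hθn] at hfin
  set ω' := R.θ.symm^[n] ω with hω'
  set Φ := R.F ω (R.normTransferN n ω' fun x => |f x|) with hΦdef
  have hΦ : 0 ≤ Φ := by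
    have hb' := hfb.abs.normTransferN n
    rw [hθn] at hb'
    refine F_nonneg hsupp hb' fun y hy => normTransferN_nonneg hsupp (fun _ _ => abs_nonneg _) n ?_
    rwa [hθn]
  -- Time is reversed: `V j` is the variation on the fiber over `θ^{-j} ω`, after `n - j` steps from
  -- `θ^{-n} ω`.
  set V : ℕ → ℝ := fun j =>
    (eVariationOn (R.normTransferN (n - j) ω' f) (R.X (R.θ.symm^[j] ω))).toReal with hV
  have hV0 : ∀ j, 0 ≤ V j := fun j => ENNReal.toReal_nonneg
  have step : ∀ j q, 1 ≤ q → j + q ≤ n → V j ≤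
      R.lyCoeff a b 𝒱 q (R.θ.symm^[j + q] ω) * V (j + q) +
        R.lyConst a b 𝒱 δ q (R.θ.symm^[j + q] ω) * Φ := by
    intro j q hq hjq
    obtain ⟨p, rfl⟩ := Nat.exists_eq_add_of_le hjq
    have h1 : R.θ^[p] ω' = R.θ.symm^[j + q] ω := by
      rw [hω', add_comm (j + q) p]
      exact iterate_symm_apply p _ ω
    have h2 : R.θ^[p + q] ω' = R.θ.symm^[j] ω := by
      rw [hω', show j + q + p = p + q + j by ring]
      exact iterate_symm_apply (p + q) j ω
    have h3 : p + (q + j) = j + q + p := by ring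
    have h := toReal_eVariationOn_normTransferN_add_le (r := j) hsupp ha hb h𝒰 h𝒱 hδ_pos hgood hq
      (by rw [h1, add_comm q j]; exact rhoN_pos_of_backward hωρ _) (p := p) hf
    rw [h3, hθn, h1, h2] at h
    have h4 : j + q + p - j = p + q := by omega
    have h5 : j + q + p - (j + q) = p := by omega
    simp only [hV, h4, h5]
    exact h
  have hΨω := hΨ (K ω) n s V (fun i => R.lyCoeff a b 𝒱 N (R.θ.symm^[i] ω))
    (fun i => Real.exp (d (R.θ.symm^[i] ω))) Φ hs hV0 hΦ
    (fun i => lyCoeff_nonneg hsupp ha hb)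
    (fun i => Real.exp_le_exp.mpr (by linarith [hdK i]))
    (fun m => lyCoeff_prod_le_exp hsupp ha hb hωL (hsum m))
    (fun j hj => (step j N hN1 hj).trans (by
      have h1 := hωd (j + N)
      have h2 := lyLogBound_nonneg (R := R) (𝒱 := 𝒱) (δ := δ) (n := 1)
        (ω := R.θ.symm^[j + N] ω) ha hb
      have h3 := lyConst_le_exp (R := R) (𝒱 := 𝒱) (δ := δ) hsupp ha hb
        (hδ_pos (R.θ.symm^[j + N] ω) N hN1)
      gcongr
      exact h3.trans (Real.exp_le_exp.mpr (by linarith))))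
    (fun j hj => (step j 1 le_rfl hj).trans (by
      have h1 := hωd (j + 1)
      have h2 := lyLogBound_nonneg (R := R) (𝒱 := 𝒱) (δ := δ) (n := N)
        (ω := R.θ.symm^[j + 1] ω) ha hb
      have h3 := lyConst_le_exp (R := R) (𝒱 := 𝒱) (δ := δ) hsupp ha hb
        (hδ_pos (R.θ.symm^[j + 1] ω) 1 le_rfl)
      have h4 := lyCoeff_le_exp (R := R) (𝒱 := 𝒱) (δ := δ) (n := 1)
        (ω := R.θ.symm^[j + 1] ω) hsupp ha hb
      have h5 := hV0 (j + 1)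
      have h6 : Real.exp (R.lyLogBound a b 𝒱 δ 1 (R.θ.symm^[j + 1] ω)) ≤
        Real.exp (d (R.θ.symm^[j + 1] ω)) := Real.exp_le_exp.mpr (by linarith)
      gcongr
      · exact h4.trans h6
      · exact h3.trans h6))
  have hV0' : V 0 = (eVariationOn (R.normTransferN n ω' f) (R.X ω)).toReal := rfl
  have hVn : V n = (eVariationOn f (R.X ω')).toReal := by
    simp only [hV, Nat.sub_self, normTransferN_zero, hω']
  rw [hV0', hVn] at hΨω
  rw [← ENNReal.ofReal_toReal hfin]
  exact ENNReal.ofReal_le_ofReal hΨω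

end RandomOpenSystem

/-! ### The proposition. -/

theorem proposition3p4 {Ω : Type*} [MeasurableSpace Ω] (P : Measure Ω) [IsProbabilityMeasure P]
    (R : RandomOpenSystem Ω P)
    (hS : Integrable (fun ω => Real.log (R.weightSum ω)) P)
    (hsupp : ∀ ω, (R.suppInfty ω).Nonempty)
    (hrho_pos : ∀ᵐ ω ∂P, 0 < R.rho ω)
    (hrho : Integrable (fun ω => Real.log (R.rho ω)) P)
    (a b : ℝ) (ha : 0 ≤ a) (hb : 1 ≤ b)
    (𝒰 𝒱 : Ω → ℕ → Set (Set ℝ))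
    (h𝒰 : ∀ ω, ∀ n ≥ 1, R.IsAdmissible a b n ω (𝒰 ω n))
    (h𝒱 : ∀ ω, ∀ n ≥ 1, R.IsAdaptedRefinement n ω (𝒰 ω n) (𝒱 ω n))
    (δ : Ω → ℕ → ℝ) (hδ_pos : ∀ ω, ∀ n ≥ 1, 0 < δ ω n)
    (hδ : ∀ n ≥ 1, Integrable (fun ω => Real.log (δ ω n)) P)
    (hgood : ∀ ω, ∀ n ≥ 1, ∀ U ∈ R.good n ω (𝒱 ω n), 2 * δ ω n ≤ R.F ω (U.indicator 1))
    (hη : ∀ n ≥ 1, Integrable (fun ω => Real.log (R.eta n ω (𝒱 ω n) : ℝ)) P)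
    (Nc : ℕ) (hNc : IsLeast {N : ℕ | R.IsContractionTime a b 𝒱 N} Nc) :
    0 < R.xi a b 𝒱 Nc ∧
    ∀ ε > 0, ∃ C : Ω → ℝ, Measurable C ∧ (∀ ω, 0 < C ω) ∧
      ∀ᵐ ω ∂P, ∀ n ≥ 1, ∀ f : ℝ → ℝ, BoundedVariationOn f (R.X (R.θ.symm^[n] ω)) →
        eVariationOn (R.normTransferN n (R.θ.symm^[n] ω) f) (R.X ω) ≤
          ENNReal.ofReal
            (C ω * Real.exp (-(R.xi a b 𝒱 Nc - ε) * n) *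
                (eVariationOn f (R.X (R.θ.symm^[n] ω))).toReal +
              C ω * R.F ω (R.normTransferN n (R.θ.symm^[n] ω) fun x => |f x|)) := by
  refine ⟨RandomOpenSystem.xi_pos hNc.1, fun ε hε => ?_⟩
  have hξ := RandomOpenSystem.xi_pos hNc.1
  set ξ := R.xi a b 𝒱 Nc with hξdef
  -- The iteration needs a positive rate `ξ - ε`. Replacing `ε` by `min ε (ξ / 2)` ensures this and
  -- only strengthens the estimate.
  obtain ⟨C, hCm, hC0, hC⟩ := RandomOpenSystem.exists_lasotaYorke_of_lt_xi hS hsupp hrho_pos hrho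
    ha hb h𝒰 h𝒱 hδ_pos hδ hgood hη hNc.1 (ε := min ε (ξ / 2)) (by positivity)
    ((min_le_right _ _).trans_lt (by linarith))
  refine ⟨C, hCm, hC0, ?_⟩
  filter_upwards [hC] with ω hω n _ f hf
  refine (hω n f hf).trans (ENNReal.ofReal_le_ofReal ?_)
  have := (hC0 ω).le
  gcongr
  exact min_le_left _ _
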